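/- Let $2^{<\omega}$ be the set of finite binary strings; write $\sigma\prec\tau$ if $\sigma$ is a proper initial segment of $\tau$, and let $[2^{<\omega}]^2$ be the set of pairs $\langle\sigma,\tau\rangle$ of strings with $\sigma\prec\tau$. A coloring $f:[2^{<\omega}]^2\to 2$ is *stable* if for every $\sigma\in 2^{<\omega}$ there are a color $c<2$ and an $n\in\omega$ such that $f(\sigma,\tau)=c$ for all $\tau\succ\sigma$ with $|\tau|>n$. A set $H\subseteq 2^{<\omega}$ is *$f$-homogeneous* if there is a $c<2$ with $f(\sigma,\tau)=c$ for all $\sigma\prec\tau$ in $H$. For $\sigma\in H$, a *successor* of $\sigma$ in $H$ is a $\tau\in H$ with $\sigma\prec\tau$ such that no $\xi\in H$ satisfies $\sigma\prec\xi\prec\tau$. Write $H\cong 2^{<\omega}$ if $H$ has exactly one element with no proper initial segment in $H$, and every element of $H$ has exactly two successors in $H$ (equivalently, $(H,\preceq)$ and $(2^{<\omega},\preceq)$ are isomorphic). Let $\mathsf{STT}^2_2$ be the statement: for every stable coloring $f:[2^{<\omega}]^2\to 2$ there is an $f$-homogeneous set $H\subseteq 2^{<\omega}$ with $H\cong 2^{<\omega}$.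 **Corollary.** 1. $\mathsf{STT}^2_2$ admits cone avoidance: for every set $Z\subseteq\omega$, every set $C\subseteq\omega$ with $C\nleq_T Z$, and every $Z$-computable stable coloring $f:[2^{<\omega}]^2\to 2$, there is an $f$-homogeneous set $H\cong 2^{<\omega}$ such that $C\nleq_T H\oplus Z$. 2. $\mathsf{RCA}_0\nvdash\mathsf{STT}^2_2\to\mathsf{ACA}_0$: where $\mathsf{STT}^2_2$ is regarded as a sentence of second-order arithmetic (strings and pairs being coded by numbers, and colorings by sets), it is not the case that $\mathsf{RCA}_0$ proves $\mathsf{STT}^2_2\to\varphi$ for every axiom $\varphi$ of $\mathsf{ACA}_0$. -/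

import Mathlib

namespace TreeThm

/-! ## Turing reducibility of sets and cone avoidance -/

open Classical in
/-- The characteristic function of a set of natural numbers, as an oracle. -/
noncomputable def charFun (A : Set ℕ) : ℕ →. ℕ :=
  fun n => Part.some (if n ∈ A then 1 else 0)

/-- `A ≤_T B` for sets of natural numbers. -/
def SetTuringLE (A B : Set ℕ) : Prop :=
  TuringReducible (charFun A) (charFun B)

/-- The effective join `A ⊕ B`. -/
def join (A B : Set ℕ) : Set ℕ :=
  {k | (∃ n ∈ A, k = 2 * n) ∨ (∃ n ∈ B, k = 2 * n + 1)}

/-- A problem: instances, candidate solutions, the relation of being a solution, and the sets of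
natural numbers by which instances and solutions are represented. -/
structure Problem where
  /-- the instances -/
  Inst : Type
  /-- the candidates for a solution -/
  Cand : Type
  /-- `IsSol I S`: `S` is a solution to `I` -/
  IsSol : Inst → Cand → Prop
  /-- the set of natural numbers representing an instance -/
  instCode : Inst → Set ℕ
  /-- the set of natural numbers representing a candidate -/
  candCode : Cand → Set ℕ

/-- Cone avoidance: for every set `Z`, every `C ≰_T Z` and every `Z`-computable instance `I`
there is a solution `S` to `I` with `C ≰_T S ⊕ Z`. -/
def Problem.AdmitsConeAvoidance (P : Problem) : Prop :=
  ∀ Z C : Set ℕ, ¬ SetTuringLE C Z →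
    ∀ I : P.Inst, SetTuringLE (P.instCode I) Z →
      ∃ S : P.Cand, P.IsSol I S ∧ ¬ SetTuringLE C (join (P.candCode S) Z)

/-! ## The stable tree theorem for pairs and two colors -/

/-- Finite binary strings, the elements of `2^{<ω}`. -/
abbrev Str : Type := List Bool

/-- `σ ≺ τ`: `σ` is a proper initial segment of `τ`. -/
def SPre (σ τ : Str) : Prop := σ <+: τ ∧ σ ≠ τ

/-- `[2^{<ω}]^2`. -/
abbrev StrPair : Type := {p : Str × Str // SPre p.1 p.2}

/-- Colorings `f : [2^{<ω}]^2 → 2`. -/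
abbrev Coloring : Type := StrPair → Fin 2

/-- `f` is stable: for every `σ` there are a color `c` and a level `n` such that `f(σ, τ) = c`
for all `τ ≻ σ` with `|τ| > n`. -/
def Stable (f : Coloring) : Prop :=
  ∀ σ : Str, ∃ (c : Fin 2) (n : ℕ), ∀ (τ : Str) (h : SPre σ τ), n < τ.length → f ⟨(σ, τ), h⟩ = c

/-- `τ` is a successor of `σ` in `T`: no node of `T` lies strictly between. -/
def IsSucc (T : Set Str) (σ τ : Str) : Prop :=
  τ ∈ T ∧ SPre σ τ ∧ ¬ ∃ ξ ∈ T, SPre σ ξ ∧ SPre ξ τ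

/-- `σ` is a root of `T`: a node of `T` at level `0`. -/
def IsRoot (T : Set Str) (σ : Str) : Prop :=
  σ ∈ T ∧ ¬ ∃ ξ ∈ T, SPre ξ σ

/-- `T ≅ 2^{<ω}`: `T` is perfect and 2-branching, that is, `T` has a unique root and every node
of `T` has exactly two successors in `T`. -/
def IsoFullTree (T : Set Str) : Prop :=
  (∃! ρ, IsRoot T ρ) ∧
    ∀ σ ∈ T, ∃ α β, α ≠ β ∧ ∀ γ, IsSucc T σ γ ↔ γ = α ∨ γ = β

/-- `H` is `f`-homogeneous. -/
def Homogeneous (f : Coloring) (H : Set Str) : Prop :=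
  ∃ c : Fin 2, ∀ p : StrPair, p.1.1 ∈ H → p.1.2 ∈ H → f p = c

/-- The principle as a problem: the instances are the stable colorings of pairs, represented by
their graphs, and the solutions are the homogeneous sets isomorphic to `2^{<ω}`. -/
def STT22 : Problem where
  Inst := {f : Coloring // Stable f}
  Cand := Set Str
  IsSol f H := IsoFullTree H ∧ Homogeneous f.1 H
  instCode f := {k | ∃ p : StrPair, k = Encodable.encode (p.1, f.1 p)}
  candCode H := {k | ∃ σ ∈ H, k = Encodable.encode σ}

/-! ## The language of second-order arithmetic

De Bruijn indices, for number variables and set variables separately; in a formula of type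
`Fm n m` the free number variables are among `0, …, n - 1` and the free set variables among
`0, …, m - 1`. A number quantifier binds number variable `0`, a set quantifier set variable `0`. -/

/-- Numerical terms. -/
inductive Tm (n : ℕ) : Type
  | var (i : Fin n) : Tm n
  | zero : Tm n
  | one : Tm n
  | add (s t : Tm n) : Tm n
  | mul (s t : Tm n) : Tm n

/-- Formulas. -/
inductive Fm : ℕ → ℕ → Type
  | falsum {n m : ℕ} : Fm n m
  | eq {n m : ℕ} (s t : Tm n) : Fm n m
  | lt {n m : ℕ} (s t : Tm n) : Fm n m
  | mem {n m : ℕ} (t : Tm n) (X : Fin m) : Fm n m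
  | imp {n m : ℕ} (φ ψ : Fm n m) : Fm n m
  | allN {n m : ℕ} (φ : Fm (n + 1) m) : Fm n m
  | allS {n m : ℕ} (φ : Fm n (m + 1)) : Fm n m

/-- Sentences. -/
abbrev Sent : Type := Fm 0 0

namespace Tm

/-- Simultaneous substitution. -/
def subst {n n' : ℕ} (σ : Fin n → Tm n') : Tm n → Tm n'
  | var i => σ i
  | zero => zero
  | one => one
  | add s t => add (s.subst σ) (t.subst σ)
  | mul s t => mul (s.subst σ) (t.subst σ)

/-- Weakening by one number variable. -/
def lift {n : ℕ} (t : Tm n) : Tm (n + 1) := t.subst fun i => var i.succ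

/-- The number variable `0`. -/
abbrev x0 {n : ℕ} : Tm (n + 1) := var 0

/-- The number variable `1`. -/
abbrev x1 {n : ℕ} : Tm (n + 1 + 1) := var (Fin.succ 0)

/-- The number variable `2`. -/
abbrev x2 {n : ℕ} : Tm (n + 1 + 1 + 1) := var (Fin.succ (Fin.succ 0))

/-- The number variable `3`. -/
abbrev x3 {n : ℕ} : Tm (n + 1 + 1 + 1 + 1) := var (Fin.succ (Fin.succ (Fin.succ 0)))

/-- The numeral `2`. -/
def two {n : ℕ} : Tm n := add one one

/-- The code `(s + t)² + s` of the ordered pair `⟨s, t⟩`. -/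
def pair {n : ℕ} (s t : Tm n) : Tm n := add (mul (add s t) (add s t)) s

/-- The code of `⟨⟨s, t⟩, u⟩`. -/
def triple {n : ℕ} (s t u : Tm n) : Tm n := pair (pair s t) u

end Tm

namespace Fm

variable {n m n' m' : ℕ}

/-- Negation. -/
def neg (φ : Fm n m) : Fm n m := φ.imp falsum

/-- Conjunction. -/
def and (φ ψ : Fm n m) : Fm n m := (φ.imp ψ.neg).neg

/-- Disjunction. -/
def or (φ ψ : Fm n m) : Fm n m := φ.neg.imp ψ

/-- Equivalence. -/
def iff (φ ψ : Fm n m) : Fm n m := (φ.imp ψ).and (ψ.imp φ)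

/-- Existential number quantifier. -/
def exN (φ : Fm (n + 1) m) : Fm n m := φ.neg.allN.neg

/-- Existential set quantifier. -/
def exS (φ : Fm n (m + 1)) : Fm n m := φ.neg.allS.neg

/-- Simultaneous substitution of terms for number variables and of set variables for set
variables. -/
def subst : {n m n' m' : ℕ} → (Fin n → Tm n') → (Fin m → Fin m') → Fm n m → Fm n' m'
  | _, _, _, _, _, _, falsum => falsum
  | _, _, _, _, σ, _, eq s t => eq (s.subst σ) (t.subst σ)
  | _, _, _, _, σ, _, lt s t => lt (s.subst σ) (t.subst σ)
  | _, _, _, _, σ, ρ, mem t X => mem (t.subst σ) (ρ X)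
  | _, _, _, _, σ, ρ, imp φ ψ => imp (φ.subst σ ρ) (ψ.subst σ ρ)
  | _, _, _, _, σ, ρ, allN φ =>
      allN (φ.subst (Fin.cons (Tm.var 0) fun i => (σ i).lift) ρ)
  | _, _, _, _, σ, ρ, allS φ =>
      allS (φ.subst σ (Fin.cons 0 fun i => (ρ i).succ))

/-- Weakening by one number variable. -/
def liftN (φ : Fm n m) : Fm (n + 1) m := φ.subst (fun i => Tm.var i.succ) id

/-- Weakening by one set variable. -/
def liftS (φ : Fm n m) : Fm n (m + 1) := φ.subst Tm.var Fin.succ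

/-- `φ(t)`, for the number variable `0`. -/
def instN (φ : Fm (n + 1) m) (t : Tm n) : Fm n m := φ.subst (Fin.cons t Tm.var) id

/-- `φ(Y)`, for the set variable `0`. -/
def instS (φ : Fm n (m + 1)) (Y : Fin m) : Fm n m := φ.subst Tm.var (Fin.cons Y id)

/-- `φ(x + 1)`, where `x` is the number variable `0`. -/
def shiftN (φ : Fm (n + 1) m) : Fm (n + 1) m :=
  φ.subst (Fin.cons (Tm.add (Tm.var 0) Tm.one) fun i => Tm.var i.succ) id

/-- A sentence, regarded as a formula in any number of variables. -/
def ofSent (φ : Sent) : Fm n m := φ.subst Fin.elim0 Fin.elim0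

/-- Universal closure. -/
def close : {n m : ℕ} → Fm n m → Sent
  | 0, 0, φ => φ
  | 0, _ + 1, φ => close (allS φ)
  | _ + 1, _, φ => close (allN φ)

end Fm

/-! ## Provability: classical natural deduction, two-sorted, with equality of numbers -/

/-- `Prf T Γ φ`: the formula `φ` is derivable from the axioms `T` and the assumptions `Γ`. -/
inductive Prf (T : Set Sent) : {n m : ℕ} → List (Fm n m) → Fm n m → Prop
  | ax {n m : ℕ} {Γ : List (Fm n m)} {φ : Sent} : φ ∈ T → Prf T Γ φ.ofSent
  | hyp {n m : ℕ} {Γ : List (Fm n m)} {φ : Fm n m} : φ ∈ Γ → Prf T Γ φ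
  | impI {n m : ℕ} {Γ : List (Fm n m)} {φ ψ : Fm n m} :
      Prf T (φ :: Γ) ψ → Prf T Γ (φ.imp ψ)
  | impE {n m : ℕ} {Γ : List (Fm n m)} {φ ψ : Fm n m} :
      Prf T Γ (φ.imp ψ) → Prf T Γ φ → Prf T Γ ψ
  | raa {n m : ℕ} {Γ : List (Fm n m)} {φ : Fm n m} :
      Prf T (φ.neg :: Γ) Fm.falsum → Prf T Γ φ
  | allNI {n m : ℕ} {Γ : List (Fm n m)} {φ : Fm (n + 1) m} :
      Prf T (Γ.map Fm.liftN) φ → Prf T Γ φ.allN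
  | allNE {n m : ℕ} {Γ : List (Fm n m)} {φ : Fm (n + 1) m} (t : Tm n) :
      Prf T Γ φ.allN → Prf T Γ (φ.instN t)
  | allSI {n m : ℕ} {Γ : List (Fm n m)} {φ : Fm n (m + 1)} :
      Prf T (Γ.map Fm.liftS) φ → Prf T Γ φ.allS
  | allSE {n m : ℕ} {Γ : List (Fm n m)} {φ : Fm n (m + 1)} (Y : Fin m) :
      Prf T Γ φ.allS → Prf T Γ (φ.instS Y)
  | eqRefl {n m : ℕ} {Γ : List (Fm n m)} (t : Tm n) : Prf T Γ (Fm.eq t t)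
  | eqSubst {n m : ℕ} {Γ : List (Fm n m)} {s t : Tm n} (φ : Fm (n + 1) m) :
      Prf T Γ (Fm.eq s t) → Prf T Γ (φ.instN s) → Prf T Γ (φ.instN t)

/-- `T ⊢ φ`. -/
def Proves (T : Set Sent) (φ : Sent) : Prop := Prf T [] φ

/-! ## The systems `RCA₀` and `ACA₀` -/

/-- Arithmetical formulas: no set quantifiers (set parameters are allowed). -/
inductive IsArith : {n m : ℕ} → Fm n m → Prop
  | falsum {n m : ℕ} : IsArith (Fm.falsum : Fm n m)
  | eq {n m : ℕ} (s t : Tm n) : IsArith (Fm.eq s t : Fm n m)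
  | lt {n m : ℕ} (s t : Tm n) : IsArith (Fm.lt s t : Fm n m)
  | mem {n m : ℕ} (t : Tm n) (X : Fin m) : IsArith (Fm.mem t X)
  | imp {n m : ℕ} {φ ψ : Fm n m} : IsArith φ → IsArith ψ → IsArith (φ.imp ψ)
  | allN {n m : ℕ} {φ : Fm (n + 1) m} : IsArith φ → IsArith φ.allN

/-- Bounded quantifier formulas. -/
inductive IsDelta0 : {n m : ℕ} → Fm n m → Prop
  | falsum {n m : ℕ} : IsDelta0 (Fm.falsum : Fm n m)
  | eq {n m : ℕ} (s t : Tm n) : IsDelta0 (Fm.eq s t : Fm n m)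
  | lt {n m : ℕ} (s t : Tm n) : IsDelta0 (Fm.lt s t : Fm n m)
  | mem {n m : ℕ} (t : Tm n) (X : Fin m) : IsDelta0 (Fm.mem t X)
  | imp {n m : ℕ} {φ ψ : Fm n m} : IsDelta0 φ → IsDelta0 ψ → IsDelta0 (φ.imp ψ)
  | allLt {n m : ℕ} (t : Tm n) {φ : Fm (n + 1) m} :
      IsDelta0 φ → IsDelta0 (((Fm.lt (Tm.var 0) t.lift).imp φ).allN)

/-- `Σ⁰₁` formulas. -/
def IsSigma1 {n m : ℕ} (φ : Fm n m) : Prop := ∃ θ : Fm (n + 1) m, IsDelta0 θ ∧ φ = θ.exN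

/-- `Π⁰₁` formulas. -/
def IsPi1 {n m : ℕ} (φ : Fm n m) : Prop := ∃ θ : Fm (n + 1) m, IsDelta0 θ ∧ φ = θ.allN

/-- Induction for `φ`: `(φ(0) ∧ ∀ x (φ(x) → φ(x + 1))) → ∀ x φ(x)`. -/
def induction {n m : ℕ} (φ : Fm (n + 1) m) : Fm n m :=
  ((φ.instN Tm.zero).and (φ.imp φ.shiftN).allN).imp φ.allN

/-- Comprehension for `φ`: `∃ X ∀ x (x ∈ X ↔ φ(x))`, with `X` not free in `φ`. -/
def comprehension {n m : ℕ} (φ : Fm (n + 1) m) : Fm n m :=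
  (((Fm.mem (Tm.var 0) 0).iff φ.liftS).allN).exS

open Tm Fm in
/-- The basic axioms for `0, 1, +, ·, <`. -/
def basicAxioms : Set Sent :=
  { close (n := 1) (m := 0) (eq (add (var 0) one) zero).neg,
    close (n := 2) (m := 0)
      ((eq (add (var 0) one) (add (var 1) one)).imp (eq (var 0) (var 1))),
    close (n := 1) (m := 0) (eq (add (var 0) zero) (var 0)),
    close (n := 2) (m := 0)
      (eq (add (var 0) (add (var 1) one)) (add (add (var 0) (var 1)) one)),
    close (n := 1) (m := 0) (eq (mul (var 0) zero) zero),
    close (n := 2) (m := 0)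
      (eq (mul (var 0) (add (var 1) one)) (add (mul (var 0) (var 1)) (var 0))),
    close (n := 1) (m := 0) (lt (var 0) zero).neg,
    close (n := 2) (m := 0)
      ((lt (var 0) (add (var 1) one)).iff ((lt (var 0) (var 1)).or (eq (var 0) (var 1)))) }

/-- `RCA₀`: the basic axioms, `Σ⁰₁` induction and `Δ⁰₁` comprehension. -/
def RCA0 : Set Sent :=
  basicAxioms ∪
  {χ | ∃ (n m : ℕ) (φ : Fm (n + 1) m), IsSigma1 φ ∧ χ = (induction φ).close} ∪
  {χ | ∃ (n m : ℕ) (φ ψ : Fm (n + 1) m), IsSigma1 φ ∧ IsPi1 ψ ∧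
    χ = (((φ.iff ψ).allN).imp (comprehension φ)).close}

/-- `ACA₀`: the basic axioms, the induction axiom for sets and arithmetical comprehension. -/
def ACA0 : Set Sent :=
  basicAxioms ∪
  {(induction (n := 0) (m := 1) (Fm.mem (Tm.var 0) 0)).close} ∪
  {χ | ∃ (n m : ℕ) (φ : Fm (n + 1) m), IsArith φ ∧ χ = (comprehension φ).close}

/-! ## The stable tree theorem as a sentence of second-order arithmetic

The binary string `b₁ … bₖ` is coded by the number with binary expansion `1 b₁ … bₖ`, so that the
strings are coded by the nonzero numbers, and the strings of length greater than `k` by the numbers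
that are at least `2^k + 2^k`. -/

namespace Fm

open Tm

variable {n m : ℕ}

/-- `t` is a power of two: it is nonzero, and each of its divisors is `1` or even. -/
def pow2 (t : Tm n) : Fm n m :=
  (eq t zero).neg.and
    (((eq t.lift.lift (mul x1 x0)).imp
      ((eq x1 one).or (eq x2 (add x0 x0)).exN)).allN.allN)

/-- `s ≺ t`, for codes of strings: `s ≠ 0`, `s ≠ t`, and `t = s · p + r` for some power of two `p`
and some `r < p`. -/
def spre (s t : Tm n) : Fm n m :=
  ((eq s zero).neg.and (eq s t).neg).and
    ((pow2 x1).and ((lt x0 x1).and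
      (eq t.lift.lift (add (mul s.lift.lift x1) x0)))).exN.exN

/-- `F` is (the graph of) a function `[2^{<ω}]^2 → 2`: each element of `F` is of the form
`⟨⟨σ, τ⟩, c⟩` with `σ ≺ τ` and `c < 2`, and for all `σ ≺ τ` there is exactly one such `c`. -/
def isColoring (F : Fin m) : Fm n m :=
  ((mem x0 F).imp
    ((spre x2 x1).and ((lt x0 two).and
      (eq x3 (triple x2 x1 x0)))).exN.exN.exN).allN.and
  ((spre x1 x0).imp
    ((mem (triple x2 x1 x0) F).and
      ((mem (triple x3 x2 x0) F).imp (eq x0 x1)).allN).exN).allN.allN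

/-- For every string `σ` there are `c < 2` and `q = 2^k` such that `F(σ, τ) = c` for all `τ ≻ σ`
with `|τ| > k`. -/
def isStable (F : Fin m) : Fm n m :=
  ((eq x0 zero).neg.imp
    ((lt x1 two).and ((pow2 x0).and
      ((spre x3 x0).imp
        ((lt x0 (add x1 x1)).neg.imp
          (mem (triple x3 x0 x2) F))).allN)).exN.exN).allN

/-- `t` is a successor of `s` in `H`. -/
def isSucc (H : Fin m) (s t : Tm n) : Fm n m :=
  (mem t H).and ((spre s t).and
    ((mem x0 H).and ((spre s.lift x0).and (spre x0 t.lift))).exN.neg)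

/-- `t` is a root of `H`. -/
def isRoot (H : Fin m) (t : Tm n) : Fm n m :=
  (mem t H).and ((mem x0 H).and (spre x0 t.lift)).exN.neg

/-- `H` is a set of strings with `H ≅ 2^{<ω}`: it has a unique root, and each element of `H` has
exactly two successors in `H`. -/
def isFullTree (H : Fin m) : Fm n m :=
  ((mem x0 H).imp (eq x0 zero).neg).allN.and
  (((isRoot H x0).and ((isRoot H x0).imp (eq x0 x1)).allN).exN.and
  ((mem x0 H).imp
    ((eq x1 x0).neg.and
      ((isSucc H x3 x0).iff
        ((eq x0 x2).or (eq x0 x1))).allN).exN.exN).allN)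

/-- There is `c < 2` with `F(σ, τ) = c` for all `σ ≺ τ` in `H`. -/
def isHomogeneous (F H : Fin m) : Fm n m :=
  ((lt x0 two).and
    ((mem x1 H).imp ((mem x0 H).imp ((spre x1 x0).imp
      (mem (triple x1 x0 x2) F)))).allN.allN).exN

end Fm

/-- For every stable coloring `F : [2^{<ω}]^2 → 2` there is an `F`-homogeneous set
`H ≅ 2^{<ω}`. In the scope of both set quantifiers, `F` is set variable `1` and `H` is `0`. -/
def STT22Sentence : Sent :=
  (((Fm.isColoring 0).and (Fm.isStable 0)).imp
    ((Fm.isFullTree 0).and (Fm.isHomogeneous 1 0)).exS).allS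

end TreeThm

/-! A stable colouring gives every string a limit colour. The set `P` of strings with limit colour 0
need not be computable from `Z`, so the core is strong cone avoidance for arbitrary two-part
partitions. `exists_branching_avoiding` finds, inside `P` or inside its complement, a nonempty set
`G` in which every element has two incomparable extensions and for which `G ⊕ Z` does not compute
`C`. Since the limit colour is constant on `G`, a greedy search computable in `G ⊕ Z` selects a
homogeneous copy of the full tree (`thinTree`): each node waits for two incomparable extensions in
`G` that already have the right colour with all nodes chosen below them.

Strong cone avoidance is a forcing argument. A condition is a finite set `F` with a branching
reservoir `V` computable in an oracle that does not compute `C`. Every reservoir may be assumed to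
meet both parts, for otherwise it is itself a solution. If all requirements are dense below some
`Pᶜ`-condition, a generic set solves the problem inside `Pᶜ`. Otherwise every `Pᶜ`-condition extends
to one below which some requirement can never be forced, and these blocked conditions make every
requirement dense for `P` (`exists_forces_of_block`). To see this, put a blocked condition above
every element of `F` and ask which values are computed by a finite extension on one of the two
sides, for every partition `B` in place of the unknown `P`. By compactness the question is Σ⁰₁ in
the oracle, so it cannot single out the correct values of `C`. Either a wrong value is unavoidable,
and then it occurs for `P` itself; or a correct value is avoidable, and the cone avoidance basis
theorem (`exists_path_avoiding`) gives an avoiding `B` whose join with the oracle still does not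
compute `C`, along which the reservoirs can be thinned. In both cases a requirement is forced on one
of the sides, and the blocks exclude `Pᶜ`.

For the second part, iterating cone avoidance from the empty set, with `C` the halting set, yields a
Turing ideal closed under solutions and omitting the halting set (`exists_ideal`). As the
second-order part of an ω-model it satisfies `RCA0` and `STT22Sentence` but not arithmetical
comprehension, and soundness of the calculus concludes. -/

namespace TreeThm

/-! ## Primitive recursive functions and `fun_prop` -/

attribute [fun_prop] Primrec

section
variable {α β γ δ : Type*} [Primcodable α] [Primcodable β] [Primcodable γ] [Primcodable δ]

theorem primrec_id : Primrec fun a : α => a := Primrec.id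
theorem primrec_const (b : β) : Primrec fun _ : α => b := Primrec.const b
theorem primrec_comp {f : β → γ} {g : α → β} (hf : Primrec f) (hg : Primrec g) :
    Primrec fun a => f (g a) := hf.comp hg
theorem primrec_fst {f : α → β × γ} (hf : Primrec f) : Primrec fun a => (f a).1 :=
  Primrec.fst.comp hf
theorem primrec_snd {f : α → β × γ} (hf : Primrec f) : Primrec fun a => (f a).2 :=
  Primrec.snd.comp hf
theorem primrec_mk {f : α → β} {g : α → γ} (hf : Primrec f) (hg : Primrec g) :
    Primrec fun a => (f a, g a) := hf.pair hg
theorem primrec_take {f : α → ℕ} {g : α → List β} (hf : Primrec f) (hg : Primrec g) :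
    Primrec fun a => (g a).take (f a) := Primrec.list_take.comp hf hg
theorem primrec_length {g : α → List β} (hg : Primrec g) : Primrec fun a => (g a).length :=
  Primrec.list_length.comp hg
theorem primrec_unpair {g : α → ℕ} (hg : Primrec g) : Primrec fun a => (g a).unpair :=
  Primrec.unpair.comp hg
theorem primrec_natPair {f g : α → ℕ} (hf : Primrec f) (hg : Primrec g) :
    Primrec fun a => Nat.pair (f a) (g a) := Primrec₂.natPair.comp hf hg
theorem primrec_encode {g : α → β} (hg : Primrec g) : Primrec fun a => Encodable.encode (g a) :=
  Primrec.encode.comp hg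
theorem primrec_decode {g : α → ℕ} (hg : Primrec g) :
    Primrec fun a => (Encodable.decode (g a) : Option β) := Primrec.decode.comp hg
theorem primrec_getElem? {f : α → List β} {g : α → ℕ} (hf : Primrec f) (hg : Primrec g) :
    Primrec fun a => (f a)[g a]? := Primrec.list_getElem?.comp hf hg
theorem primrec_some {f : α → β} (hf : Primrec f) : Primrec fun a => some (f a) :=
  Primrec.option_some.comp hf
theorem primrec_add {f g : α → ℕ} (hf : Primrec f) (hg : Primrec g) :
    Primrec fun a => f a + g a := Primrec.nat_add.comp hf hg
theorem primrec_mul {f g : α → ℕ} (hf : Primrec f) (hg : Primrec g) :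
    Primrec fun a => f a * g a := Primrec.nat_mul.comp hf hg
theorem primrec_append {f g : α → List β} (hf : Primrec f) (hg : Primrec g) :
    Primrec fun a => f a ++ g a := Primrec.list_append.comp hf hg
theorem primrec_cons {f : α → β} {g : α → List β} (hf : Primrec f) (hg : Primrec g) :
    Primrec fun a => f a :: g a := Primrec.list_cons.comp hf hg
theorem primrec_div {f g : α → ℕ} (hf : Primrec f) (hg : Primrec g) :
    Primrec fun a => f a / g a := Primrec.nat_div.comp hf hg
theorem primrec_mod {f g : α → ℕ} (hf : Primrec f) (hg : Primrec g) :
    Primrec fun a => f a % g a := Primrec.nat_mod.comp hf hg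

attribute [fun_prop] primrec_id primrec_const primrec_comp primrec_fst primrec_snd primrec_mk
  primrec_take primrec_length primrec_unpair primrec_natPair primrec_encode primrec_decode
  primrec_getElem? primrec_some primrec_add primrec_mul primrec_append primrec_cons primrec_div
  primrec_mod

theorem primrecPred_eq {f g : α → β} (hf : Primrec f) (hg : Primrec g) :
    PrimrecPred fun a => f a = g a := Primrec.eq.comp hf hg

theorem primrecPred_le {f g : α → ℕ} (hf : Primrec f) (hg : Primrec g) :
    PrimrecPred fun a => f a ≤ g a := Primrec.nat_le.comp hf hg

theorem primrecPred_lt {f g : α → ℕ} (hf : Primrec f) (hg : Primrec g) :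
    PrimrecPred fun a => f a < g a := Primrec.nat_lt.comp hf hg

theorem primrecPred_exists_mem {S : α × β → Prop} (hS : PrimrecPred S) {f : α → List β}
    (hf : Primrec f) : PrimrecPred fun a => ∃ b ∈ f a, S (a, b) := by
  have : PrimrecRel fun (b : β) (a : α) => S (a, b) :=
    PrimrecPred.comp (f := fun p : β × α => (p.2, p.1)) hS (by fun_prop)
  exact this.exists_mem_list.comp hf Primrec.id

theorem primrecPred_forall_mem {S : α × β → Prop} (hS : PrimrecPred S) {f : α → List β}
    (hf : Primrec f) : PrimrecPred fun a => ∀ b ∈ f a, S (a, b) := by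
  have : PrimrecRel fun (b : β) (a : α) => S (a, b) :=
    PrimrecPred.comp (f := fun p : β × α => (p.2, p.1)) hS (by fun_prop)
  exact this.forall_mem_list.comp hf Primrec.id

theorem primrecPred_exists_lt {S : α × ℕ → Prop} (hS : PrimrecPred S) {f : α → ℕ}
    (hf : Primrec f) : PrimrecPred fun a => ∃ b < f a, S (a, b) :=
  (primrecPred_exists_mem hS (Primrec.list_range.comp hf)).of_eq (by simp)

theorem primrecPred_forall_lt {S : α × ℕ → Prop} (hS : PrimrecPred S) {f : α → ℕ}
    (hf : Primrec f) : PrimrecPred fun a => ∀ b < f a, S (a, b) :=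
  (primrecPred_forall_mem hS (Primrec.list_range.comp hf)).of_eq (by simp)

end

/-! ## Relatively computably enumerable predicates -/

/-- The characteristic function with values in `Bool`. -/
noncomputable def chi (B : Set ℕ) (n : ℕ) : Bool := by
  classical exact decide (n ∈ B)

theorem chi_eq_true {B : Set ℕ} {n : ℕ} : chi B n = true ↔ n ∈ B := by simp [chi]
theorem chi_eq_false {B : Set ℕ} {n : ℕ} : chi B n = false ↔ n ∉ B := by simp [chi]

theorem exists_chi_eq (f : ℕ → Bool) : ∃ B, chi B = f :=
  ⟨{n | f n = true}, by funext n; cases h : f n <;> simp [chi, h]⟩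

/-- The list of the first `k` values of `f`. -/
def ini {α : Type*} (f : ℕ → α) (k : ℕ) : List α := (List.range k).map f

theorem ini_length {α : Type*} (f : ℕ → α) (k : ℕ) : (ini f k).length = k := by simp [ini]

theorem ini_take {α : Type*} (f : ℕ → α) {j k : ℕ} (h : j ≤ k) : (ini f k).take j = ini f j := by
  simp [ini, ← List.map_take, List.take_range, h]

theorem ini_getElem? {α : Type*} (f : ℕ → α) {i k : ℕ} (h : i < k) : (ini f k)[i]? = some (f i) := by
  simp [ini, h]

theorem ini_congr {α : Type*} {f g : ℕ → α} {k : ℕ} (h : ∀ i < k, f i = g i) : ini f k = ini g k := by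
  simp only [ini]
  exact List.map_congr_left fun i hi => h i (List.mem_range.1 hi)

theorem eq_ini_iff {α : Type*} {f : ℕ → α} {l : List α} :
    l = ini f l.length ↔ ∀ i < l.length, l[i]? = some (f i) := by
  constructor
  · intro h i hi
    rw [h, ini_getElem? f hi]
  · intro h
    apply List.ext_getElem?
    intro i
    by_cases hi : i < l.length
    · rw [h i hi, ini_getElem? f hi]
    · rw [List.getElem?_eq_none (by omega), List.getElem?_eq_none (by rw [ini_length]; omega)]

section
variable {α β γ : Type*} [Primcodable α] [Primcodable β] [Primcodable γ]

/-- `S` is computably enumerable relative to `B`. -/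
def Sig (B : Set ℕ) (S : α → Prop) : Prop :=
  ∃ R : List Bool × α → Prop, PrimrecPred R ∧ ∀ a, S a ↔ ∃ k, R (ini (chi B) k, a)

namespace Sig
variable {B : Set ℕ} {S T : α → Prop}

theorem of_iff (hS : Sig B S) (h : ∀ a, T a ↔ S a) : Sig B T := by
  obtain rfl : S = T := funext fun a => propext (h a).symm
  exact hS

theorem of_primrec (h : PrimrecPred S) : Sig B S :=
  ⟨fun p => S p.2, h.comp Primrec.snd, by simp⟩

theorem comp (hS : Sig B S) {f : β → α} (hf : Primrec f) : Sig B fun b => S (f b) := by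
  obtain ⟨R, hR, h⟩ := hS
  exact ⟨fun p => R (p.1, f p.2),
    PrimrecPred.comp (f := fun p : List Bool × β => (p.1, f p.2)) hR (by fun_prop),
    fun b => h _⟩

/-- The length of the initial segment is itself a number, so it can code both the shorter segment
that is really used and the witness. -/
theorem ex {S : α × β → Prop} (hS : Sig B S) : Sig B fun a => ∃ b, S (a, b) := by
  obtain ⟨R, hR, h⟩ := hS
  refine ⟨fun p => ∃ b ∈ (Encodable.decode (α := β) p.1.length.unpair.2).toList,
    R (p.1.take p.1.length.unpair.1, p.2, b), ?_, fun a => ?_⟩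
  · have : PrimrecPred fun q : (List Bool × α) × β =>
        R (q.1.1.take q.1.1.length.unpair.1, q.1.2, q.2) :=
      PrimrecPred.comp (f := fun q : (List Bool × α) × β =>
        (q.1.1.take q.1.1.length.unpair.1, q.1.2, q.2)) hR (by fun_prop)
    exact primrecPred_exists_mem this (Primrec.optionToList.comp (by fun_prop))
  · constructor
    · rintro ⟨b, hb⟩
      obtain ⟨k, hk⟩ := (h _).1 hb
      refine ⟨Nat.pair k (Encodable.encode b), b, ?_, ?_⟩
      · simp [ini_length]
      · rw [ini_length, Nat.unpair_pair, ini_take _ (Nat.left_le_pair _ _)]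
        exact hk
    · rintro ⟨k, b, -, hb⟩
      rw [ini_length, ini_take _ (Nat.unpair_left_le _)] at hb
      exact ⟨b, (h _).2 ⟨_, hb⟩⟩

/-- Monotonicity in the length lets finitely many witnesses be replaced by their maximum. -/
theorem exists_bounded {S : α × ℕ → Prop} {R : List Bool × (α × ℕ) → Prop} (hR : PrimrecPred R)
    (h : ∀ a, S a ↔ ∃ k, R (ini (chi B) k, a)) :
    ∃ R' : List Bool × (α × ℕ) → Prop, PrimrecPred R' ∧ (∀ a, S a ↔ ∃ k, R' (ini (chi B) k, a)) ∧
      ∀ a j k, j ≤ k → R' (ini (chi B) j, a) → R' (ini (chi B) k, a) := by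
  refine ⟨fun p => ∃ j < p.1.length + 1, R (p.1.take j, p.2), ?_, ?_, ?_⟩
  · have : PrimrecPred fun q : (List Bool × (α × ℕ)) × ℕ => R (q.1.1.take q.2, q.1.2) :=
      PrimrecPred.comp (f := fun q : (List Bool × (α × ℕ)) × ℕ => (q.1.1.take q.2, q.1.2)) hR
        (by fun_prop)
    exact primrecPred_exists_lt this (by fun_prop)
  · intro a
    rw [h]
    constructor
    · rintro ⟨k, hk⟩
      exact ⟨k, k, by simp [ini_length], by rwa [ini_take _ le_rfl]⟩
    · rintro ⟨k, j, hj, hk⟩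
      rw [ini_length] at hj
      exact ⟨j, by rwa [ini_take _ (by omega)] at hk⟩
  · rintro a j k hjk ⟨i, hi, hR⟩
    rw [ini_length] at hi
    refine ⟨i, by rw [ini_length]; omega, ?_⟩
    rw [ini_take _ (by omega)] at hR ⊢
    exact hR

theorem all_lt {S : α × ℕ → Prop} (hS : Sig B S) {f : α → ℕ} (hf : Primrec f) :
    Sig B fun a => ∀ i < f a, S (a, i) := by
  obtain ⟨R₀, hR₀, h₀⟩ := hS
  obtain ⟨R, hR, h, hmono⟩ := exists_bounded hR₀ h₀
  refine ⟨fun p => ∀ i < f p.2, R (p.1, p.2, i), ?_, fun a => ?_⟩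
  · have : PrimrecPred fun q : (List Bool × α) × ℕ => R (q.1.1, q.1.2, q.2) :=
      PrimrecPred.comp (f := fun q : (List Bool × α) × ℕ => (q.1.1, q.1.2, q.2)) hR (by fun_prop)
    exact primrecPred_forall_lt (f := fun p : List Bool × α => f p.2) this (by fun_prop)
  · constructor
    · intro H
      have : ∀ n, (∀ i < n, S (a, i)) → ∃ k, ∀ i < n, R (ini (chi B) k, a, i) := by
        intro n
        induction n with
        | zero => exact fun _ => ⟨0, by simp⟩
        | succ n ih =>
          intro hn
          obtain ⟨k, hk⟩ := ih fun i hi => hn i (by omega)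
          obtain ⟨l, hl⟩ := (h _).1 (hn n (by omega))
          refine ⟨max k l, fun i hi => ?_⟩
          rcases Nat.lt_succ_iff_lt_or_eq.1 hi with hi | rfl
          · exact hmono _ _ _ (le_max_left _ _) (hk i hi)
          · exact hmono _ _ _ (le_max_right _ _) hl
      exact this _ H
    · rintro ⟨k, hk⟩ i hi
      exact (h _).2 ⟨k, hk i hi⟩

/-- The index type carries no coding: the defining relations are chosen one by one, nonuniformly. -/
theorem fin_or {ι : Type*} (l : List ι) {S : ι → α → Prop} (h : ∀ i ∈ l, Sig B (S i)) :
    Sig B fun a => ∃ i ∈ l, S i a := by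
  choose! R hR h using h
  refine ⟨fun p => ∃ i ∈ l, R i p, ?_, fun a => ?_⟩
  · clear h
    induction l with
    | nil => exact (PrimrecPred.not (primrecPred_eq primrec_id primrec_id)).of_eq (by simp)
    | cons i l ih =>
      exact ((hR i (by simp)).or (ih fun j hj => hR j (by simp [hj]))).of_eq (by simp)
  · constructor
    · rintro ⟨i, hi, ha⟩
      obtain ⟨k, hk⟩ := (h i hi a).1 ha
      exact ⟨k, i, hi, hk⟩
    · rintro ⟨k, i, hi, hk⟩
      exact ⟨i, hi, (h i hi a).2 ⟨k, hk⟩⟩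

theorem or (hS : Sig B S) (hT : Sig B T) : Sig B fun a => S a ∨ T a :=
  (fin_or [S, T] (S := fun i => i) (by simp [hS, hT])).of_iff (by simp)

/-- Two witnesses have to be merged into one, which bounded quantification over `i < 2` already
does. -/
theorem and (hS : Sig B S) (hT : Sig B T) : Sig B fun a => S a ∧ T a := by
  have h1 : Sig B fun p : α × ℕ => p.2 = 0 ∧ S p.1 := by
    obtain ⟨R, hR, h⟩ := hS
    refine ⟨fun p => p.2.2 = 0 ∧ R (p.1, p.2.1), PrimrecPred.and
      (primrecPred_eq (by fun_prop) (by fun_prop)) (PrimrecPred.comp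
        (f := fun p : List Bool × α × ℕ => (p.1, p.2.1)) hR (by fun_prop)), by simp [h]⟩
  have h2 : Sig B fun p : α × ℕ => p.2 = 1 ∧ T p.1 := by
    obtain ⟨R, hR, h⟩ := hT
    refine ⟨fun p => p.2.2 = 1 ∧ R (p.1, p.2.1), PrimrecPred.and
      (primrecPred_eq (by fun_prop) (by fun_prop)) (PrimrecPred.comp
        (f := fun p : List Bool × α × ℕ => (p.1, p.2.1)) hR (by fun_prop)), by simp [h]⟩
  refine ((h1.or h2).all_lt (f := fun _ => 2) (by fun_prop)).of_iff fun a => ?_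
  constructor
  · rintro ⟨h1, h2⟩ i hi
    interval_cases i <;> simp [h1, h2]
  · intro h
    exact ⟨by simpa using h 0, by simpa using h 1⟩

theorem fin_and {ι : Type*} (l : List ι) {S : ι → α → Prop} (h : ∀ i ∈ l, Sig B (S i)) :
    Sig B fun a => ∀ i ∈ l, S i a := by
  induction l with
  | nil => exact (of_primrec (primrecPred_eq primrec_id primrec_id)).of_iff (by simp)
  | cons i l ih =>
    exact ((h i (by simp)).and (ih fun j hj => h j (by simp [hj]))).of_iff (by simp)

theorem all_mem {S : α × β → Prop} (hS : Sig B S) {f : α → List β} (hf : Primrec f) :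
    Sig B fun a => ∀ b ∈ f a, S (a, b) := by
  have h1 : Sig B fun q : (α × ℕ) × β => (f q.1.1)[q.1.2]? = some q.2 ∧ S (q.1.1, q.2) :=
    (of_primrec (primrecPred_eq (by fun_prop) (by fun_prop))).and
      (hS.comp (f := fun q : (α × ℕ) × β => (q.1.1, q.2)) (by fun_prop))
  refine (h1.ex.all_lt (f := fun a => (f a).length) (by fun_prop)).of_iff fun a => ?_
  constructor
  · intro h i hi
    exact ⟨(f a)[i], by simp [hi], h _ (List.getElem_mem _)⟩
  · intro h b hb
    obtain ⟨i, hi, rfl⟩ := List.mem_iff_getElem.1 hb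
    obtain ⟨b, h1, h2⟩ := h i hi
    simp only [List.getElem?_eq_getElem hi, Option.some.injEq] at h1
    exact h1 ▸ h2

theorem ex_mem {S : α × β → Prop} (hS : Sig B S) {f : α → List β} (hf : Primrec f) :
    Sig B fun a => ∃ b ∈ f a, S (a, b) := by
  have h0 : PrimrecPred fun q : α × β => ∃ b ∈ f q.1, b = q.2 :=
    primrecPred_exists_mem (S := fun r : (α × β) × β => r.2 = r.1.2)
      (primrecPred_eq (by fun_prop) (by fun_prop)) (f := fun q : α × β => f q.1) (by fun_prop)
  exact ((of_primrec h0).and hS).ex.of_iff (by simp)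

theorem mem : Sig B fun n => n ∈ B := by
  refine ⟨fun p => p.1[p.2]? = some true, primrecPred_eq (by fun_prop) (by fun_prop), fun n => ?_⟩
  constructor
  · intro h
    exact ⟨n + 1, by simpa [ini_getElem?] using chi_eq_true.2 h⟩
  · rintro ⟨k, hk⟩
    have : n < k := by
      by_contra h
      rw [List.getElem?_eq_none (by simpa [ini_length] using h)] at hk
      cases hk
    simpa [ini_getElem? _ this, chi_eq_true] using hk

theorem not_mem : Sig B fun n => n ∉ B := by
  refine ⟨fun p => p.1[p.2]? = some false, primrecPred_eq (by fun_prop) (by fun_prop), fun n => ?_⟩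
  constructor
  · intro h
    exact ⟨n + 1, by simpa [ini_getElem?] using chi_eq_false.2 h⟩
  · rintro ⟨k, hk⟩
    have : n < k := by
      by_contra h
      rw [List.getElem?_eq_none (by simpa [ini_length] using h)] at hk
      cases hk
    simpa [ini_getElem? _ this, chi_eq_false] using hk

end Sig

/-- `S` is computable relative to `B`. -/
def Dec (B : Set ℕ) (S : α → Prop) : Prop := Sig B S ∧ Sig B fun a => ¬ S a

namespace Dec
variable {B : Set ℕ} {S T : α → Prop}

theorem of_iff (hS : Dec B S) (h : ∀ a, T a ↔ S a) : Dec B T :=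
  ⟨hS.1.of_iff h, hS.2.of_iff fun a => not_congr (h a)⟩

theorem of_primrec (h : PrimrecPred S) : Dec B S := ⟨.of_primrec h, .of_primrec h.not⟩

theorem comp (hS : Dec B S) {f : β → α} (hf : Primrec f) : Dec B fun b => S (f b) :=
  ⟨hS.1.comp hf, hS.2.comp hf⟩

theorem not (hS : Dec B S) : Dec B fun a => ¬ S a := ⟨hS.2, hS.1.of_iff (by simp)⟩

theorem and (hS : Dec B S) (hT : Dec B T) : Dec B fun a => S a ∧ T a :=
  ⟨hS.1.and hT.1, (hS.2.or hT.2).of_iff fun a => by tauto⟩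

theorem or (hS : Dec B S) (hT : Dec B T) : Dec B fun a => S a ∨ T a :=
  (hS.not.and hT.not).not.of_iff fun a => by tauto

theorem imp (hS : Dec B S) (hT : Dec B T) : Dec B fun a => S a → T a :=
  (hS.not.or hT).of_iff fun a => by tauto

theorem all_mem {S : α × β → Prop} (hS : Dec B S) {f : α → List β} (hf : Primrec f) :
    Dec B fun a => ∀ b ∈ f a, S (a, b) :=
  ⟨hS.1.all_mem hf, (hS.2.ex_mem hf).of_iff (by simp)⟩

theorem ex_mem {S : α × β → Prop} (hS : Dec B S) {f : α → List β} (hf : Primrec f) :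
    Dec B fun a => ∃ b ∈ f a, S (a, b) :=
  ⟨hS.1.ex_mem hf, (hS.2.all_mem hf).of_iff (by simp)⟩

theorem all_lt {S : α × ℕ → Prop} (hS : Dec B S) {f : α → ℕ} (hf : Primrec f) :
    Dec B fun a => ∀ i < f a, S (a, i) :=
  (hS.all_mem (Primrec.list_range.comp hf)).of_iff (by simp)

theorem mem : Dec B fun n => n ∈ B := ⟨.mem, .not_mem⟩

theorem fin_or {ι : Type*} (l : List ι) {S : ι → α → Prop} (h : ∀ i ∈ l, Dec B (S i)) :
    Dec B fun a => ∃ i ∈ l, S i a :=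
  ⟨.fin_or l fun i hi => (h i hi).1,
    (Sig.fin_and l (S := fun i a => ¬ S i a) fun i hi => (h i hi).2).of_iff (by simp)⟩

end Dec

/-- Uniform use: computations relative to a uniformly `B`-computable family of sets. -/
theorem Sig.uniform {B : Set ℕ} {M : β → Set ℕ} (hM : Dec B fun p : β × ℕ => p.2 ∈ M p.1)
    {R : List Bool × α → Prop} (hR : Sig B R) :
    Sig B fun p : β × α => ∃ k, R (ini (chi (M p.1)) k, p.2) := by
  have h1 : Sig B fun q : ((β × α) × List Bool) × ℕ =>
      q.1.2[q.2]? = some (chi (M q.1.1.1) q.2) := by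
    have ht : Sig B fun q : ((β × α) × List Bool) × ℕ =>
        q.1.2[q.2]? = some true ∧ q.2 ∈ M q.1.1.1 :=
      (of_primrec (primrecPred_eq (by fun_prop) (by fun_prop))).and
        (hM.1.comp (f := fun q : ((β × α) × List Bool) × ℕ => (q.1.1.1, q.2)) (by fun_prop))
    have hf : Sig B fun q : ((β × α) × List Bool) × ℕ =>
        q.1.2[q.2]? = some false ∧ q.2 ∉ M q.1.1.1 :=
      (of_primrec (primrecPred_eq (by fun_prop) (by fun_prop))).and
        (hM.2.comp (f := fun q : ((β × α) × List Bool) × ℕ => (q.1.1.1, q.2)) (by fun_prop))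
    refine (ht.or hf).of_iff fun q => ?_
    by_cases h : q.2 ∈ M q.1.1.1
    · simp [h, chi_eq_true.2 h]
    · simp [h, chi_eq_false.2 h]
  -- An initial segment of the member of the family is guessed as a string and verified bit by bit.
  have h2 : Sig B fun q : (β × α) × List Bool =>
      (∀ i < q.2.length, q.2[i]? = some (chi (M q.1.1) i)) ∧ R (q.2, q.1.2) :=
    (h1.all_lt (f := fun q : (β × α) × List Bool => q.2.length) (by fun_prop)).and
      (hR.comp (f := fun q : (β × α) × List Bool => (q.2, q.1.2)) (by fun_prop))
  refine h2.ex.of_iff fun p => ?_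
  constructor
  · rintro ⟨k, hk⟩
    exact ⟨ini (chi (M p.1)) k, eq_ini_iff.1 (by rw [ini_length]), hk⟩
  · rintro ⟨l, hl, hR⟩
    refine ⟨l.length, ?_⟩
    rw [← eq_ini_iff.2 hl]
    exact hR

theorem Sig.trans {A B : Set ℕ} {S : α → Prop} (hS : Sig A S) (h : Dec B fun n => n ∈ A) :
    Sig B S := by
  obtain ⟨R, hR, hS⟩ := hS
  have := Sig.uniform (β := Unit) (M := fun _ => A)
    (h.comp (f := fun p : Unit × ℕ => p.2) (by fun_prop)) (Sig.of_primrec hR)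
  exact (this.comp (f := fun a : α => ((), a)) (by fun_prop)).of_iff hS

theorem Dec.trans {A B : Set ℕ} {S : α → Prop} (hS : Dec A S) (h : Dec B fun n => n ∈ A) :
    Dec B S := ⟨hS.1.trans h, hS.2.trans h⟩

end

/-! ### Turing reducibility expressed through `Sig` and `Dec` -/

section
variable {α β γ : Type*} [Primcodable α] [Primcodable β] [Primcodable γ]

/-- Relations defined by primitive recursion. -/
theorem Sig.iterate {B : Set ℕ} {P : α × γ → Prop} {Q : (α × ℕ) × (γ × γ) → Prop}
    {T : α × ℕ × γ → Prop} (hP : Sig B P) (hQ : Sig B Q) (h0 : ∀ a v, T (a, 0, v) ↔ P (a, v))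
    (hs : ∀ a n v, T (a, n + 1, v) ↔ ∃ u, T (a, n, u) ∧ Q ((a, n), (u, v))) : Sig B T := by
  have h1 : Sig B fun q : (α × List γ) × γ => q.1.2[0]? = some q.2 ∧ P (q.1.1, q.2) :=
    (of_primrec (primrecPred_eq (by fun_prop) (by fun_prop))).and
      (hP.comp (f := fun q : (α × List γ) × γ => (q.1.1, q.2)) (by fun_prop))
  have h2 : Sig B fun q : ((α × List γ) × ℕ) × (γ × γ) =>
      (q.1.1.2[q.1.2]? = some q.2.1 ∧ q.1.1.2[q.1.2 + 1]? = some q.2.2) ∧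
        Q ((q.1.1.1, q.1.2), q.2) :=
    ((of_primrec (primrecPred_eq (by fun_prop) (by fun_prop))).and
      (of_primrec (primrecPred_eq (by fun_prop) (by fun_prop)))).and
      (hQ.comp (f := fun q : ((α × List γ) × ℕ) × (γ × γ) => ((q.1.1.1, q.1.2), q.2))
        (by fun_prop))
  -- The whole history of the recursion is quantified over as one finite list.
  have h3 : Sig B fun q : (α × ℕ × γ) × List γ =>
      (∃ x, q.2[0]? = some x ∧ P (q.1.1, x)) ∧
      (∀ i < q.1.2.1, ∃ x : γ × γ, (q.2[i]? = some x.1 ∧ q.2[i + 1]? = some x.2) ∧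
        Q ((q.1.1, i), x)) ∧ q.2[q.1.2.1]? = some q.1.2.2 :=
    (h1.ex.comp (f := fun q : (α × ℕ × γ) × List γ => (q.1.1, q.2)) (by fun_prop)).and
      ((((h2.ex.comp (f := fun q : ((α × ℕ × γ) × List γ) × ℕ => ((q.1.1.1, q.1.2), q.2))
        (by fun_prop)).all_lt (f := fun q : (α × ℕ × γ) × List γ => q.1.2.1) (by fun_prop))).and
      (of_primrec (primrecPred_eq (by fun_prop) (by fun_prop))))
  refine h3.ex.of_iff ?_
  rintro ⟨a, n, v⟩
  dsimp only
  induction n generalizing v with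
  | zero =>
    rw [h0]
    constructor
    · intro h
      exact ⟨[v], ⟨v, rfl, h⟩, by simp, rfl⟩
    · rintro ⟨L, ⟨x, hx, hP⟩, -, hv⟩
      obtain rfl : x = v := by rw [hx] at hv; exact Option.some.inj hv
      exact hP
  | succ n ih =>
    rw [hs]
    constructor
    · rintro ⟨u, hu, hQ⟩
      obtain ⟨L, ⟨x, hx, hP⟩, hL, hn⟩ := (ih u).1 hu
      obtain ⟨hlt, -⟩ := List.getElem?_eq_some_iff.1 hn
      -- The list may run past index `n`, so it is cut before the new value is appended.
      have key : ∀ i ≤ n, (L.take (n + 1) ++ [v])[i]? = L[i]? := by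
        intro i hi
        rw [List.getElem?_append_left (by simp; omega), List.getElem?_take]
        simp; omega
      have key' : (L.take (n + 1) ++ [v])[n + 1]? = some v := by
        rw [List.getElem?_append_right (by simp)]
        simp [Nat.min_eq_left hlt]
      refine ⟨L.take (n + 1) ++ [v], ⟨x, by rw [key 0 (by omega)]; exact hx, hP⟩, ?_, key'⟩
      intro i hi
      rcases Nat.lt_succ_iff_lt_or_eq.1 hi with hi | rfl
      · obtain ⟨x, ⟨h1, h2⟩, h3⟩ := hL i hi
        exact ⟨x, ⟨by rw [key _ (by omega)]; exact h1, by rw [key _ (by omega)]; exact h2⟩, h3⟩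
      · exact ⟨(u, v), ⟨by rw [key _ le_rfl]; exact hn, key'⟩, hQ⟩
    · rintro ⟨L, hP, hL, hv⟩
      obtain ⟨x, ⟨h1, h2⟩, h3⟩ := hL n (by omega)
      refine ⟨x.1, (ih _).2 ⟨L, hP, fun i hi => hL i (by omega), h1⟩, ?_⟩
      obtain rfl : x.2 = v := by rw [h2] at hv; exact Option.some.inj hv
      exact h3

end

/-- Every clause of relative recursiveness preserves Σ⁰₁ graphs: composition guesses the
intermediate value, primitive recursion is `Sig.iterate`, and minimization needs only a bounded
quantifier over earlier nonzero values. -/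
theorem sig_graph_of_recursiveIn {B : Set ℕ} {f : ℕ →. ℕ} (hf : Nat.RecursiveIn {charFun B} f) :
    Sig B fun p : ℕ × ℕ => p.2 ∈ f p.1 := by
  induction hf with
  | zero =>
    exact (Sig.of_primrec (S := fun p : ℕ × ℕ => p.2 = 0)
      (primrecPred_eq (by fun_prop) (by fun_prop))).of_iff fun p => Part.mem_some_iff
  | succ =>
    exact (Sig.of_primrec (S := fun p : ℕ × ℕ => p.2 = p.1 + 1)
      (primrecPred_eq (by fun_prop) (by fun_prop))).of_iff fun p => Part.mem_some_iff
  | left =>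
    exact (Sig.of_primrec (S := fun p : ℕ × ℕ => p.2 = p.1.unpair.1)
      (primrecPred_eq (by fun_prop) (by fun_prop))).of_iff fun p => Part.mem_some_iff
  | right =>
    exact (Sig.of_primrec (S := fun p : ℕ × ℕ => p.2 = p.1.unpair.2)
      (primrecPred_eq (by fun_prop) (by fun_prop))).of_iff fun p => Part.mem_some_iff
  | oracle g hg =>
    obtain rfl := Set.mem_singleton_iff.1 hg
    have h1 : Sig B fun p : ℕ × ℕ => p.1 ∈ B ∧ p.2 = 1 :=
      (Sig.mem.comp (f := fun p : ℕ × ℕ => p.1) (by fun_prop)).and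
        (.of_primrec (primrecPred_eq (by fun_prop) (by fun_prop)))
    have h2 : Sig B fun p : ℕ × ℕ => p.1 ∉ B ∧ p.2 = 0 :=
      (Sig.not_mem.comp (f := fun p : ℕ × ℕ => p.1) (by fun_prop)).and
        (.of_primrec (primrecPred_eq (by fun_prop) (by fun_prop)))
    refine (h1.or h2).of_iff fun p => ?_
    by_cases h : p.1 ∈ B <;> simp [charFun, h]
  | @pair f h _ _ ihf ihh =>
    have h1 : Sig B fun q : (ℕ × ℕ) × (ℕ × ℕ) =>
        (q.2.1 ∈ f q.1.1 ∧ q.2.2 ∈ h q.1.1) ∧ Nat.pair q.2.1 q.2.2 = q.1.2 :=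
      ((ihf.comp (f := fun q : (ℕ × ℕ) × (ℕ × ℕ) => (q.1.1, q.2.1)) (by fun_prop)).and
        (ihh.comp (f := fun q : (ℕ × ℕ) × (ℕ × ℕ) => (q.1.1, q.2.2)) (by fun_prop))).and
        (.of_primrec (primrecPred_eq (by fun_prop) (by fun_prop)))
    refine h1.ex.of_iff fun p => ?_
    simp only [Seq.seq, Part.map_eq_map, Part.bind_map, Part.mem_bind_iff, Part.mem_map_iff,
      Prod.exists]
    constructor
    · rintro ⟨a, ha, b, hb, h⟩
      exact ⟨a, b, ⟨ha, hb⟩, h⟩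
    · rintro ⟨a, b, ⟨ha, hb⟩, h⟩
      exact ⟨a, ha, b, hb, h⟩
  | @comp f h _ _ ihf ihh =>
    have h1 : Sig B fun q : (ℕ × ℕ) × ℕ => q.2 ∈ h q.1.1 ∧ q.1.2 ∈ f q.2 :=
      (ihh.comp (f := fun q : (ℕ × ℕ) × ℕ => (q.1.1, q.2)) (by fun_prop)).and
        (ihf.comp (f := fun q : (ℕ × ℕ) × ℕ => (q.2, q.1.2)) (by fun_prop))
    exact h1.ex.of_iff fun p => Part.mem_bind_iff
  | @prec f h _ _ ihf ihh =>
    have := Sig.iterate (α := ℕ) (γ := ℕ) (T := fun q => q.2.2 ∈ (q.2.1.rec (f q.1) fun y IH => do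
          let i ← IH
          h (Nat.pair q.1 (Nat.pair y i)) : Part ℕ)) ihf
      (ihh.comp (f := fun q : (ℕ × ℕ) × (ℕ × ℕ) =>
        (Nat.pair q.1.1 (Nat.pair q.1.2 q.2.1), q.2.2)) (by fun_prop)) (fun a v => Iff.rfl)
      (fun a n v => by simp)
    exact this.comp (f := fun p : ℕ × ℕ => (p.1.unpair.1, p.1.unpair.2, p.2)) (by fun_prop)
  | @rfind f _ ihf =>
    have h1 : Sig B fun q : (ℕ × ℕ) × ℕ => q.2 ∈ f (Nat.pair q.1.1 q.1.2) ∧ q.2 ≠ 0 :=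
      (ihf.comp (f := fun q : (ℕ × ℕ) × ℕ => (Nat.pair q.1.1 q.1.2, q.2)) (by fun_prop)).and
        (.of_primrec (PrimrecPred.not (primrecPred_eq (by fun_prop) (by fun_prop))))
    have h2 : Sig B fun p : ℕ × ℕ => 0 ∈ f (Nat.pair p.1 p.2) ∧
        ∀ i < p.2, ∃ m, m ∈ f (Nat.pair p.1 i) ∧ m ≠ 0 :=
      (ihf.comp (f := fun p : ℕ × ℕ => (Nat.pair p.1 p.2, 0)) (by fun_prop)).and
        ((h1.ex.comp (f := fun q : (ℕ × ℕ) × ℕ => (q.1.1, q.2)) (by fun_prop)).all_lt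
          (f := fun p : ℕ × ℕ => p.2) (by fun_prop))
    exact h2.of_iff fun p => Nat.mem_rfind.trans (by simp)

section
variable {α : Type*} [Primcodable α]

/-- Primitive recursion with one oracle query per step. Afterwards all oracle access goes through
this function, and the rest of a computation is primitive recursive. -/
theorem recursiveIn_encode_ini (B : Set ℕ) :
    Nat.RecursiveIn {charFun B} fun k => Part.some (Encodable.encode (ini (chi B) k)) := by
  let g : ℕ → ℕ := fun x =>
    Encodable.encode (((Encodable.decode x.unpair.2.unpair.1 : Option (List Bool)).getD []) ++
      [decide (x.unpair.2.unpair.2 = 1)])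
  have hg : Primrec g := by
    have h1 : Primrec fun x : ℕ => decide (x.unpair.2.unpair.2 = 1) :=
      PrimrecPred.decide (primrecPred_eq (by fun_prop) (by fun_prop))
    have h2 : Primrec fun x : ℕ =>
        ((Encodable.decode x.unpair.2.unpair.1 : Option (List Bool)).getD []) :=
      Primrec.option_getD.comp (by fun_prop) (by fun_prop)
    fun_prop
  let h : ℕ →. ℕ := fun x => Part.some (g (Nat.pair x.unpair.1
    (Nat.pair x.unpair.2.unpair.2 (chi B x.unpair.2.unpair.1).toNat)))
  have ho : Nat.RecursiveIn {charFun B} fun x =>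
      Part.some (chi B x.unpair.2.unpair.1).toNat := by
    refine ((Nat.RecursiveIn.oracle (O := {charFun B}) _ rfl).comp
      (Nat.Primrec.recursiveIn (Primrec.nat_iff.1
        (show Primrec fun x : ℕ => x.unpair.2.unpair.1 by fun_prop)))).of_eq fun x => ?_
    refine (Part.bind_some _ _).trans ?_
    by_cases hx : x.unpair.2.unpair.1 ∈ B <;> simp [charFun, chi, hx]
  have hh : Nat.RecursiveIn {charFun B} h := by
    refine ((Nat.Primrec.recursiveIn (Primrec.nat_iff.1 hg)).comp
      ((Nat.RecursiveIn.left).pair (((Nat.RecursiveIn.right).comp .right).pair ho))).of_eq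
        fun x => ?_
    simp [h, Seq.seq]
  have hz : Nat.RecursiveIn {charFun B} fun _ => Part.some (Encodable.encode ([] : List Bool)) :=
    (Nat.Primrec.recursiveIn (Nat.Primrec.const _)).of_eq fun x => rfl
  have hp := (Nat.RecursiveIn.prec hz hh).comp
    ((Nat.Primrec.recursiveIn (Primrec.nat_iff.1
      (show Primrec fun k : ℕ => Nat.pair 0 k by fun_prop))))
  refine hp.of_eq fun k => ?_
  simp only [Part.coe_some, Part.bind_eq_bind, Part.bind_some, Nat.unpair_pair]
  induction k with
  | zero => simp [ini]
  | succ k ih =>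
    change Part.bind _ _ = _
    rw [ih]
    simp only [h, Part.bind_some, Nat.unpair_pair, g, Encodable.encodek, Option.getD_some, ini,
      List.range_succ, List.map_append, List.map_cons, List.map_nil]
    cases chi B k <;> simp

/-- The relativized theorem of Post: from right to left, search for a stage at which membership or
non-membership is confirmed and read off which. -/
theorem setTuringLE_iff {A B : Set ℕ} : SetTuringLE A B ↔ Dec B fun n => n ∈ A := by
  constructor
  · intro h
    have h := sig_graph_of_recursiveIn (RecursiveIn.iff_nat.1 h)
    have h1 := h.comp (f := fun n : ℕ => (n, 1)) (by fun_prop)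
    have h0 := h.comp (f := fun n : ℕ => (n, 0)) (by fun_prop)
    refine ⟨h1.of_iff fun n => ?_, h0.of_iff fun n => ?_⟩ <;>
    by_cases hn : n ∈ A <;> simp [charFun, hn]
  · rintro ⟨⟨R, hR, h⟩, ⟨R', hR', h'⟩⟩
    classical
    let dec : ℕ → List Bool × ℕ := fun x =>
      ((Encodable.decode x.unpair.2 : Option (List Bool)).getD [], x.unpair.1.unpair.1)
    have hd : Primrec dec := by
      have h2 : Primrec fun x : ℕ => ((Encodable.decode x.unpair.2 : Option (List Bool)).getD []) :=
        Primrec.option_getD.comp (by fun_prop) (by fun_prop)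
      fun_prop
    -- The value is `0` at the stages that settle the question, as the minimization operator
    -- requires.
    let t : ℕ → ℕ := fun x => if R (dec x) ∨ R' (dec x) then 0 else 1
    have ht : Primrec t :=
      Primrec.ite ((hR.comp hd).or (hR'.comp hd)) (by fun_prop) (by fun_prop)
    let v : ℕ → ℕ := fun x => if R (dec x) then 1 else 0
    have hv : Primrec v := Primrec.ite (hR.comp hd) (by fun_prop) (by fun_prop)
    have hi := (Nat.Primrec.recursiveIn (O := {charFun B}) (Primrec.nat_iff.1
      (show Primrec fun x : ℕ => x by fun_prop))).pair ((recursiveIn_encode_ini B).comp .right)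
    have ht' := (Nat.Primrec.recursiveIn (O := {charFun B}) (Primrec.nat_iff.1 ht)).comp hi
    have hv' := (Nat.Primrec.recursiveIn (O := {charFun B}) (Primrec.nat_iff.1 hv)).comp hi
    have hid : Nat.RecursiveIn {charFun B} fun n => Part.some n :=
      (Nat.Primrec.recursiveIn (Primrec.nat_iff.1 (show Primrec fun x : ℕ => x by fun_prop)))
    have hfin := hv'.comp (hid.pair ht'.rfind)
    refine RecursiveIn.iff_nat.2 (hfin.of_eq_tot (g := fun n => if n ∈ A then 1 else 0)
      fun n => ?_)
    have hex : ∃ k, R (ini (chi B) k, n) ∨ R' (ini (chi B) k, n) := by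
      by_cases hn : n ∈ A
      · obtain ⟨k, hk⟩ := (h n).1 hn
        exact ⟨k, .inl hk⟩
      · obtain ⟨k, hk⟩ := (h' n).1 hn
        exact ⟨k, .inr hk⟩
    have hspec := Nat.find_spec hex
    have hmin := fun i (hi : i < Nat.find hex) => Nat.find_min hex hi
    set k := Nat.find hex
    simp only [Seq.seq, Part.coe_some, Part.bind_eq_bind, Part.bind_some, Part.map_eq_map,
      Part.bind_map, Part.map_some, Nat.unpair_pair, dec, t, v, Encodable.encodek, Option.getD_some]
    have hr : Nat.rfind (fun m => Part.some (decide ((if R (ini (chi B) m, n) ∨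
        R' (ini (chi B) m, n) then 0 else 1) = 0))) = Part.some k := by
      refine Part.eq_some_iff.2 (Nat.mem_rfind.2 ⟨by simp [hspec], fun {m} hm => ?_⟩)
      simp [hmin m hm]
    rw [hr]
    · by_cases hn : n ∈ A
      · have : ¬ R' (ini (chi B) k, n) := fun hr => (h' n).2 ⟨k, hr⟩ hn
        simp [hn, hspec.resolve_right this]
      · have : ¬ R (ini (chi B) k, n) := fun hr => hn ((h n).2 ⟨k, hr⟩)
        simp [hn, this]

end

/-! ### Characteristic functions, countability and joins -/

theorem Dec.ext_chi {C Y : Set ℕ} : (Dec Y fun n => n ∈ C) ↔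
    Sig Y fun p : ℕ × Bool => p.2 = chi C p.1 := by
  constructor
  · rintro ⟨h1, h2⟩
    refine (((h1.comp (f := fun p : ℕ × Bool => p.1) (by fun_prop)).and (.of_primrec
      (S := fun p : ℕ × Bool => p.2 = true) (primrecPred_eq (by fun_prop) (by fun_prop)))).or
      ((h2.comp (f := fun p : ℕ × Bool => p.1) (by fun_prop)).and (.of_primrec
      (S := fun p : ℕ × Bool => p.2 = false)
        (primrecPred_eq (by fun_prop) (by fun_prop))))).of_iff ?_
    rintro ⟨n, b⟩
    by_cases h : n ∈ C
    · simp [h, chi_eq_true.2 h]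
    · simp [h, chi_eq_false.2 h]
  · intro h
    refine ⟨(h.comp (f := fun n : ℕ => (n, true)) (by fun_prop)).of_iff fun n => ?_,
      (h.comp (f := fun n : ℕ => (n, false)) (by fun_prop)).of_iff fun n => ?_⟩
    · rw [← chi_eq_true, eq_comm]
    · rw [← chi_eq_false, eq_comm]

/-- Each such predicate is determined by the partial recursive function that decides it, hence by a
program code. This makes the list of requirements countable. -/
theorem countable_primrecPred {α : Type*} [Primcodable α] :
    {S : α → Prop | PrimrecPred S}.Countable := by
  classical
  have hc : (Set.range fun c : Nat.Partrec.Code => c.eval).Countable := Set.countable_range _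
  refine Set.MapsTo.countable_of_injOn (f := fun S : α → Prop => fun n : ℕ =>
    (Part.bind (Encodable.decode (α := α) n) fun a => (Part.some (decide (S a))).map
      Encodable.encode : Part ℕ)) (t := Set.range fun c : Nat.Partrec.Code => c.eval) ?_ ?_ hc
  · intro S hS
    have : Partrec fun a => Part.some (decide (S a)) := (PrimrecPred.decide hS).to_comp
    exact Nat.Partrec.Code.exists_code.1 this
  · intro S _ T _ h
    funext a
    have := congrFun h (Encodable.encode a)
    simpa using this

theorem Dec.join {α : Type*} [Primcodable α] {A : α → Set ℕ} {B Y : Set ℕ}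
    (hA : Dec Y fun p : α × ℕ => p.2 ∈ A p.1) (hB : Dec Y fun n => n ∈ B) :
    Dec Y fun p : α × ℕ => p.2 ∈ TreeThm.join (A p.1) B := by
  have h : Dec Y fun p : α × ℕ =>
      (p.2 % 2 = 0 ∧ p.2 / 2 ∈ A p.1) ∨ (p.2 % 2 = 1 ∧ p.2 / 2 ∈ B) :=
    ((Dec.of_primrec (primrecPred_eq (by fun_prop) (by fun_prop))).and
      (hA.comp (f := fun p : α × ℕ => (p.1, p.2 / 2)) (by fun_prop))).or
    ((Dec.of_primrec (primrecPred_eq (by fun_prop) (by fun_prop))).and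
      (hB.comp (f := fun p : α × ℕ => p.2 / 2) (by fun_prop)))
  refine h.of_iff ?_
  rintro ⟨a, n⟩
  constructor
  · rintro (⟨m, hm, rfl⟩ | ⟨m, hm, rfl⟩)
    · left; simpa using hm
    · right
      refine ⟨by dsimp only; omega, ?_⟩
      rwa [show (2 * m + 1) / 2 = m by omega]
  · rintro (⟨h1, h2⟩ | ⟨h1, h2⟩)
    · exact .inl ⟨_, h2, by dsimp only at h1 ⊢; omega⟩
    · exact .inr ⟨_, h2, by dsimp only at h1 ⊢; omega⟩

theorem dec_join {A B Y : Set ℕ} (hA : Dec Y fun n => n ∈ A) (hB : Dec Y fun n => n ∈ B) :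
    Dec Y fun n => n ∈ join A B :=
  (Dec.join (A := fun _ : Unit => A) (hA.comp (f := fun p : Unit × ℕ => p.2) (by fun_prop))
    hB).comp (f := fun n : ℕ => ((), n)) (by fun_prop)

theorem mem_join_left {A B : Set ℕ} {n : ℕ} : 2 * n ∈ join A B ↔ n ∈ A := by
  constructor
  · rintro (⟨m, hm, h⟩ | ⟨m, hm, h⟩)
    · obtain rfl : n = m := by omega
      exact hm
    · omega
  · intro h; exact .inl ⟨n, h, rfl⟩

theorem mem_join_right {A B : Set ℕ} {n : ℕ} : 2 * n + 1 ∈ join A B ↔ n ∈ B := by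
  constructor
  · rintro (⟨m, hm, h⟩ | ⟨m, hm, h⟩)
    · omega
    · obtain rfl : n = m := by omega
      exact hm
  · intro h; exact .inr ⟨n, h, rfl⟩

theorem dec_join_left (A B : Set ℕ) : Dec (join A B) fun n => n ∈ A :=
  (Dec.mem.comp (f := fun n => 2 * n) (by fun_prop)).of_iff fun _ => mem_join_left.symm

theorem dec_join_right (A B : Set ℕ) : Dec (join A B) fun n => n ∈ B :=
  (Dec.mem.comp (f := fun n => 2 * n + 1) (by fun_prop)).of_iff fun _ => mem_join_right.symm

/-! ## Effective compactness and the cone avoidance basis theorem -/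

theorem isClosed_ini (T : List Bool → Prop) (k : ℕ) : IsClosed {f : ℕ → Bool | T (ini f k)} := by
  have hc : Continuous fun f : ℕ → Bool => fun i : Fin k => f i := by fun_prop
  have h := (isClosed_discrete {g : Fin k → Bool | T (List.ofFn g)}).preimage hc
  convert h using 1
  ext f
  simp only [ini, Set.mem_ofPred_eq, Set.mem_preimage, List.ofFn_eq_map]
  rw [← List.map_coe_finRange_eq_range, List.map_map]
  rfl

theorem exists_mem_iInter_of_antitone {T : ℕ → List Bool → Prop} (hmono : ∀ n β, T n β → T (n + 1) β)
    (hne : ∀ n, ∃ f : ℕ → Bool, ∀ k, ¬ T n (ini f k)) :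
    ∃ f : ℕ → Bool, ∀ n k, ¬ T n (ini f k) := by
  have hcl : ∀ n, IsClosed {f : ℕ → Bool | ∀ k, ¬ T n (ini f k)} := fun n => by
    rw [Set.ofPred_forall]
    exact isClosed_iInter fun k => isClosed_ini (fun β => ¬ T n β) k
  obtain ⟨f, hf⟩ := IsCompact.nonempty_iInter_of_sequence_nonempty_isCompact_isClosed
    (fun n => {f : ℕ → Bool | ∀ k, ¬ T n (ini f k)})
    (fun n f hf k h => hf k (hmono _ _ h)) hne (hcl 0).isCompact hcl
  exact ⟨f, fun n => by simpa using Set.mem_iInter.1 hf n⟩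

/-- Compactness of Cantor space: a set of strings met by every path is already met below some fixed
level. -/
theorem forall_exists_ini_iff (T : List Bool → Prop) :
    (∀ f : ℕ → Bool, ∃ k, T (ini f k)) ↔
      ∃ m, ∀ β : List Bool, β.length = m → ∃ k, k ≤ m ∧ T (β.take k) := by
  constructor
  · intro h
    by_contra hcon
    push Not at hcon
    obtain ⟨f, hf⟩ := exists_mem_iInter_of_antitone
      (T := fun m β => ∃ k, k ≤ m ∧ k ≤ β.length ∧ T (β.take k))
      (fun n β ⟨k, h1, h2⟩ => ⟨k, by omega, h2⟩) (fun m => by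
        obtain ⟨β, hβ, hT⟩ := hcon m
        -- The padding with `false` is immaterial, as only prefixes of `β` are tested.
        refine ⟨fun i => β.getD i false, ?_⟩
        rintro k ⟨j, hj, hj', h⟩
        rw [ini_length] at hj'
        refine hT j hj ?_
        rw [ini_take _ hj'] at h
        convert h using 1
        have hl : (β.take j).length = j := by simp; omega
        have he : β.take j = ini (fun i => β.getD i false) (β.take j).length := by
          refine eq_ini_iff.2 fun i hi => ?_
          rw [hl] at hi
          rw [List.getElem?_take_of_lt hi, List.getD_eq_getElem?_getD,
            List.getElem?_eq_getElem (by omega)]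
          simp
        rw [he, hl])
    obtain ⟨k, hk⟩ := h f
    exact hf k k ⟨k, le_rfl, by rw [ini_length], by rwa [ini_take _ le_rfl]⟩
  · rintro ⟨m, hm⟩ f
    obtain ⟨k, hk, hT⟩ := hm (ini f m) (ini_length _ _)
    exact ⟨k, by rwa [ini_take _ hk] at hT⟩

/-- The list of all binary strings of length `m`. -/
def allStr : ℕ → List (List Bool)
  | 0 => [[]]
  | m + 1 => (allStr m).flatMap fun β => [β ++ [false], β ++ [true]]

theorem mem_allStr {m : ℕ} {β : List Bool} : β ∈ allStr m ↔ β.length = m := by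
  induction m generalizing β with
  | zero => simp [allStr]
  | succ m ih =>
    simp only [allStr, List.mem_flatMap, ih]
    constructor
    · rintro ⟨γ, h, hβ⟩
      simp only [List.mem_cons, List.not_mem_nil, or_false] at hβ
      rcases hβ with rfl | rfl <;> simp [h]
    · intro h
      rcases List.eq_nil_or_concat β with rfl | ⟨γ, b, rfl⟩
      · simp at h
      · refine ⟨γ, by simpa using h, ?_⟩
        cases b <;> simp

theorem primrec_allStr : Primrec allStr := by
  refine (Primrec.nat_rec₁ (f := fun _ l => l.flatMap fun β : List Bool => [β ++ [false], β ++ [true]])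
    [[]] (Primrec.list_flatMap Primrec.snd (Primrec.of_eq (f := fun p : (ℕ × List (List Bool)) ×
      List Bool => [p.2 ++ [false], p.2 ++ [true]]) (by fun_prop) fun _ => rfl))).of_eq fun m => ?_
  induction m with
  | zero => rfl
  | succ m ih => simp only [allStr, ← ih]

section
variable {α : Type*} [Primcodable α]

/-- Compactness replaces the quantifier over paths by a search for a level at which finitely many
strings are all met. -/
theorem Sig.forall_path {Y : Set ℕ} {T : List Bool × α → Prop} (hT : Sig Y T) :
    Sig Y fun a => ∀ f : ℕ → Bool, ∃ k, T (ini f k, a) := by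
  have h1 : Sig Y fun q : ((α × ℕ) × List Bool) × ℕ => q.2 ≤ q.1.1.2 ∧
      T (q.1.2.take q.2, q.1.1.1) :=
    (of_primrec (primrecPred_le (by fun_prop) (by fun_prop))).and
      (hT.comp (f := fun q : ((α × ℕ) × List Bool) × ℕ => (q.1.2.take q.2, q.1.1.1)) (by fun_prop))
  have h2 := (h1.ex.all_mem (f := fun p : α × ℕ => allStr p.2)
    (primrec_allStr.comp Primrec.snd)).ex
  refine h2.of_iff fun a => ?_
  rw [forall_exists_ini_iff fun β => T (β, a)]
  simp only [mem_allStr]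

/-- A string stands for the finite set of positions where it is `true`; by `ini_join_eq` the
truncation at its length makes the result agree with that of any set the string is an initial
segment of. -/
theorem sig_ini_join {Y : Set ℕ} {R : List Bool × α → Prop} (hR : PrimrecPred R) :
    Sig Y fun p : List Bool × α =>
      R (ini (chi (join {n | p.1[n]? = some true} Y)) p.1.length, p.2) := by
  have hM : Dec Y fun p : List Bool × ℕ => p.2 ∈ join {n | p.1[n]? = some true} Y :=
    Dec.join (A := fun β : List Bool => {n | β[n]? = some true})
      (Dec.of_primrec (S := fun p : List Bool × ℕ => p.1[p.2]? = some true)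
        (primrecPred_eq (by fun_prop) (by fun_prop))) .mem
  have hR' : PrimrecPred fun p : List Bool × (ℕ × α) => p.1.length = p.2.1 ∧ R (p.1, p.2.2) :=
    (primrecPred_eq (by fun_prop) (by fun_prop)).and
      (hR.comp (f := fun p : List Bool × (ℕ × α) => (p.1, p.2.2)) (by fun_prop))
  refine ((Sig.uniform (M := fun β : List Bool => join {n | β[n]? = some true} Y) hM
    (Sig.of_primrec hR')).comp
    (f := fun p : List Bool × α => (p.1, (p.1.length, p.2))) (by fun_prop)).of_iff fun p => ?_
  constructor
  · intro h
    exact ⟨_, ini_length _ _, h⟩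
  · rintro ⟨k, h1, h2⟩
    rw [ini_length] at h1
    obtain rfl : k = p.1.length := h1
    exact h2

end

theorem ini_join_eq (B Y : Set ℕ) (k : ℕ) :
    ini (chi (join {n | (ini (chi B) k)[n]? = some true} Y)) k = ini (chi (join B Y)) k := by
  refine ini_congr fun i hi => ?_
  rw [Bool.eq_iff_iff, chi_eq_true, chi_eq_true]
  rcases Nat.even_or_odd' i with ⟨j, rfl | rfl⟩
  · rw [mem_join_left, mem_join_left, Set.mem_ofPred_eq, ini_getElem? _ (by omega)]
    simp [chi_eq_true]
  · rw [mem_join_right, mem_join_right]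

/-- `C` is the function enumerated by the functional `R` with oracle `X`. -/
def Enumerates (R : List Bool × (ℕ × Bool) → Prop) (X C : Set ℕ) : Prop :=
  ∀ n v, v = chi C n ↔ ∃ k, R (ini (chi X) k, (n, v))

theorem dec_iff_enumerates {X C : Set ℕ} :
    (Dec X fun n => n ∈ C) ↔ ∃ R, PrimrecPred R ∧ Enumerates R X C := by
  rw [Dec.ext_chi]
  simp only [Sig, Prod.forall, Enumerates]

/-- If both alternatives failed, `v` would be the value of `C` at `n` exactly when every path meets
`T` for `(n, v)`. That condition is Σ⁰₁ in `Y` by compactness, so `Y` would compute `C`. -/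
theorem exists_disagreement_or_exists_path {Y C : Set ℕ} (hC : ¬ Dec Y fun n => n ∈ C)
    {T : List Bool × (ℕ × Bool) → Prop} (hT : Sig Y T) :
    (∃ n, ∀ f : ℕ → Bool, ∃ k, T (ini f k, (n, !chi C n))) ∨
      ∃ n, ∃ f : ℕ → Bool, ∀ k, ¬ T (ini f k, (n, chi C n)) := by
  by_contra hcon
  push Not at hcon
  obtain ⟨h1, h2⟩ := hcon
  refine hC (Dec.ext_chi.2 (hT.forall_path.of_iff ?_))
  rintro ⟨n, v⟩
  constructor
  · rintro h
    dsimp only at h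
    subst h
    exact h2 n
  · intro h
    by_contra hne
    obtain ⟨f, hf⟩ := h1 n
    obtain ⟨k, hk⟩ := h f
    dsimp only at hne hk
    rw [Bool.eq_not_of_ne hne] at hk
    exact hf k hk

/-- One step of the basis theorem. `T` collects the forbidden strings, so enlarging it shrinks the
Π⁰₁ class of paths. -/
theorem exists_refine_not_enumerates {Y C : Set ℕ} (hC : ¬ Dec Y fun n => n ∈ C)
    {T : List Bool → Prop} (hT : Sig Y T) (hne : ∃ f : ℕ → Bool, ∀ k, ¬ T (ini f k))
    {R : List Bool × (ℕ × Bool) → Prop} (hR : PrimrecPred R) :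
    ∃ T' : List Bool → Prop, (Sig Y T' ∧ ∃ f : ℕ → Bool, ∀ k, ¬ T' (ini f k)) ∧
      (∀ β, T β → T' β) ∧
      ∀ B, (∀ k, ¬ T' (ini (chi B) k)) → ¬ Enumerates R (join B Y) C := by
  have hS := sig_ini_join (Y := Y) hR
  -- A path meets this relation if it leaves the class or if `R` outputs the given value along it.
  rcases exists_disagreement_or_exists_path hC ((hT.comp (f := fun p : List Bool × (ℕ × Bool) =>
      p.1) (by fun_prop)).or hS) with ⟨n, hn⟩ | ⟨n, f, hf⟩
  · refine ⟨T, ⟨hT, hne⟩, fun _ h => h, fun B hB hen => ?_⟩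
    obtain ⟨k, hk⟩ := hn (chi B)
    have hk := hk.resolve_left (hB k)
    dsimp only at hk
    rw [ini_length, ini_join_eq] at hk
    simpa using (hen n _).2 ⟨k, hk⟩
  -- Strings that output the correct value at `n` are forbidden too; the path `f` shows that the
  -- class stays nonempty.
  · refine ⟨_, ⟨hT.or (hS.comp (f := fun β => (β, (n, chi C n))) (by fun_prop)), f, hf⟩,
      fun β h => .inl h, fun B hB hen => ?_⟩
    obtain ⟨k, hk⟩ := (hen n _).1 rfl
    refine hB k (.inr ?_)
    dsimp only
    rwa [ini_length, ini_join_eq]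

/-- The cone avoidance basis theorem: the class is shrunk once for each functional, and by
compactness some path survives all the steps. -/
theorem exists_path_avoiding {Y C : Set ℕ} (hC : ¬ Dec Y fun n => n ∈ C)
    {T : List Bool → Prop} (hT : Sig Y T) (hne : ∃ f : ℕ → Bool, ∀ k, ¬ T (ini f k)) :
    ∃ B : Set ℕ, (¬ Dec (join B Y) fun n => n ∈ C) ∧ ∀ k, ¬ T (ini (chi B) k) := by
  have hne' : {R : List Bool × (ℕ × Bool) → Prop | PrimrecPred R}.Nonempty :=
    ⟨fun _ => True, (primrecPred_eq primrec_id primrec_id).of_eq (by simp)⟩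
  obtain ⟨r, hr⟩ := countable_primrecPred.exists_eq_range hne'
  have hr' : ∀ n, PrimrecPred (r n) := fun n => by
    have : r n ∈ {R : List Bool × (ℕ × Bool) → Prop | PrimrecPred R} := hr ▸ ⟨n, rfl⟩
    exact this
  choose step h1 h2 h3 using fun (n : ℕ)
    (T : {T : List Bool → Prop // Sig Y T ∧ ∃ f : ℕ → Bool, ∀ k, ¬ T (ini f k)}) =>
    exists_refine_not_enumerates hC T.2.1 T.2.2 (hr' n)
  let seq : ℕ → {T : List Bool → Prop // Sig Y T ∧ ∃ f : ℕ → Bool, ∀ k, ¬ T (ini f k)} :=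
    fun n => n.rec ⟨T, hT, hne⟩ fun n T => ⟨step n T, h1 n T⟩
  obtain ⟨f, hf⟩ := exists_mem_iInter_of_antitone (T := fun n => (seq n).1)
    (fun n β h => h2 n (seq n) β h) (fun n => (seq n).2.2)
  obtain ⟨B, rfl⟩ := exists_chi_eq f
  refine ⟨B, fun hdec => ?_, hf 0⟩
  obtain ⟨R, hR, hen⟩ := dec_iff_enumerates.1 hdec
  have : R ∈ Set.range r := hr ▸ hR
  obtain ⟨n, rfl⟩ := this
  exact h3 n (seq n) B (hf (n + 1)) hen

/-- The evading paths of the earlier dichotomy form a nonempty Π⁰₁ class relative to `Y`, to which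
the basis theorem applies. -/
theorem exists_disagreement_or_exists_evading {Y C : Set ℕ} (hC : ¬ Dec Y fun n => n ∈ C)
    {T : List Bool × (ℕ × Bool) → Prop} (hT : Sig Y T) :
    (∃ n, ∀ B : Set ℕ, ∃ k, T (ini (chi B) k, (n, !chi C n))) ∨
      ∃ n, ∃ B : Set ℕ, (¬ Dec (join B Y) fun n => n ∈ C) ∧
        ∀ k, ¬ T (ini (chi B) k, (n, chi C n)) := by
  rcases exists_disagreement_or_exists_path hC hT with ⟨n, hn⟩ | ⟨n, hn⟩
  · exact .inl ⟨n, fun B => hn (chi B)⟩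
  · obtain ⟨B, h1, h2⟩ := exists_path_avoiding hC
      (hT.comp (f := fun β => (β, (n, chi C n))) (by fun_prop)) hn
    exact .inr ⟨n, B, h1, h2⟩

/-! ## Branching sets of strings -/

/-- The set of codes of the strings in `H`. -/
def codes (H : Set Str) : Set ℕ := {k | ∃ σ ∈ H, k = Encodable.encode σ}

theorem encode_mem_codes {H : Set Str} {σ : Str} : Encodable.encode σ ∈ codes H ↔ σ ∈ H := by
  constructor
  · rintro ⟨τ, hτ, h⟩
    exact Encodable.encode_injective h ▸ hτ
  · intro h
    exact ⟨σ, h, rfl⟩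

theorem dec_codes {Y : Set ℕ} {H : Set Str} :
    (Dec Y fun n => n ∈ codes H) ↔ Dec Y fun σ : Str => σ ∈ H := by
  constructor
  · intro h
    exact (h.comp (f := fun σ : Str => Encodable.encode σ) (by fun_prop)).of_iff
      fun σ => encode_mem_codes.symm
  · intro h
    have h1 : Dec Y fun p : ℕ × Str => p.1 = Encodable.encode p.2 ∧ p.2 ∈ H :=
      (Dec.of_primrec (primrecPred_eq (by fun_prop) (by fun_prop))).and
        (h.comp (f := fun p : ℕ × Str => p.2) (by fun_prop))
    refine (h1.ex_mem (f := fun n : ℕ => (Encodable.decode n : Option Str).toList)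
      (Primrec.optionToList.comp (by fun_prop))).of_iff fun n => ?_
    constructor
    · rintro ⟨σ, hσ, rfl⟩
      exact ⟨σ, by simp, rfl, hσ⟩
    · rintro ⟨σ, -, h, hσ⟩
      exact ⟨σ, hσ, h⟩

theorem not_prefix_of_extend {σ τ σ' τ' : Str} (hσ : σ <+: σ') (hτ : τ <+: τ')
    (h1 : ¬ σ <+: τ) (h2 : ¬ τ <+: σ) : ¬ σ' <+: τ' := fun h =>
  (List.prefix_or_prefix_of_prefix (hσ.trans h) hτ).elim h1 h2

/-- Every element of `V` has two incomparable extensions in `V`. -/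
def Branching (V : Set Str) : Prop :=
  ∀ σ ∈ V, ∃ τ₁ ∈ V, ∃ τ₂ ∈ V, (σ <+: τ₁ ∧ σ <+: τ₂) ∧ ¬ τ₁ <+: τ₂ ∧ ¬ τ₂ <+: τ₁

namespace Branching
variable {V : Set Str}

theorem exists_long (hV : Branching V) {σ : Str} (hσ : σ ∈ V) (k : ℕ) :
    ∃ τ ∈ V, σ <+: τ ∧ k ≤ τ.length := by
  induction k with
  | zero => exact ⟨σ, hσ, List.prefix_rfl, by simp⟩
  | succ k ih =>
    obtain ⟨τ, hτ, h1, h2⟩ := ih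
    obtain ⟨τ₁, hτ₁, τ₂, hτ₂, ⟨h3, h4⟩, h5, h6⟩ := hV τ hτ
    refine ⟨τ₁, hτ₁, h1.trans h3, ?_⟩
    have := h3.length_le
    rcases Nat.lt_or_ge k τ₁.length with h | h
    · exact h
    · have : τ = τ₁ := h3.eq_of_length (by omega)
      -- An extension of the same length would be `τ` itself, and hence comparable with the other
      -- one.
      exact absurd (this ▸ h4) h5

theorem upward (hV : Branching V) {S : Str → Prop} (hS : ∀ σ τ, σ <+: τ → S σ → S τ) :
    Branching {σ | σ ∈ V ∧ S σ} := by
  rintro σ ⟨hσ, h⟩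
  obtain ⟨τ₁, hτ₁, τ₂, hτ₂, ⟨h3, h4⟩, h5⟩ := hV σ hσ
  exact ⟨τ₁, ⟨hτ₁, hS _ _ h3 h⟩, τ₂, ⟨hτ₂, hS _ _ h4 h⟩, ⟨h3, h4⟩, h5⟩

theorem cone (hV : Branching V) (ρ : Str) : Branching {σ | σ ∈ V ∧ ρ <+: σ} :=
  hV.upward fun _ _ h h' => h'.trans h

theorem long (hV : Branching V) (k : ℕ) : Branching {σ | σ ∈ V ∧ k ≤ σ.length} :=
  hV.upward fun _ _ h h' => h'.trans h.length_le

theorem union {ι : Type*} {l : List ι} {U : ι → Set Str} (h : ∀ i ∈ l, Branching (U i)) :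
    Branching {σ | ∃ i ∈ l, σ ∈ U i} := by
  rintro σ ⟨i, hi, hσ⟩
  obtain ⟨τ₁, hτ₁, τ₂, hτ₂, h3⟩ := h i hi σ hσ
  exact ⟨τ₁, ⟨i, hi, hτ₁⟩, τ₂, ⟨i, hi, hτ₂⟩, h3⟩

end Branching

theorem primrecPred_prefix {α : Type*} [Primcodable α] {f g : α → Str} (hf : Primrec f)
    (hg : Primrec g) : PrimrecPred fun a => f a <+: g a :=
  (primrecPred_eq hf (primrec_take (primrec_length hf) hg)).of_eq fun _ =>
    List.prefix_iff_eq_take.symm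

theorem dec_cone {Y : Set ℕ} {V : Set Str} (hV : Dec Y fun σ => σ ∈ V) (ρ : Str) :
    Dec Y fun σ => σ ∈ {σ | σ ∈ V ∧ ρ <+: σ} :=
  hV.and (.of_primrec (primrecPred_prefix (by fun_prop) (by fun_prop)))

/-- `U` is a `Y`-computable branching set of elements of `V ∩ S`, and meets the cone above `ρ`. -/
def SubAbove (Y : Set ℕ) (V S : Set Str) (ρ : Str) (U : Set Str) : Prop :=
  (Dec Y fun σ => σ ∈ U) ∧ Branching U ∧ U ⊆ V ∧ U ⊆ S ∧ ∃ τ ∈ U, ρ <+: τ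

/-- Either some cone of `V` above `ρ` misses `S`, and that cone serves; or `S` is dense in `V` above
some extension of `ρ`, and intersecting with `S` keeps the branching property. -/
theorem exists_subAbove_or {Y : Set ℕ} {V S : Set Str} (hV : Branching V)
    (hVY : Dec Y fun σ => σ ∈ V) (hS : Dec Y fun σ => σ ∈ S) {ρ : Str} (hρ : ∃ τ ∈ V, ρ <+: τ) :
    (∃ U, SubAbove Y V S ρ U) ∨ ∃ U, SubAbove Y V Sᶜ ρ U := by
  obtain ⟨τ, hτ, hρτ⟩ := hρ
  by_cases h : ∃ w ∈ V, τ <+: w ∧ ∀ u ∈ V, w <+: u → u ∉ S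
  · obtain ⟨w, hw, hτw, hu⟩ := h
    exact .inr ⟨{σ | σ ∈ V ∧ w <+: σ}, dec_cone hVY w, hV.cone w, fun σ h => h.1,
      fun σ h => hu σ h.1 h.2, w, ⟨hw, List.prefix_rfl⟩, hρτ.trans hτw⟩
  · push Not at h
    refine .inl ⟨{σ | (σ ∈ V ∧ τ <+: σ) ∧ σ ∈ S}, (dec_cone hVY τ).and hS, ?_,
      fun σ h => h.1.1, fun σ h => h.2, ?_⟩
    · rintro σ ⟨⟨h1, h2⟩, -⟩
      obtain ⟨τ₁, hτ₁, τ₂, hτ₂, ⟨h3, h4⟩, h5, h6⟩ := hV σ h1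
      obtain ⟨u₁, hu₁, h7, h8⟩ := h τ₁ hτ₁ (h2.trans h3)
      obtain ⟨u₂, hu₂, h9, h10⟩ := h τ₂ hτ₂ (h2.trans h4)
      exact ⟨u₁, ⟨⟨hu₁, (h2.trans h3).trans h7⟩, h8⟩, u₂, ⟨⟨hu₂, (h2.trans h4).trans h9⟩, h10⟩,
        ⟨h3.trans h7, h4.trans h9⟩, not_prefix_of_extend h7 h9 h5 h6,
        not_prefix_of_extend h9 h7 h6 h5⟩
    · obtain ⟨u, hu, h1, h2⟩ := h τ hτ List.prefix_rfl
      exact ⟨u, ⟨⟨hu, h1⟩, h2⟩, hρτ.trans h1⟩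

/-! ## Forcing conditions -/

/-- A forcing condition: a finite set `F ⊆ P` and a reservoir `V`, computable in a set `Y` that
does not compute `C`. -/
structure Cond (Z C : Set ℕ) (P : Set Str) where
  /-- the finite part -/
  F : List Str
  /-- the reservoir -/
  V : Set Str
  /-- an oracle for the reservoir -/
  Y : Set ℕ
  F_sub : ∀ σ ∈ F, σ ∈ P
  branching : Branching V
  -- The empty string is included so that the reservoir is nonempty even when `F` is empty.
  cover : ∀ σ ∈ [] :: F, ∃ τ ∈ V, σ <+: τ
  dec_V : Dec Y fun σ => σ ∈ V
  dec_Z : Dec Y fun n => n ∈ Z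
  not_dec : ¬ Dec Y fun n => n ∈ C

namespace Cond
variable {Z C : Set ℕ} {P : Set Str}

/-- `c'` extends `c`. -/
def Ext (c' c : Cond Z C P) : Prop :=
  (Dec c'.Y fun n => n ∈ c.Y) ∧ c.F ⊆ c'.F ∧ (∀ σ ∈ c'.F, σ ∈ c.F ∨ σ ∈ c.V) ∧ c'.V ⊆ c.V

theorem Ext.refl (c : Cond Z C P) : Ext c c :=
  ⟨.mem, fun _ h => h, fun _ h => .inl h, fun _ h => h⟩

theorem Ext.trans {c₁ c₂ c₃ : Cond Z C P} (h : Ext c₁ c₂) (h' : Ext c₂ c₃) : Ext c₁ c₃ :=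
  ⟨h'.1.trans h.1, fun _ hσ => h.2.1 (h'.2.1 hσ),
    fun σ hσ => (h.2.2.1 σ hσ).elim (fun h => h'.2.2.1 σ h) fun h => .inr (h'.2.2.2 h),
    fun _ hσ => h'.2.2.2 (h.2.2.2 hσ)⟩

/-- `G` satisfies `c`. -/
def Allows (c : Cond Z C P) (G : Set Str) : Prop :=
  (∀ σ ∈ c.F, σ ∈ G) ∧ ∀ σ ∈ G, σ ∈ c.F ∨ σ ∈ c.V

/-- `c` forces that `R` does not compute `C` from the generic set and `Z`. -/
def Forces (c : Cond Z C P) (R : List Bool × (ℕ × Bool) → Prop) : Prop :=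
  ∀ G, c.Allows G → ¬ Enumerates R (join (codes G) Z) C

/-- Below `c`, every requirement can be forced. -/
def Dense (c : Cond Z C P) : Prop :=
  ∀ d, Ext d c → ∀ R, PrimrecPred R → ∃ e, Ext e d ∧ Forces e R

/-- Two incomparable elements of the reservoir have cones that are again admissible reservoirs, so
by `hP` each of them contains an element of `P` that can be put into `F`. -/
theorem exists_split (c : Cond Z C P)
    (hP : ∀ Y V, (¬ Dec Y fun n => n ∈ C) → (Dec Y fun σ => σ ∈ V) → (Dec Y fun n => n ∈ Z) →
      Branching V → V.Nonempty → ∃ σ ∈ V, σ ∈ P) (σ : Str) (hσ : σ ∈ [] :: c.F) :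
    ∃ d, Ext d c ∧ ∃ τ₁ ∈ d.F, ∃ τ₂ ∈ d.F, (σ <+: τ₁ ∧ σ <+: τ₂) ∧ ¬ τ₁ <+: τ₂ ∧ ¬ τ₂ <+: τ₁ := by
  obtain ⟨τ, hτ, hστ⟩ := c.cover σ hσ
  obtain ⟨τ₁, hτ₁, τ₂, hτ₂, ⟨h3, h4⟩, h5, h6⟩ := c.branching τ hτ
  obtain ⟨u₁, ⟨hu₁, h7⟩, h8⟩ := hP c.Y _ c.not_dec (dec_cone c.dec_V τ₁) c.dec_Z
    (c.branching.cone τ₁) ⟨τ₁, hτ₁, List.prefix_rfl⟩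
  obtain ⟨u₂, ⟨hu₂, h9⟩, h10⟩ := hP c.Y _ c.not_dec (dec_cone c.dec_V τ₂) c.dec_Z
    (c.branching.cone τ₂) ⟨τ₂, hτ₂, List.prefix_rfl⟩
  refine ⟨⟨u₁ :: u₂ :: c.F, c.V, c.Y, ?_, c.branching, ?_, c.dec_V, c.dec_Z, c.not_dec⟩,
    ⟨.mem, fun ρ hρ => by simp [hρ], ?_, fun _ h => h⟩, u₁, by simp, u₂, by simp,
    ⟨(hστ.trans h3).trans h7, (hστ.trans h4).trans h9⟩, not_prefix_of_extend h7 h9 h5 h6,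
    not_prefix_of_extend h9 h7 h6 h5⟩
  · intro ρ hρ
    simp only [List.mem_cons] at hρ
    rcases hρ with rfl | rfl | hρ
    · exact h8
    · exact h10
    · exact c.F_sub ρ hρ
  · intro ρ hρ
    simp only [List.mem_cons] at hρ
    rcases hρ with rfl | rfl | rfl | hρ
    · exact c.cover _ (by simp)
    · exact ⟨_, hu₁, List.prefix_rfl⟩
    · exact ⟨_, hu₂, List.prefix_rfl⟩
    · exact c.cover _ (by simp [hρ])
  · intro ρ hρ
    simp only [List.mem_cons] at hρ
    rcases hρ with rfl | rfl | hρ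
    · exact .inr hu₁
    · exact .inr hu₂
    · exact .inl hρ

theorem exists_split_all (c : Cond Z C P)
    (hP : ∀ Y V, (¬ Dec Y fun n => n ∈ C) → (Dec Y fun σ => σ ∈ V) → (Dec Y fun n => n ∈ Z) →
      Branching V → V.Nonempty → ∃ σ ∈ V, σ ∈ P) (l : List Str) (hl : l ⊆ [] :: c.F) :
    ∃ d, Ext d c ∧ ∀ σ ∈ l, ∃ τ₁ ∈ d.F, ∃ τ₂ ∈ d.F,
      (σ <+: τ₁ ∧ σ <+: τ₂) ∧ ¬ τ₁ <+: τ₂ ∧ ¬ τ₂ <+: τ₁ := by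
  induction l with
  | nil => exact ⟨c, .refl c, by simp⟩
  | cons σ l ih =>
    obtain ⟨d, hd, h⟩ := ih fun ρ hρ => hl (by simp [hρ])
    obtain ⟨e, he, h'⟩ := exists_split d hP σ (by
      rcases List.mem_cons.1 (hl (List.mem_cons_self)) with h | h
      · simp [h]
      · exact List.mem_cons_of_mem _ (hd.2.1 h))
    refine ⟨e, he.trans hd, fun ρ hρ => ?_⟩
    rcases List.mem_cons.1 hρ with rfl | hρ
    · exact h'
    · obtain ⟨τ₁, h1, τ₂, h2, h3⟩ := h ρ hρ
      exact ⟨τ₁, he.2.1 h1, τ₂, he.2.1 h2, h3⟩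

/-- Alternate between splitting all current elements and forcing the next requirement; the union of
the finite parts is the generic set. -/
theorem exists_generic (c : Cond Z C P) (hc : c.Dense)
    (hP : ∀ Y V, (¬ Dec Y fun n => n ∈ C) → (Dec Y fun σ => σ ∈ V) → (Dec Y fun n => n ∈ Z) →
      Branching V → V.Nonempty → ∃ σ ∈ V, σ ∈ P) :
    ∃ G ⊆ P, G.Nonempty ∧ Branching G ∧ ¬ Dec (join (codes G) Z) fun n => n ∈ C := by
  have hne : {R : List Bool × (ℕ × Bool) → Prop | PrimrecPred R}.Nonempty :=
    ⟨fun _ => True, (primrecPred_eq primrec_id primrec_id).of_eq (by simp)⟩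
  obtain ⟨r, hr⟩ := countable_primrecPred.exists_eq_range hne
  have hr' : ∀ n, PrimrecPred (r n) := fun n => by
    have : r n ∈ {R : List Bool × (ℕ × Bool) → Prop | PrimrecPred R} := hr ▸ ⟨n, rfl⟩
    exact this
  have hstep : ∀ (n : ℕ) (d : {d // Ext d c}), ∃ e : {d // Ext d c}, Ext e.1 d.1 ∧
      Forces e.1 (r n) ∧ ∀ σ ∈ [] :: d.1.F, ∃ τ₁ ∈ e.1.F, ∃ τ₂ ∈ e.1.F,
        (σ <+: τ₁ ∧ σ <+: τ₂) ∧ ¬ τ₁ <+: τ₂ ∧ ¬ τ₂ <+: τ₁ := by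
    rintro n ⟨d, hd⟩
    obtain ⟨e₁, h1, h2⟩ := exists_split_all d hP _ (fun _ h => h)
    obtain ⟨e₂, h3, h4⟩ := hc e₁ (h1.trans hd) _ (hr' n)
    refine ⟨⟨e₂, (h3.trans h1).trans hd⟩, h3.trans h1, h4, fun σ hσ => ?_⟩
    obtain ⟨τ₁, h5, τ₂, h6, h7⟩ := h2 σ hσ
    exact ⟨τ₁, h3.2.1 h5, τ₂, h3.2.1 h6, h7⟩
  choose step h1 h2 h3 using hstep
  let seq : ℕ → {d // Ext d c} := fun n => n.rec ⟨c, .refl c⟩ fun n d => step n d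
  have hmono : ∀ m n, m ≤ n → Ext (seq n).1 (seq m).1 := by
    intro m n h
    induction n, h using Nat.le_induction with
    | base => exact .refl _
    | succ n _ ih => exact (h1 n (seq n)).trans ih
  refine ⟨{σ | ∃ n, σ ∈ (seq n).1.F}, ?_, ?_, ?_, ?_⟩
  · rintro σ ⟨n, hσ⟩
    exact (seq n).1.F_sub σ hσ
  · obtain ⟨τ, h, -⟩ := h3 0 (seq 0) [] (by simp)
    exact ⟨τ, 1, h⟩
  · rintro σ ⟨n, hσ⟩
    obtain ⟨τ₁, h4, τ₂, h5, h6⟩ := h3 n (seq n) σ (by simp [hσ])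
    exact ⟨τ₁, ⟨n + 1, h4⟩, τ₂, ⟨n + 1, h5⟩, h6⟩
  · intro hdec
    obtain ⟨R, hR, hen⟩ := dec_iff_enumerates.1 hdec
    have : R ∈ Set.range r := hr ▸ hR
    obtain ⟨n, rfl⟩ := this
    -- Whatever enters after stage `n + 1` is taken from the reservoir of that stage, so the union
    -- satisfies every condition of the sequence.
    refine h2 n (seq n) {σ | ∃ n, σ ∈ (seq n).1.F} ⟨fun σ hσ => ⟨n + 1, hσ⟩, ?_⟩ hen
    rintro σ ⟨m, hσ⟩
    rcases le_total m (n + 1) with h | h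
    · exact .inl ((hmono _ _ h).2.1 hσ)
    · exact (hmono _ _ h).2.2.1 σ hσ

end Cond

/-! ### Forcing a requirement by a wrong value or by a missing correct value -/

theorem ini_join_codes {G G' : Set Str} {Z : Set ℕ} {k : ℕ}
    (h : ∀ σ : Str, Encodable.encode σ < k → (σ ∈ G ↔ σ ∈ G')) :
    ini (chi (join (codes G) Z)) k = ini (chi (join (codes G') Z)) k := by
  refine ini_congr fun i hi => ?_
  rw [Bool.eq_iff_iff, chi_eq_true, chi_eq_true]
  rcases Nat.even_or_odd' i with ⟨j, rfl | rfl⟩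
  · rw [mem_join_left, mem_join_left]
    constructor
    · rintro ⟨σ, hσ, rfl⟩
      exact encode_mem_codes.2 ((h σ (by omega)).1 hσ)
    · rintro ⟨σ, hσ, rfl⟩
      exact encode_mem_codes.2 ((h σ (by omega)).2 hσ)
  · rw [mem_join_right, mem_join_right]

namespace Cond
variable {Z C : Set ℕ} {P : Set Str}

/-- The wrong computation is preserved by putting `E` into the finite part and removing from the
reservoir all strings short enough to affect its use. -/
theorem exists_forces_of_computation (c : Cond Z C P) {R : List Bool × (ℕ × Bool) → Prop}
    {E : List Str} (hE : ∀ τ ∈ E, τ ∈ c.V ∧ τ ∈ P) {n k : ℕ}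
    (hR : R (ini (chi (join (codes {σ | σ ∈ c.F ++ E}) Z)) k, (n, !chi C n))) :
    ∃ d, Ext d c ∧ Forces d R := by
  have hlong : ∀ σ ∈ [] :: (c.F ++ E), ∃ τ ∈ {σ | σ ∈ c.V ∧ k ≤ σ.length}, σ <+: τ := by
    intro σ hσ
    obtain ⟨τ, hτ, hστ⟩ : ∃ τ ∈ c.V, σ <+: τ := by
      rw [← List.cons_append, List.mem_append] at hσ
      rcases hσ with hσ | hσ
      · exact c.cover σ hσ
      · exact ⟨σ, (hE σ hσ).1, List.prefix_rfl⟩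
    obtain ⟨u, hu, h1, h2⟩ := c.branching.exists_long hτ k
    exact ⟨u, ⟨hu, h2⟩, hστ.trans h1⟩
  refine ⟨⟨c.F ++ E, {σ | σ ∈ c.V ∧ k ≤ σ.length}, c.Y, ?_, c.branching.long k, hlong,
    c.dec_V.and (.of_primrec (primrecPred_le (by fun_prop) (by fun_prop))), c.dec_Z, c.not_dec⟩,
    ⟨.mem, fun σ h => List.mem_append_left _ h, ?_, fun σ h => h.1⟩, ?_⟩
  · intro σ hσ
    rcases List.mem_append.1 hσ with hσ | hσ
    · exact c.F_sub σ hσ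
    · exact (hE σ hσ).2
  · intro σ hσ
    rcases List.mem_append.1 hσ with hσ | hσ
    · exact .inl hσ
    · exact .inr (hE σ hσ).1
  · rintro G ⟨h1, h2⟩ hen
    have hk : ini (chi (join (codes G) Z)) k =
        ini (chi (join (codes {σ | σ ∈ c.F ++ E}) Z)) k := by
      refine ini_join_codes fun σ hσ => ⟨fun h => ?_, fun h => h1 σ h⟩
      refine (h2 σ h).resolve_right fun h => ?_
      -- A string with code below `k` has length below `k`, so it is not in the new reservoir.
      have := Encodable.length_le_encode σ
      have := h.2
      omega
    have := (hen n (!chi C n)).2 ⟨k, hk ▸ hR⟩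
    simp at this

/-- A computation from `G` looks at finitely many strings only, so it would already be a computation
from `F` together with a finite part of the reservoir. -/
theorem forces_of_evading (c : Cond Z C P) {R : List Bool × (ℕ × Bool) → Prop} {n : ℕ}
    (h : ∀ E : List Str, (∀ τ ∈ E, τ ∈ c.V) → ∀ k,
      ¬ R (ini (chi (join (codes {σ | σ ∈ c.F ++ E}) Z)) k, (n, chi C n))) : Forces c R := by
  rintro G ⟨h1, h2⟩ hen
  obtain ⟨k, hk⟩ := (hen n _).1 rfl
  have hfin : {σ : Str | Encodable.encode σ < k ∧ σ ∈ G ∧ σ ∈ c.V}.Finite :=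
    Set.Finite.subset (Set.Finite.preimage Encodable.encode_injective.injOn (Set.finite_Iio k))
      fun σ hσ => hσ.1
  refine h hfin.toFinset.toList (by simp +contextual) k ?_
  convert hk using 2
  refine ini_join_codes fun σ hσ => ?_
  simp only [Set.mem_ofPred_eq, List.mem_append, Finset.mem_toList, Set.Finite.mem_toFinset]
  constructor
  · rintro (h | h)
    · exact h1 σ h
    · exact h.2.1
  · intro h
    exact (h2 σ h).imp id fun h' => ⟨hσ, h, h'⟩

/-- The new reservoir is the union of one branching set above each element of `[] :: F`. -/
theorem exists_ext_subset (c : Cond Z C P) {Y : Set ℕ} (hY : ¬ Dec Y fun n => n ∈ C)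
    (hcY : Dec Y fun n => n ∈ c.Y) {S : Set Str}
    (h : ∀ σ ∈ [] :: c.F, ∃ U, SubAbove Y c.V S σ U) :
    ∃ d, Ext d c ∧ d.F = c.F ∧ d.V ⊆ S := by
  choose! U hU using h
  refine ⟨⟨c.F, {τ | ∃ σ ∈ [] :: c.F, τ ∈ U σ}, Y, c.F_sub,
    .union fun σ hσ => (hU σ hσ).2.1, fun σ hσ => ?_,
    .fin_or _ fun σ hσ => (hU σ hσ).1, c.dec_Z.trans hcY, hY⟩,
    ⟨hcY, fun _ h => h, fun _ h => .inl h, ?_⟩, rfl, ?_⟩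
  · obtain ⟨τ, h1, h2⟩ := (hU σ hσ).2.2.2.2
    exact ⟨τ, ⟨σ, hσ, h1⟩, h2⟩
  · rintro τ ⟨σ, hσ, h⟩
    exact (hU σ hσ).2.2.1 h
  · rintro τ ⟨σ, hσ, h⟩
    exact (hU σ hσ).2.2.2.1 h

end Cond

/-- A finite set of elements of `W` of colour `b` yields, together with `F`, a computation. -/
def Question (Z : Set ℕ) (F : List Str) (W : Set Str) (R : List Bool × (ℕ × Bool) → Prop)
    (b : Bool) (p : List Bool × (ℕ × Bool)) : Prop :=
  ∃ E : List Str, (∀ τ ∈ E, τ ∈ W ∧ p.1[Encodable.encode τ]? = some b) ∧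
    ∃ k, R (ini (chi (join (codes {σ | σ ∈ F ++ E}) Z)) k, p.2)

theorem sig_question {Y Z : Set ℕ} (hZ : Dec Y fun n => n ∈ Z) (F : List Str) {W : Set Str}
    (hW : Dec Y fun σ => σ ∈ W) {R : List Bool × (ℕ × Bool) → Prop} (hR : PrimrecPred R)
    (b : Bool) : Sig Y (Question Z F W R b) := by
  have hM : Dec Y fun p : List Str × ℕ => p.2 ∈ join (codes {σ | σ ∈ F ++ p.1}) Z :=
    Dec.join (A := fun E : List Str => codes {σ | σ ∈ F ++ E})
      (Dec.of_primrec (S := fun p : List Str × ℕ => ∃ σ ∈ F ++ p.1, p.2 = Encodable.encode σ)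
        (primrecPred_exists_mem (S := fun q : (List Str × ℕ) × Str => q.1.2 = Encodable.encode q.2)
          (primrecPred_eq (by fun_prop) (by fun_prop)) (f := fun p : List Str × ℕ => F ++ p.1)
          (by fun_prop))) hZ
  have h1 : Sig Y fun q : ((List Bool × (ℕ × Bool)) × List Str) × Str =>
      q.2 ∈ W ∧ q.1.1.1[Encodable.encode q.2]? = some b :=
    (hW.1.comp (f := fun q : ((List Bool × (ℕ × Bool)) × List Str) × Str => q.2)
      (by fun_prop)).and (.of_primrec (primrecPred_eq (by fun_prop) (by fun_prop)))
  exact ((h1.all_mem (f := fun q : (List Bool × (ℕ × Bool)) × List Str => q.2)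
    (by fun_prop)).and ((Sig.uniform (M := fun E : List Str => join (codes {σ | σ ∈ F ++ E}) Z) hM
      (Sig.of_primrec hR)).comp (f := fun q : (List Bool × (ℕ × Bool)) × List Str => (q.2, q.1.2))
      (by fun_prop))).ex

theorem ini_getElem?_eq_some {f : ℕ → Bool} {k i : ℕ} {b : Bool} (h : (ini f k)[i]? = some b) :
    f i = b := by
  by_cases hi : i < k
  · rw [ini_getElem? f hi] at h
    exact Option.some.inj h
  · rw [List.getElem?_eq_none (by rw [ini_length]; omega)] at h
    cases h

/-- A finite `E` is covered by a long enough initial segment of `B`, along which the question would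
be answered positively. -/
theorem not_computation_of_not_question {B Z : Set ℕ} {F : List Str} {W : Set Str}
    {R : List Bool × (ℕ × Bool) → Prop} {b : Bool} {x : ℕ × Bool}
    (h : ∀ k, ¬ Question Z F W R b (ini (chi B) k, x)) {E : List Str}
    (hE : ∀ τ ∈ E, τ ∈ W ∧ chi B (Encodable.encode τ) = b) (k : ℕ) :
    ¬ R (ini (chi (join (codes {σ | σ ∈ F ++ E}) Z)) k, x) := by
  intro hR
  obtain ⟨m, hm⟩ : ∃ m, ∀ τ ∈ E, Encodable.encode τ < m := by
    clear h hE hR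
    induction E with
    | nil => exact ⟨0, by simp⟩
    | cons τ E ih =>
      obtain ⟨m, hm⟩ := ih
      refine ⟨max (Encodable.encode τ + 1) m, fun σ hσ => ?_⟩
      rcases List.mem_cons.1 hσ with rfl | hσ
      · exact lt_max_of_lt_left (Nat.lt_succ_self _)
      · exact lt_max_of_lt_right (hm σ hσ)
  refine h m ⟨E, fun τ hτ => ⟨(hE τ hτ).1, ?_⟩, k, hR⟩
  rw [ini_getElem? _ (hm τ hτ), (hE τ hτ).2]

/-! ## Strong cone avoidance for partitions of the full binary tree -/

section
variable {Z C : Set ℕ} {P : Set Str}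

/-- The blocked conditions are found one at a time, each over the oracle of the previous one, to end
with a common oracle. Raising the oracle of an earlier one is harmless: what extends the modified
condition extends the original. -/
theorem exists_blocks
    (hblock : ∀ c : Cond Z C Pᶜ, ∃ d, d.Ext c ∧ ∃ R, PrimrecPred R ∧
      ∀ e : Cond Z C Pᶜ, e.Ext d → ¬ e.Forces R)
    {Y : Set ℕ} {V : Set Str} (hY : ¬ Dec Y fun n => n ∈ C) (hZ : Dec Y fun n => n ∈ Z)
    (hV : Branching V) (hVY : Dec Y fun σ => σ ∈ V) (l : List Str)
    (hl : ∀ σ ∈ l, ∃ τ ∈ V, σ <+: τ) :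
    ∃ Y', (¬ Dec Y' fun n => n ∈ C) ∧ (Dec Y' fun n => n ∈ Y) ∧
      ∀ σ ∈ l, ∃ (d : Cond Z C Pᶜ) (R : _), d.Y = Y' ∧ d.V ⊆ {τ | τ ∈ V ∧ σ <+: τ} ∧
        PrimrecPred R ∧ ∀ e : Cond Z C Pᶜ, e.Ext d → ¬ e.Forces R := by
  induction l with
  | nil => exact ⟨Y, hY, .mem, by simp⟩
  | cons σ l ih =>
    obtain ⟨Y₁, hY₁, hYY₁, h⟩ := ih fun ρ hρ => hl ρ (by simp [hρ])
    obtain ⟨τ, hτ, hστ⟩ := hl σ (by simp)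
    obtain ⟨d, hd, R, hR, hbl⟩ := hblock ⟨[], {τ | τ ∈ V ∧ σ <+: τ}, Y₁, by simp, hV.cone σ,
      by simpa using ⟨τ, hτ, hστ⟩, (dec_cone hVY σ).trans hYY₁, hZ.trans hYY₁, hY₁⟩
    refine ⟨d.Y, d.not_dec, hYY₁.trans hd.1, fun ρ hρ => ?_⟩
    rcases List.mem_cons.1 hρ with rfl | hρ
    · exact ⟨d, R, rfl, hd.2.2.2, hR, hbl⟩
    · obtain ⟨e, R', rfl, h1, h2, h3⟩ := h ρ hρ
      refine ⟨⟨e.F, e.V, d.Y, e.F_sub, e.branching, e.cover, e.dec_V.trans hd.1,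
        e.dec_Z.trans hd.1, d.not_dec⟩, R', rfl, h1, h2, fun f hf => h3 f ?_⟩
      exact hf.trans ⟨hd.1, fun _ h => h, fun _ h => .inl h, fun _ h => h⟩

/-- This is the combinatorial core. A blocked `Pᶜ`-condition `d σ` lies above every `σ` in `[] ::
c.F`; each argument that would force `Q σ` below `d σ` is contradictory, which leaves only arguments
that force `R` on the side of `P`. -/
theorem exists_forces_of_block
    (hblock : ∀ c : Cond Z C Pᶜ, ∃ d, d.Ext c ∧ ∃ R, PrimrecPred R ∧
      ∀ e : Cond Z C Pᶜ, e.Ext d → ¬ e.Forces R)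
    (c : Cond Z C P) {R : List Bool × (ℕ × Bool) → Prop} (hR : PrimrecPred R) :
    ∃ d : Cond Z C P, d.Ext c ∧ d.Forces R := by
  obtain ⟨Y, hY, hcY, h⟩ := exists_blocks hblock c.not_dec c.dec_Z c.branching c.dec_V
    ([] :: c.F) c.cover
  have hZ := c.dec_Z.trans hcY
  have : Nonempty (Cond Z C Pᶜ) := ⟨(h [] (by simp)).choose⟩
  choose! d Q hdY hdV hQ hbl using h
  have hdec : ∀ σ ∈ [] :: c.F, Dec Y fun τ => τ ∈ (d σ).V := fun σ hσ => by
    have := (d σ).dec_V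
    rwa [hdY σ hσ] at this
  have hW : Dec Y fun τ => τ ∈ {τ | ∃ σ ∈ [] :: c.F, τ ∈ (d σ).V} := .fin_or _ hdec
  let c' : Cond Z C P := ⟨c.F, {τ | ∃ σ ∈ [] :: c.F, τ ∈ (d σ).V}, Y, c.F_sub,
    .union fun σ _ => (d σ).branching, fun σ hσ => by
      obtain ⟨τ, hτ, -⟩ := (d σ).cover [] (by simp)
      exact ⟨τ, ⟨σ, hσ, hτ⟩, (hdV σ hσ hτ).2⟩, hW, hZ, hY⟩
  have hc' : c'.Ext c := ⟨hcY, fun _ h => h, fun _ h => .inl h, by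
    rintro τ ⟨σ, hσ, hτ⟩
    exact (hdV σ hσ hτ).1⟩
  suffices h : ∃ e : Cond Z C P, e.Ext c' ∧ e.Forces R by
    obtain ⟨e, he, hf⟩ := h
    exact ⟨e, he.trans hc', hf⟩
  -- The colour `true` stands for the side of `P` with requirement `R`, the colour `false` for its
  -- complement with the blocked requirements.
  have hT := (sig_question hZ c.F hW hR true).or (Sig.fin_or ([] :: c.F)
    (S := fun σ => Question Z (d σ).F (d σ).V (Q σ) false)
    fun σ hσ => sig_question hZ _ (hdec σ hσ) (hQ σ hσ) false)
  rcases exists_disagreement_or_exists_evading hY hT with ⟨n, hn⟩ | ⟨n, B, hB, hn⟩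
  -- A wrong value is unavoidable, in particular for the actual partition, so `E` really lies in `P`
  -- or in `Pᶜ` and may enter a finite part.
  · obtain ⟨k, ⟨E, hE, j, hj⟩ | ⟨σ, hσ, E, hE, j, hj⟩⟩ := hn (codes P)
    · refine c'.exists_forces_of_computation (E := E) (fun τ hτ => ⟨(hE τ hτ).1, ?_⟩) hj
      exact encode_mem_codes.1 (chi_eq_true.1 (ini_getElem?_eq_some (hE τ hτ).2))
    · obtain ⟨e, he, hf⟩ := (d σ).exists_forces_of_computation (E := E)
        (fun τ hτ => ⟨(hE τ hτ).1, fun h => chi_eq_false.1 (ini_getElem?_eq_some (hE τ hτ).2)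
          (encode_mem_codes.2 h)⟩) hj
      exact absurd hf (hbl σ hσ e he)
  · have hS : Dec (join B Y) fun τ : Str => τ ∈ {τ : Str | chi B (Encodable.encode τ) = true} :=
      ((dec_join_left B Y).comp (f := fun τ : Str => Encodable.encode τ) (by fun_prop)).of_iff
        fun τ => chi_eq_true
    have hYB := dec_join_right B Y
    -- Here `B` evades the correct value. If a whole block `d σ` can be thinned to the complement of
    -- `B`, then `Q σ` gets forced, which is impossible.
    by_cases hside : ∃ σ ∈ [] :: c.F, ∀ τ ∈ [] :: (d σ).F,
        ∃ U, SubAbove (join B Y) (d σ).V {τ : Str | chi B (Encodable.encode τ) = true}ᶜ τ U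
    · obtain ⟨σ, hσ, hU⟩ := hside
      obtain ⟨e, he, heF, heV⟩ := (d σ).exists_ext_subset hB (by rwa [hdY σ hσ]) hU
      refine absurd (e.forces_of_evading (n := n) fun E hE k => ?_) (hbl σ hσ e he)
      rw [heF]
      exact not_computation_of_not_question (fun k hq => hn k (.inr ⟨σ, hσ, hq⟩))
        (fun τ hτ => ⟨he.2.2.2 (hE τ hτ), by simpa using heV (hE τ hτ)⟩) k
    · push Not at hside
      obtain ⟨e, he, heF, heV⟩ := c'.exists_ext_subset hB hYB
        (S := {τ : Str | chi B (Encodable.encode τ) = true}) fun σ hσ => by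
          obtain ⟨τ, hτ, hU⟩ := hside σ hσ
          -- In each block some `τ` cannot be handled off `B`, so it can be handled inside `B`. As
          -- the block lies above `σ`, this covers `σ`, whatever `τ` is.
          obtain ⟨U, h1, h2, h3, h4, u, hu, -⟩ := (exists_subAbove_or (d σ).branching
            ((hdec σ hσ).trans hYB) hS ((d σ).cover τ hτ)).resolve_right fun ⟨U, h⟩ => hU U h
          exact ⟨U, h1, h2, fun ρ hρ => ⟨σ, hσ, h3 hρ⟩, h4, u, hu, (hdV σ hσ (h3 hu)).2⟩
      refine ⟨e, he, e.forces_of_evading (n := n) fun E hE k => ?_⟩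
      rw [heF]
      exact not_computation_of_not_question (fun k hq => hn k (.inl hq))
        (fun τ hτ => ⟨he.2.2.2 (hE τ hτ), heV (hE τ hτ)⟩) k

/-- Strong cone avoidance for two-colourings of the full binary tree. -/
theorem exists_branching_avoiding (hC : ¬ Dec Z fun n => n ∈ C) (P : Set Str) :
    ∃ G : Set Str, (G ⊆ P ∨ G ⊆ Pᶜ) ∧ G.Nonempty ∧ Branching G ∧
      ¬ Dec (join (codes G) Z) fun n => n ∈ C := by
  by_contra hcon
  push Not at hcon
  -- A reservoir missing one part lies in the other and would itself be a solution.
  have hmeet : ∀ Q : Set Str, Q = P ∨ Q = Pᶜ → ∀ Y V, (¬ Dec Y fun n => n ∈ C) →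
      (Dec Y fun σ => σ ∈ V) → (Dec Y fun n => n ∈ Z) → Branching V → V.Nonempty →
      ∃ σ ∈ V, σ ∈ Q := by
    intro Q hQ Y V hY hVY hZ hV hne
    by_contra hno
    push Not at hno
    refine hY ((hcon V ?_ hne hV).trans (dec_join (dec_codes.2 hVY) hZ))
    rcases hQ with rfl | rfl
    · exact .inr hno
    · exact .inl fun σ hσ => by simpa using hno σ hσ
  have hfull : Branching Set.univ := fun σ _ =>
    ⟨σ ++ [false], trivial, σ ++ [true], trivial, ⟨by simp, by simp⟩, by simp, by simp⟩
  have huniv : Dec Z fun σ : Str => σ ∈ (Set.univ : Set Str) :=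
    (Dec.of_primrec (primrecPred_eq primrec_id primrec_id)).of_iff (by simp)
  by_cases h : ∃ c : Cond Z C Pᶜ, c.Dense
  · obtain ⟨c, hc⟩ := h
    obtain ⟨G, h1, h2, h3, h4⟩ := c.exists_generic hc (hmeet _ (.inr rfl))
    exact h4 (hcon G (.inr h1) h2 h3)
  -- With no dense condition on the side of `Pᶜ`, every such condition extends to a blocked one, and
  -- the trivial condition for `P` is dense.
  · simp only [Cond.Dense] at h
    push Not at h
    let c : Cond Z C P := ⟨[], Set.univ, Z, by simp, hfull, by simp, huniv, .mem, hC⟩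
    obtain ⟨G, h1, h2, h3, h4⟩ := c.exists_generic
      (fun d _ R hR => exists_forces_of_block h d hR) (hmeet _ (.inl rfl))
    exact h4 (hcon G (.inl h1) h2 h3)

end

/-! ## Thinning a branching set to an isomorphic copy of the full binary tree -/

/-- `b` is the first element with `S (a, b)`. -/
def First {α β : Type*} [Encodable β] (S : α × β → Prop) (p : α × β) : Prop :=
  S p ∧ ∀ i < Encodable.encode p.2, ∀ b ∈ (Encodable.decode i : Option β).toList,
    Encodable.encode b = i → ¬ S (p.1, b)

theorem First.dec {α β : Type*} [Primcodable α] [Primcodable β] {Y : Set ℕ} {S : α × β → Prop}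
    (hS : Dec Y S) : Dec Y (First S) := by
  have h : Dec Y fun q : ((α × β) × ℕ) × β => Encodable.encode q.2 = q.1.2 → ¬ S (q.1.1.1, q.2) :=
    (Dec.of_primrec (primrecPred_eq (by fun_prop) (by fun_prop))).imp
      (hS.not.comp (f := fun q : ((α × β) × ℕ) × β => (q.1.1.1, q.2)) (by fun_prop))
  exact hS.and ((h.all_mem (f := fun q : (α × β) × ℕ => (Encodable.decode q.2 : Option β).toList)
    (Primrec.optionToList.comp (by fun_prop))).all_lt
    (f := fun p : α × β => Encodable.encode p.2) (by fun_prop))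

section
variable {α β : Type*} [Encodable β] {S : α × β → Prop} {a : α} {b b' : β}

theorem First.unique (h : First S (a, b)) (h' : First S (a, b')) : b = b' := by
  rcases lt_trichotomy (Encodable.encode b) (Encodable.encode b') with hlt | heq | hlt
  · exact absurd h.1 (h'.2 _ hlt b (by simp) rfl)
  · exact Encodable.encode_injective heq
  · exact absurd h'.1 (h.2 _ hlt b' (by simp) rfl)

theorem First.exists (h : ∃ b, S (a, b)) : ∃ b, First S (a, b) := by
  classical
  have hn : ∃ n, ∃ b, Encodable.encode b = n ∧ S (a, b) := by
    obtain ⟨b, hb⟩ := h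
    exact ⟨_, b, rfl, hb⟩
  obtain ⟨b, hb, hS⟩ := Nat.find_spec hn
  refine ⟨b, hS, fun i hi b' _ hi' hS' => ?_⟩
  dsimp only at hi
  rw [hb] at hi
  exact Nat.find_min hn hi ⟨b', hi', hS'⟩

end

theorem SPre.not_prefix {σ τ : Str} (h : SPre σ τ) : ¬ τ <+: σ := fun h' =>
  h.2 (h.1.eq_of_length (le_antisymm h.1.length_le h'.length_le))

theorem SPre.trans_prefix {σ τ ρ : Str} (h : SPre σ τ) (h' : τ <+: ρ) : SPre σ ρ :=
  ⟨h.1.trans h', fun he => h.not_prefix (he ▸ h')⟩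

theorem SPre.length_lt {σ τ : Str} (h : SPre σ τ) : σ.length < τ.length :=
  lt_of_le_of_ne h.1.length_le fun he => h.2 (h.1.eq_of_length he)

section
variable (G : Set Str) (Good : Str × Str → Prop) (root : Str)

/-- `p` is a possible pair of successors for the last node of the branch `L`. -/
def SuccPair (q : List Str × (Str × Str)) : Prop :=
  q.1 ≠ [] ∧ (q.2.1 ∈ G ∧ q.2.2 ∈ G) ∧ (¬ q.2.1 <+: q.2.2 ∧ ¬ q.2.2 <+: q.2.1) ∧
    ∀ ρ ∈ q.1, Good (ρ, q.2.1) ∧ Good (ρ, q.2.2)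

/-- `L` is a branch, listed downwards, of the tree built from `root` by taking the first possible
pair of successors. -/
def Branch (L : List Str) : Prop :=
  L ≠ [] ∧ ∀ i < L.length, (i + 1 = L.length ∧ L[i]? = some root) ∨
    ∃ p : Str × Str, First (SuccPair G Good) (L.drop (i + 1), p) ∧
      (L[i]? = some p.1 ∨ L[i]? = some p.2)

/-- The tree of the last nodes of branches. -/
def thinTree : Set Str := {σ | ∃ M, Branch G Good root (σ :: M)}

variable {G Good root}

theorem branch_singleton {σ : Str} : Branch G Good root [σ] ↔ σ = root := by
  constructor
  · rintro ⟨-, h⟩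
    rcases h 0 (by simp) with ⟨-, h⟩ | ⟨p, h, -⟩
    · simpa using h
    · exact absurd rfl h.1.1
  · rintro rfl
    exact ⟨by simp, fun i hi => .inl (by simp at hi; simp [hi])⟩

/-- `Branch` is defined entry by entry so that its complexity can be read off; this recursive form
serves the inductions. -/
theorem branch_cons_cons {σ τ : Str} {M : List Str} : Branch G Good root (τ :: σ :: M) ↔
    Branch G Good root (σ :: M) ∧ ∃ p : Str × Str, First (SuccPair G Good) (σ :: M, p) ∧
      (τ = p.1 ∨ τ = p.2) := by
  constructor
  · rintro ⟨-, h⟩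
    refine ⟨⟨by simp, fun i hi => ?_⟩, ?_⟩
    · simpa using h (i + 1) (by simpa using hi)
    · simpa using h 0 (by simp)
  · rintro ⟨⟨-, h⟩, h'⟩
    refine ⟨by simp, fun i hi => ?_⟩
    cases i with
    | zero => exact .inr (by simpa using h')
    | succ i => simpa using h i (by simpa using hi)

theorem Branch.tail {σ : Str} {M L : List Str} (hL : Branch G Good root L)
    (h : (σ :: M) <:+ L) : Branch G Good root (σ :: M) := by
  induction L with
  | nil => simp at h
  | cons τ L ih =>
    rcases List.suffix_cons_iff.1 h with h | h
    · rwa [h]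
    · cases L with
      | nil => simp at h
      | cons ρ L => exact ih (branch_cons_cons.1 hL).1 h

theorem Branch.mem (hroot : root ∈ G) {L : List Str} (hL : Branch G Good root L) :
    ∀ ρ ∈ L, ρ ∈ G := by
  induction L with
  | nil => simp
  | cons τ L ih =>
    cases L with
    | nil => rw [branch_singleton] at hL; simpa [hL]
    | cons σ M =>
      obtain ⟨h1, p, h2, h3⟩ := branch_cons_cons.1 hL
      intro ρ hρ
      rcases List.mem_cons.1 hρ with rfl | hρ
      · rcases h3 with rfl | rfl
        · exact h2.1.2.1.1
        · exact h2.1.2.1.2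
      · exact ih h1 ρ hρ

theorem Branch.good {τ : Str} {L : List Str} (hL : Branch G Good root (τ :: L)) :
    ∀ ρ ∈ L, Good (ρ, τ) := by
  cases L with
  | nil => simp
  | cons σ M =>
    obtain ⟨h1, p, h2, h3⟩ := branch_cons_cons.1 hL
    intro ρ hρ
    rcases h3 with rfl | rfl
    · exact (h2.1.2.2.2 ρ hρ).1
    · exact (h2.1.2.2.2 ρ hρ).2

theorem Branch.root_suffix {L : List Str} (hL : Branch G Good root L) : [root] <:+ L := by
  induction L with
  | nil => exact absurd rfl hL.1
  | cons τ L ih =>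
    cases L with
    | nil => rw [branch_singleton] at hL; rw [hL]
    | cons σ M => exact (ih (branch_cons_cons.1 hL).1).trans (List.suffix_cons _ _)


/-- Two branches that part ways do so at the two members of one first pair. These are incomparable,
and so are all their extensions. -/
theorem Branch.trichotomy {L L' : List Str} (hGood : ∀ σ τ, Good (σ, τ) → SPre σ τ)
    (hL : Branch G Good root L) (hL' : Branch G Good root L') :
    L <:+ L' ∨ L' <:+ L ∨ ∀ σ ∈ L.head?, ∀ τ ∈ L'.head?, ¬ σ <+: τ ∧ ¬ τ <+: σ := by
  have hext : ∀ {σ : Str} {M : List Str}, Branch G Good root (σ :: M) → ∀ ρ ∈ σ :: M, ρ <+: σ :=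
    fun hB ρ hρ => by
      rcases List.mem_cons.1 hρ with rfl | hρ
      · exact List.prefix_rfl
      · exact (hGood _ _ (hB.good ρ hρ)).1
  obtain ⟨τ', N', rfl⟩ := List.exists_cons_of_ne_nil hL'.1
  induction L with
  | nil => exact absurd rfl hL.1
  | cons τ L ih =>
    cases L with
    | nil =>
      rw [branch_singleton] at hL
      exact .inl (hL ▸ hL'.root_suffix)
    | cons σ M =>
      obtain ⟨h1, p, h2, h3⟩ := branch_cons_cons.1 hL
      rcases ih h1 with h | h | h
      · rcases eq_or_ne (σ :: M) (τ' :: N') with heq | hne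
        · exact .inr (.inl (heq ▸ List.suffix_cons _ _))
        obtain ⟨ρ, hρ⟩ : ∃ ρ, (ρ :: σ :: M) <:+ τ' :: N' := by
          obtain ⟨K, hK⟩ := h
          rcases List.eq_nil_or_concat K with rfl | ⟨K, ρ, rfl⟩
          · exact absurd hK hne
          · exact ⟨ρ, K, by simpa using hK⟩
        obtain ⟨-, p', h4, h5⟩ := branch_cons_cons.1 (hL'.tail hρ)
        obtain rfl := h2.unique h4
        by_cases heq : τ = ρ
        · exact .inl (heq ▸ hρ)
        · right; right
          have hρτ : ρ <+: τ' := hext hL' ρ (hρ.subset (by simp))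
          have hinc : ¬ τ <+: ρ ∧ ¬ ρ <+: τ := by
            have := h2.1.2.2.1
            rcases h3 with rfl | rfl <;> rcases h5 with rfl | rfl
            · exact absurd rfl heq
            · exact this
            · exact this.symm
            · exact absurd rfl heq
          simp only [List.head?_cons, Option.mem_some_iff, forall_eq']
          exact ⟨not_prefix_of_extend List.prefix_rfl hρτ hinc.1 hinc.2,
            not_prefix_of_extend hρτ List.prefix_rfl hinc.2 hinc.1⟩
      · exact .inr (.inl (h.trans (List.suffix_cons _ _)))
      · right; right
        simp only [List.head?_cons, Option.mem_some_iff, forall_eq'] at h ⊢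
        have hστ : σ <+: τ := hext hL σ (by simp)
        exact ⟨not_prefix_of_extend hστ List.prefix_rfl h.1 h.2,
          not_prefix_of_extend List.prefix_rfl hστ h.2 h.1⟩

/-- Comparability of strings excludes all but one case of the trichotomy; `ρ` is the node right
after `σ` on the branch of `τ`. -/
theorem Branch.suffix_of_spre {σ τ : Str} {M N : List Str}
    (hGood : ∀ σ τ, Good (σ, τ) → SPre σ τ) (hL : Branch G Good root (σ :: M))
    (hL' : Branch G Good root (τ :: N)) (h : SPre σ τ) :
    ∃ ρ, (ρ :: σ :: M) <:+ τ :: N ∧ ρ <+: τ := by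
  have hsuf : (σ :: M) <:+ τ :: N := by
    rcases hL.trichotomy hGood hL' with h' | h' | h'
    · exact h'
    · have : τ ∈ σ :: M := h'.subset (by simp)
      rcases List.mem_cons.1 this with rfl | hτ
      · exact absurd rfl h.2
      · exact absurd (hGood _ _ (hL.good τ hτ)).1 h.not_prefix
    · exact absurd h.1 (h' σ (by simp) τ (by simp)).1
  obtain ⟨K, hK⟩ := hsuf
  rcases List.eq_nil_or_concat K with rfl | ⟨K, ρ, rfl⟩
  · exact absurd (List.cons_eq_cons.1 hK).1 h.2
  · have hρ : (ρ :: σ :: M) <:+ τ :: N := ⟨K, by simpa using hK⟩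
    refine ⟨ρ, hρ, ?_⟩
    rcases List.mem_cons.1 (hρ.subset (List.mem_cons_self)) with h | h
    · rw [h]
    · exact (hGood _ _ (hL'.good ρ h)).1

theorem Branch.length_le {σ : Str} {M : List Str} (hGood : ∀ σ τ, Good (σ, τ) → SPre σ τ)
    (hL : Branch G Good root (σ :: M)) : M.length ≤ σ.length := by
  induction M generalizing σ with
  | nil => simp
  | cons τ M ih =>
    have h1 := ih (branch_cons_cons.1 hL).1
    have h2 := (hGood _ _ (hL.good τ (by simp))).length_lt
    simp only [List.length_cons]
    omega

/-- Go up in `G` beyond the stabilization levels of all the finitely many nodes of the branch, then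
split there. -/
theorem Branch.exists_first (hG : Branching G) (hroot : root ∈ G)
    (hGood : ∀ σ τ, Good (σ, τ) → SPre σ τ)
    (hlim : ∀ σ ∈ G, ∃ n, ∀ τ, SPre σ τ → n < τ.length → Good (σ, τ)) {σ : Str} {M : List Str}
    (hL : Branch G Good root (σ :: M)) : ∃ p, First (SuccPair G Good) (σ :: M, p) := by
  refine First.exists ?_
  have hmem := hL.mem hroot
  obtain ⟨n, hn⟩ : ∃ n, ∀ ρ ∈ σ :: M, ∀ τ, SPre ρ τ → n < τ.length → Good (ρ, τ) := by
    clear hL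
    generalize σ :: M = K at hmem
    induction K with
    | nil => exact ⟨0, by simp⟩
    | cons ρ K ih =>
      obtain ⟨n, hn⟩ := ih fun ρ hρ => hmem ρ (by simp [hρ])
      obtain ⟨m, hm⟩ := hlim ρ (hmem ρ (by simp))
      refine ⟨max n m, fun ρ' hρ' τ h1 h2 => ?_⟩
      rcases List.mem_cons.1 hρ' with rfl | hρ'
      · exact hm τ h1 (by omega)
      · exact hn ρ' hρ' τ h1 (by omega)
  obtain ⟨τ, hτ, hστ, hlen⟩ := hG.exists_long (hmem σ (by simp)) (max n σ.length + 1)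
  obtain ⟨τ₁, hτ₁, τ₂, hτ₂, ⟨h3, h4⟩, h5, h6⟩ := hG τ hτ
  have key : ∀ τ', τ <+: τ' → ∀ ρ ∈ σ :: M, Good (ρ, τ') := by
    intro τ' h ρ hρ
    have hlen' := h.length_le
    have hσ : SPre σ τ' := ⟨hστ.trans h, fun he => by rw [he] at hlen; omega⟩
    refine hn ρ hρ τ' ?_ (by omega)
    rcases List.mem_cons.1 hρ with rfl | hρ
    · exact hσ
    · exact (hGood _ _ (hL.good ρ hρ)).trans_prefix hσ.1
  exact ⟨(τ₁, τ₂), by simp, ⟨hτ₁, hτ₂⟩, ⟨h5, h6⟩, fun ρ hρ => ⟨key _ h3 ρ hρ, key _ h4 ρ hρ⟩⟩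

theorem isoFullTree_thinTree (hG : Branching G) (hroot : root ∈ G)
    (hGood : ∀ σ τ, Good (σ, τ) → SPre σ τ)
    (hlim : ∀ σ ∈ G, ∃ n, ∀ τ, SPre σ τ → n < τ.length → Good (σ, τ)) :
    IsoFullTree (thinTree G Good root) := by
  have hR : root ∈ thinTree G Good root := ⟨[], branch_singleton.2 rfl⟩
  have hle : ∀ σ ∈ thinTree G Good root, root ≠ σ → SPre root σ := by
    rintro σ ⟨M, hL⟩ hne
    have : root ∈ σ :: M := hL.root_suffix.subset (by simp)
    rcases List.mem_cons.1 this with h | h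
    · exact absurd h hne
    · exact hGood _ _ (hL.good root h)
  refine ⟨⟨root, ⟨hR, ?_⟩, ?_⟩, ?_⟩
  · rintro ⟨ξ, hξ, h⟩
    by_cases he : root = ξ
    · exact h.2 he.symm
    · exact h.not_prefix (hle ξ hξ he).1
  · rintro ρ ⟨hρ, h⟩
    by_contra hne
    exact h ⟨root, hR, hle ρ hρ fun h => hne h.symm⟩
  · rintro σ ⟨M, hL⟩
    obtain ⟨p, hp⟩ := hL.exists_first hG hroot hGood hlim
    have hinc := hp.1.2.2.1
    have hB : ∀ γ, γ = p.1 ∨ γ = p.2 → Branch G Good root (γ :: σ :: M) := fun γ hγ =>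
      branch_cons_cons.2 ⟨hL, p, hp, hγ⟩
    refine ⟨p.1, p.2, fun h => hinc.1 (h ▸ List.prefix_rfl), fun γ => ⟨?_, fun hγ => ?_⟩⟩
    · rintro ⟨⟨N, hN⟩, h1, h2⟩
      obtain ⟨ρ, h3, h4⟩ := hL.suffix_of_spre hGood hN h1
      obtain ⟨-, p', hp', h5⟩ := branch_cons_cons.1 (hN.tail h3)
      obtain rfl := hp.unique hp'
      by_contra hne
      refine h2 ⟨ρ, ⟨_, hN.tail h3⟩, hGood _ _ ((hB ρ h5).good σ (by simp)), h4, ?_⟩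
      rintro rfl
      exact hne h5
    · have h0 := hB γ hγ
      refine ⟨⟨_, h0⟩, hGood _ _ (h0.good σ (by simp)), ?_⟩
      -- A node strictly between would make the branch of `γ` at least two longer than that of `σ`,
      -- while it is only one longer.
      rintro ⟨ξ, ⟨N, hN⟩, h1, h2⟩
      obtain ⟨ρ, h3, h4⟩ := hL.suffix_of_spre hGood hN h1
      obtain ⟨ρ', h5, h6⟩ := hN.suffix_of_spre hGood h0 h2
      have h7 := h3.length_le
      have h8 := h5.length_le
      simp only [List.length_cons] at h7 h8
      omega

theorem good_of_mem_thinTree (hGood : ∀ σ τ, Good (σ, τ) → SPre σ τ) {σ τ : Str}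
    (hσ : σ ∈ thinTree G Good root) (hτ : τ ∈ thinTree G Good root) (h : SPre σ τ) :
    Good (σ, τ) := by
  obtain ⟨M, hM⟩ := hσ
  obtain ⟨N, hN⟩ := hτ
  obtain ⟨ρ, h1, -⟩ := hM.suffix_of_spre hGood hN h
  rcases List.mem_cons.1 (h1.subset (show σ ∈ ρ :: σ :: M by simp)) with h2 | h2
  · exact absurd h2 h.2
  · exact hN.good σ h2

/-- A branch witnesses membership. Non-membership has a witness too: either `root` does not lie
below `σ`, or some node properly below `σ` has a first pair of successors neither of which lies
below `σ`. -/
theorem dec_thinTree {Y : Set ℕ} (hGY : Dec Y fun σ => σ ∈ G) (hgY : Dec Y Good)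
    (hG : Branching G) (hroot : root ∈ G) (hGood : ∀ σ τ, Good (σ, τ) → SPre σ τ)
    (hlim : ∀ σ ∈ G, ∃ n, ∀ τ, SPre σ τ → n < τ.length → Good (σ, τ)) :
    Dec Y fun σ => σ ∈ thinTree G Good root := by
  have hpre : ∀ {f g : List Str × (Str × Str) → Str}, Primrec f → Primrec g →
      Dec Y fun q => ¬ f q <+: g q := fun hf hg =>
    (Dec.of_primrec (primrecPred_prefix hf hg)).not
  have hS : Dec Y (SuccPair G Good) :=
    (Dec.of_primrec (S := fun q : List Str × (Str × Str) => q.1 ≠ [])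
      (primrecPred_eq (by fun_prop) (by fun_prop)).not).and <|
    ((hGY.comp (f := fun q : List Str × (Str × Str) => q.2.1) (by fun_prop)).and
      (hGY.comp (f := fun q : List Str × (Str × Str) => q.2.2) (by fun_prop))).and <|
    ((hpre (f := fun q => q.2.1) (g := fun q => q.2.2) (by fun_prop) (by fun_prop)).and
      (hpre (f := fun q => q.2.2) (g := fun q => q.2.1) (by fun_prop) (by fun_prop))).and <|
    ((hgY.comp (f := fun r : (List Str × (Str × Str)) × Str => (r.2, r.1.2.1)) (by fun_prop)).and
      (hgY.comp (f := fun r : (List Str × (Str × Str)) × Str => (r.2, r.1.2.2))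
        (by fun_prop))).all_mem (f := fun q : List Str × (Str × Str) => q.1) (by fun_prop)
  have hF := (First.dec hS).1
  have hB : Sig Y (Branch G Good root) := by
    have h1 : Sig Y fun r : (List Str × ℕ) × (Str × Str) =>
        First (SuccPair G Good) (r.1.1.drop (r.1.2 + 1), r.2) ∧
          (r.1.1[r.1.2]? = some r.2.1 ∨ r.1.1[r.1.2]? = some r.2.2) :=
      (hF.comp (f := fun r : (List Str × ℕ) × (Str × Str) => (r.1.1.drop (r.1.2 + 1), r.2))
        (Primrec.pair (Primrec.list_drop.comp (by fun_prop) (by fun_prop)) (by fun_prop))).and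
      (.of_primrec ((primrecPred_eq (by fun_prop) (by fun_prop)).or
        (primrecPred_eq (by fun_prop) (by fun_prop))))
    have h2 : Sig Y fun q : List Str × ℕ => q.2 + 1 = q.1.length ∧ q.1[q.2]? = some root :=
      .of_primrec ((primrecPred_eq (by fun_prop) (by fun_prop)).and
        (primrecPred_eq (by fun_prop) (by fun_prop)))
    exact (Sig.of_primrec (S := fun L : List Str => L ≠ [])
      (primrecPred_eq (by fun_prop) (by fun_prop)).not).and
      ((h2.or h1.ex).all_lt (f := fun L : List Str => L.length) (by fun_prop))
  refine ⟨(hB.comp (f := fun q : Str × List Str => q.1 :: q.2) (by fun_prop)).ex, ?_⟩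
  have h3 : Sig Y fun q : Str × ((Str × List Str) × (Str × Str)) =>
      (Branch G Good root (q.2.1.1 :: q.2.1.2) ∧
        First (SuccPair G Good) (q.2.1.1 :: q.2.1.2, q.2.2)) ∧
      ((q.2.1.1 <+: q.1 ∧ q.2.1.1 ≠ q.1) ∧ ¬ q.2.2.1 <+: q.1 ∧ ¬ q.2.2.2 <+: q.1) :=
    ((hB.comp (f := fun q : Str × ((Str × List Str) × (Str × Str)) => q.2.1.1 :: q.2.1.2)
      (by fun_prop)).and (hF.comp (f := fun q : Str × ((Str × List Str) × (Str × Str)) =>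
        (q.2.1.1 :: q.2.1.2, q.2.2)) (by fun_prop))).and
    (.of_primrec (((primrecPred_prefix (by fun_prop) (by fun_prop)).and
      (primrecPred_eq (by fun_prop) (by fun_prop)).not).and
      ((primrecPred_prefix (by fun_prop) (by fun_prop)).not.and
        (primrecPred_prefix (by fun_prop) (by fun_prop)).not)))
  have h4 : Sig Y fun σ : Str => ¬ root <+: σ :=
    .of_primrec (primrecPred_prefix (by fun_prop) (by fun_prop)).not
  refine (h4.or h3.ex).of_iff fun σ => ?_
  constructor
  · intro hσ
    by_cases hr : root <+: σ
    · right
      classical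
      -- The witness is the deepest node below `σ`; depth is bounded by length, so the maximum
      -- exists.
      let Q : ℕ → Prop := fun n => ∃ τ M, Branch G Good root (τ :: M) ∧ τ <+: σ ∧ M.length = n
      have h0 : Q 0 := ⟨root, [], branch_singleton.2 rfl, hr, rfl⟩
      have hmax := Nat.findGreatest_spec (P := Q) (n := σ.length) (Nat.zero_le _) h0
      obtain ⟨τ, M, hL, hτ, hlen⟩ := hmax
      obtain ⟨p, hp⟩ := hL.exists_first hG hroot hGood hlim
      have key : ∀ γ, γ = p.1 ∨ γ = p.2 → ¬ γ <+: σ := by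
        intro γ hγ hpre
        have hb : Branch G Good root (γ :: τ :: M) := branch_cons_cons.2 ⟨hL, p, hp, hγ⟩
        have hb' := hb.length_le hGood
        have := hpre.length_le
        have := Nat.le_findGreatest (P := Q) (n := σ.length) (m := (τ :: M).length)
          (by omega) ⟨γ, τ :: M, hb, hpre, rfl⟩
        simp only [List.length_cons] at this
        omega
      refine ⟨((τ, M), p), ⟨hL, hp⟩, ⟨hτ, ?_⟩, key _ (.inl rfl), key _ (.inr rfl)⟩
      exact fun h : τ = σ => hσ ⟨M, h ▸ hL⟩
    · exact .inl hr
  · rintro (h | ⟨⟨⟨τ, M⟩, p⟩, ⟨hL, hp⟩, ⟨h1, h2⟩, h3, h4⟩) ⟨N, hN⟩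
    · rcases List.mem_cons.1 (hN.root_suffix.subset (List.mem_singleton_self root)) with h' | h'
      · exact h (h' ▸ List.prefix_rfl)
      · exact h (hGood _ _ (hN.good root h')).1
    · obtain ⟨ρ, h5, h6⟩ := hL.suffix_of_spre hGood hN ⟨h1, h2⟩
      obtain ⟨-, p', hp', h7⟩ := branch_cons_cons.1 (hN.tail h5)
      obtain rfl := hp.unique hp'
      rcases h7 with rfl | rfl
      · exact h3 h6
      · exact h4 h6

end

/-! ## Cone avoidance for the stable tree theorem -/

/-- Cone avoidance, in terms of `Dec`. -/
theorem exists_solution {Z C : Set ℕ} (hC : ¬ Dec Z fun n => n ∈ C) (f : STT22.Inst)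
    (hf : Dec Z fun n => n ∈ STT22.instCode f) :
    ∃ H : Set Str, STT22.IsSol f H ∧ ¬ Dec (join (codes H) Z) fun n => n ∈ C := by
  obtain ⟨f, hst⟩ := f
  let Good : Fin 2 → Str × Str → Prop := fun c p => ∃ h : SPre p.1 p.2, f ⟨p, h⟩ = c
  have hgood : ∀ c, Dec Z (Good c) := fun c => by
    refine (hf.comp (f := fun p : Str × Str => Encodable.encode (p, c)) (by fun_prop)).of_iff
      fun p => ?_
    constructor
    · rintro ⟨h, rfl⟩
      exact ⟨⟨p, h⟩, rfl⟩
    · rintro ⟨q, hq⟩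
      have := Encodable.encode_injective hq
      simp only [Prod.mk.injEq] at this
      obtain ⟨rfl, rfl⟩ := this
      exact ⟨q.2, rfl⟩
  obtain ⟨G, hGP, ⟨root, hroot⟩, hG, hav⟩ := exists_branching_avoiding hC
    {σ | ∃ n, ∀ τ, SPre σ τ → n < τ.length → Good 0 (σ, τ)}
  obtain ⟨c, hc⟩ : ∃ c, ∀ σ ∈ G, ∃ n, ∀ τ, SPre σ τ → n < τ.length → Good c (σ, τ) := by
    rcases hGP with h | h
    · exact ⟨0, h⟩
    · refine ⟨1, fun σ hσ => ?_⟩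
      obtain ⟨c, n, hn⟩ := hst σ
      have hn' : ∀ τ, SPre σ τ → n < τ.length → Good c (σ, τ) := fun τ h1 h2 => ⟨h1, hn τ h1 h2⟩
      match c with
      -- Limit colour 0 would place `σ` in the part that `G` avoids.
      | 0 => exact absurd ⟨n, hn'⟩ (h hσ)
      | 1 => exact ⟨n, hn'⟩
  have hGood : ∀ σ τ, Good c (σ, τ) → SPre σ τ := fun σ τ h => h.1
  refine ⟨thinTree G (Good c) root, ⟨isoFullTree_thinTree hG hroot hGood hc, c, ?_⟩, fun hdec => ?_⟩
  · rintro ⟨⟨σ, τ⟩, h⟩ hσ hτ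
    obtain ⟨_, h'⟩ := good_of_mem_thinTree hGood hσ hτ h
    exact h'
  · have hZ := dec_join_right (codes G) Z
    refine hav (hdec.trans (dec_join (dec_codes.2 ?_) hZ))
    exact dec_thinTree (dec_codes.1 (dec_join_left (codes G) Z)) ((hgood c).trans hZ) hG hroot
      hGood hc

theorem admitsConeAvoidance : STT22.AdmitsConeAvoidance := by
  intro Z C hC f hf
  rw [setTuringLE_iff] at hC hf
  obtain ⟨H, h1, h2⟩ := exists_solution hC f hf
  exact ⟨H, h1, by rw [setTuringLE_iff]; exact h2⟩

/-! ## Semantics of second-order arithmetic in `ω`-models -/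

/-- The value of a term. -/
def Tm.eval {n : ℕ} (v : Fin n → ℕ) : Tm n → ℕ
  | var i => v i
  | zero => 0
  | one => 1
  | add s t => s.eval v + t.eval v
  | mul s t => s.eval v * t.eval v

/-- Satisfaction in the `ω`-model with second-order part `S`. -/
def Fm.Sat (S : Set (Set ℕ)) : {n m : ℕ} → (Fin n → ℕ) → (Fin m → S) → Fm n m → Prop
  | _, _, _, _, falsum => False
  | _, _, v, _, eq s t => s.eval v = t.eval v
  | _, _, v, _, lt s t => s.eval v < t.eval v
  | _, _, v, w, mem t X => t.eval v ∈ (w X).1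
  | _, _, v, w, imp φ ψ => φ.Sat S v w → ψ.Sat S v w
  | _, _, v, w, allN φ => ∀ x : ℕ, φ.Sat S (Fin.cons x v) w
  | _, _, v, w, allS φ => ∀ X : S, φ.Sat S v (Fin.cons X w)

theorem Tm.eval_subst {n n' : ℕ} (σ : Fin n → Tm n') (v : Fin n' → ℕ) (t : Tm n) :
    (t.subst σ).eval v = t.eval fun i => (σ i).eval v := by
  induction t with
  | var i => rfl
  | zero => rfl
  | one => rfl
  | add s t hs ht => simp only [subst, eval, hs, ht]
  | mul s t hs ht => simp only [subst, eval, hs, ht]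

@[simp] theorem Tm.eval_lift {n : ℕ} (v : Fin n → ℕ) (x : ℕ) (t : Tm n) :
    t.lift.eval (Fin.cons x v : Fin (n + 1) → ℕ) = t.eval v := by
  simp only [lift, eval_subst, eval, Fin.cons_succ]

namespace Fm
variable {S : Set (Set ℕ)}

theorem sat_subst {n m n' m' : ℕ} (φ : Fm n m) (σ : Fin n → Tm n') (ρ : Fin m → Fin m')
    (v : Fin n' → ℕ) (w : Fin m' → S) :
    (φ.subst σ ρ).Sat S v w ↔ φ.Sat S (fun i => (σ i).eval v) fun i => w (ρ i) := by
  induction φ generalizing n' m' with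
  | falsum => rfl
  | eq s t => simp only [subst, Sat, Tm.eval_subst]
  | lt s t => simp only [subst, Sat, Tm.eval_subst]
  | mem t X => simp only [subst, Sat, Tm.eval_subst]
  | imp φ ψ hφ hψ => simp only [subst, Sat, hφ, hψ]
  | allN φ ih =>
    simp only [subst, Sat, ih]
    refine forall_congr' fun x => ?_
    have : (fun i => Tm.eval (Fin.cons x v : Fin (n' + 1) → ℕ)
        ((Fin.cons (Tm.var 0) fun i => (σ i).lift : Fin (_ + 1) → Tm (n' + 1)) i)) =
        Fin.cons x fun i => (σ i).eval v := by
      funext i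
      refine Fin.cases ?_ (fun i => ?_) i
      · rfl
      · simp
    rw [this]
  | allS φ ih =>
    simp only [subst, Sat, ih]
    refine forall_congr' fun X => ?_
    have : (fun i => (Fin.cons X w : Fin (m' + 1) → S)
        ((Fin.cons 0 fun i => (ρ i).succ : Fin (_ + 1) → Fin (m' + 1)) i)) =
        Fin.cons X fun i => w (ρ i) := by
      funext i
      refine Fin.cases ?_ (fun i => ?_) i
      · rfl
      · simp
    rw [this]

variable {n m : ℕ} {v : Fin n → ℕ} {w : Fin m → S}

@[simp] theorem sat_liftN {φ : Fm n m} {x : ℕ} :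
    φ.liftN.Sat S (Fin.cons x v) w ↔ φ.Sat S v w := by
  simp only [liftN, sat_subst, Tm.eval, Fin.cons_succ, id]

@[simp] theorem sat_liftS {φ : Fm n m} {X : S} :
    φ.liftS.Sat S v (Fin.cons X w) ↔ φ.Sat S v w := by
  simp only [liftS, sat_subst, Tm.eval, Fin.cons_succ]

@[simp] theorem sat_instN {φ : Fm (n + 1) m} {t : Tm n} :
    (φ.instN t).Sat S v w ↔ φ.Sat S (Fin.cons (t.eval v) v) w := by
  rw [instN, sat_subst]
  have : (fun i => Tm.eval v ((Fin.cons t Tm.var : Fin (n + 1) → Tm n) i)) =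
      Fin.cons (t.eval v) v := by
    funext i
    refine Fin.cases ?_ (fun i => ?_) i <;> simp [Tm.eval]
  rw [this]
  rfl

@[simp] theorem sat_instS {φ : Fm n (m + 1)} {Y : Fin m} :
    (φ.instS Y).Sat S v w ↔ φ.Sat S v (Fin.cons (w Y) w) := by
  rw [instS, sat_subst]
  have : (fun i => w ((Fin.cons Y id : Fin (m + 1) → Fin m) i)) = Fin.cons (w Y) w := by
    funext i
    refine Fin.cases ?_ (fun i => ?_) i <;> simp
  rw [this]
  rfl

@[simp] theorem sat_shiftN {φ : Fm (n + 1) m} {x : ℕ} :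
    φ.shiftN.Sat S (Fin.cons x v) w ↔ φ.Sat S (Fin.cons (x + 1) v) w := by
  rw [shiftN, sat_subst]
  have : (fun i => Tm.eval (Fin.cons x v : Fin (n + 1) → ℕ)
      ((Fin.cons (Tm.add (Tm.var 0) Tm.one) fun i => Tm.var i.succ :
        Fin (n + 1) → Tm (n + 1)) i)) = Fin.cons (x + 1) v := by
    funext i
    refine Fin.cases ?_ (fun i => ?_) i <;> simp [Tm.eval]
  rw [this]
  rfl

theorem sat_ofSent {φ : Sent} :
    (ofSent φ : Fm n m).Sat S v w ↔ φ.Sat S (Fin.elim0 : Fin 0 → ℕ) (Fin.elim0 : Fin 0 → S) := by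
  rw [ofSent, sat_subst]
  rw [show (fun i : Fin 0 => Tm.eval v (Fin.elim0 i)) = Fin.elim0 from Subsingleton.elim _ _,
    show (fun i : Fin 0 => w (Fin.elim0 i)) = Fin.elim0 from Subsingleton.elim _ _]

@[simp] theorem sat_falsum : ¬ (falsum : Fm n m).Sat S v w := id
@[simp] theorem sat_eq {s t : Tm n} : (eq s t : Fm n m).Sat S v w ↔ s.eval v = t.eval v := Iff.rfl
@[simp] theorem sat_lt {s t : Tm n} : (lt s t : Fm n m).Sat S v w ↔ s.eval v < t.eval v := Iff.rfl
@[simp] theorem sat_mem {t : Tm n} {X : Fin m} :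
    (mem t X : Fm n m).Sat S v w ↔ t.eval v ∈ (w X).1 := Iff.rfl
@[simp] theorem sat_imp {φ ψ : Fm n m} :
    (imp φ ψ).Sat S v w ↔ (φ.Sat S v w → ψ.Sat S v w) := Iff.rfl
@[simp] theorem sat_allN {φ : Fm (n + 1) m} :
    (allN φ).Sat S v w ↔ ∀ x : ℕ, φ.Sat S (Fin.cons x v) w := Iff.rfl
@[simp] theorem sat_allS {φ : Fm n (m + 1)} :
    (allS φ).Sat S v w ↔ ∀ X : S, φ.Sat S v (Fin.cons X w) := Iff.rfl
@[simp] theorem sat_neg {φ : Fm n m} : φ.neg.Sat S v w ↔ ¬ φ.Sat S v w := Iff.rfl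
@[simp] theorem sat_and {φ ψ : Fm n m} :
    (φ.and ψ).Sat S v w ↔ φ.Sat S v w ∧ ψ.Sat S v w := by simp [and]
@[simp] theorem sat_or {φ ψ : Fm n m} :
    (φ.or ψ).Sat S v w ↔ φ.Sat S v w ∨ ψ.Sat S v w := by simp only [or, sat_imp, sat_neg]; tauto
@[simp] theorem sat_iff {φ ψ : Fm n m} :
    (φ.iff ψ).Sat S v w ↔ (φ.Sat S v w ↔ ψ.Sat S v w) := by
  simp only [iff, sat_and, sat_imp]; tauto
@[simp] theorem sat_exN {φ : Fm (n + 1) m} :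
    φ.exN.Sat S v w ↔ ∃ x : ℕ, φ.Sat S (Fin.cons x v) w := by simp [exN]
@[simp] theorem sat_exS {φ : Fm n (m + 1)} :
    φ.exS.Sat S v w ↔ ∃ X : S, φ.Sat S v (Fin.cons X w) := by simp [exS]

theorem sat_close {φ : Fm n m} :
    φ.close.Sat S (Fin.elim0 : Fin 0 → ℕ) (Fin.elim0 : Fin 0 → S) ↔ ∀ v w, φ.Sat S v w := by
  induction n with
  | zero =>
    induction m with
    | zero =>
      rw [close]
      constructor
      · intro h v w
        rwa [Subsingleton.elim v Fin.elim0, Subsingleton.elim w Fin.elim0]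
      · intro h; exact h _ _
    | succ m ih =>
      rw [close, ih]
      constructor
      · intro h v w
        have := h v (Fin.tail w) (w 0)
        rwa [Fin.cons_self_tail] at this
      · intro h v w X
        exact h _ _
  | succ n ih =>
    rw [close, ih]
    constructor
    · intro h v w
      have := h (Fin.tail v) w (v 0)
      rwa [Fin.cons_self_tail] at this
    · intro h v w x
      exact h _ _

end Fm

theorem Prf.sound {S : Set (Set ℕ)} {T : Set Sent}
    (hT : ∀ χ ∈ T, χ.Sat S (Fin.elim0 : Fin 0 → ℕ) (Fin.elim0 : Fin 0 → S))
    {n m : ℕ} {Γ : List (Fm n m)} {φ : Fm n m} (h : Prf T Γ φ) :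
    ∀ (v : Fin n → ℕ) (w : Fin m → S), (∀ γ ∈ Γ, γ.Sat S v w) → φ.Sat S v w := by
  induction h with
  | ax h => exact fun v w _ => Fm.sat_ofSent.2 (hT _ h)
  | hyp h => exact fun v w hΓ => hΓ _ h
  | impI _ ih =>
    intro v w hΓ hφ
    exact ih v w (List.forall_mem_cons.2 ⟨hφ, hΓ⟩)
  | impE _ _ ih₁ ih₂ => exact fun v w hΓ => ih₁ v w hΓ (ih₂ v w hΓ)
  | raa _ ih =>
    intro v w hΓ
    by_contra hφ
    exact ih v w (List.forall_mem_cons.2 ⟨hφ, hΓ⟩)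
  | allNI _ ih =>
    intro v w hΓ x
    refine ih _ _ fun γ hγ => ?_
    obtain ⟨δ, hδ, rfl⟩ := List.mem_map.1 hγ
    exact Fm.sat_liftN.2 (hΓ δ hδ)
  | allNE t _ ih => exact fun v w hΓ => Fm.sat_instN.2 (ih v w hΓ _)
  | allSI _ ih =>
    intro v w hΓ X
    refine ih _ _ fun γ hγ => ?_
    obtain ⟨δ, hδ, rfl⟩ := List.mem_map.1 hγ
    exact Fm.sat_liftS.2 (hΓ δ hδ)
  | allSE Y _ ih => exact fun v w hΓ => Fm.sat_instS.2 (ih v w hΓ _)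
  | eqRefl t => exact fun v w _ => rfl
  | eqSubst φ _ _ ih₁ ih₂ =>
    intro v w hΓ
    have h1 := ih₁ v w hΓ
    have h2 := Fm.sat_instN.1 (ih₂ v w hΓ)
    rw [Fm.sat_eq] at h1
    rw [Fm.sat_instN, ← h1]
    exact h2

/-! ## Turing ideals are models of `RCA₀` -/

/-- `S` is a Turing ideal. -/
structure IsIdeal (S : Set (Set ℕ)) : Prop where
  empty_mem : ∅ ∈ S
  down : ∀ A ∈ S, ∀ B, (Dec A fun n => n ∈ B) → B ∈ S
  join_mem : ∀ A ∈ S, ∀ B ∈ S, join A B ∈ S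

theorem IsIdeal.exists_bound {S : Set (Set ℕ)} (hS : IsIdeal S) {m : ℕ} (w : Fin m → S) :
    ∃ B ∈ S, ∀ i, Dec B fun n => n ∈ (w i).1 := by
  induction m with
  | zero => exact ⟨∅, hS.empty_mem, fun i => i.elim0⟩
  | succ m ih =>
    obtain ⟨B, hB, h⟩ := ih (Fin.tail w)
    refine ⟨join (w 0).1 B, hS.join_mem _ (w 0).2 _ hB, fun i => ?_⟩
    refine Fin.cases ?_ (fun i => ?_) i
    · exact dec_join_left _ _
    · exact (h i).trans (dec_join_right _ _)

theorem primrec_eval {n : ℕ} (t : Tm n) : Primrec fun v : Fin n → ℕ => t.eval v := by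
  induction t with
  | var i => exact Primrec.fin_app.comp Primrec.id (Primrec.const i)
  | zero => exact Primrec.const 0
  | one => exact Primrec.const 1
  | add s t hs ht => exact primrec_add hs ht
  | mul s t hs ht => exact primrec_mul hs ht

theorem primrec_finCons {n : ℕ} :
    Primrec fun p : (Fin n → ℕ) × ℕ => (Fin.cons p.2 p.1 : Fin (n + 1) → ℕ) := by
  refine Primrec.fin_curry.2 (Primrec₂.swap (Primrec.fin_curry₁.2 fun i => ?_))
  refine Fin.cases ?_ (fun i => ?_) i
  · exact Primrec.snd
  · exact Primrec.of_eq (f := fun p : (Fin n → ℕ) × ℕ => p.1 i)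
      (Primrec.fin_app.comp Primrec.fst (Primrec.const i)) fun p => rfl

theorem IsDelta0.dec {S : Set (Set ℕ)} {n m : ℕ} {φ : Fm n m} (h : IsDelta0 φ) {w : Fin m → S}
    {B : Set ℕ} (hB : ∀ i, Dec B fun n => n ∈ (w i).1) :
    Dec B fun v : Fin n → ℕ => φ.Sat S v w := by
  induction h with
  | falsum => exact (Dec.of_primrec (primrecPred_eq primrec_id primrec_id)).not.of_iff (by simp)
  | eq s t => exact Dec.of_primrec (primrecPred_eq (primrec_eval s) (primrec_eval t))
  | lt s t => exact Dec.of_primrec (primrecPred_lt (primrec_eval s) (primrec_eval t))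
  | mem t X => exact (hB X).comp (primrec_eval t)
  | imp _ _ h₁ h₂ => exact (h₁ hB).imp (h₂ hB)
  | allLt t _ ih =>
    refine (((ih hB).comp primrec_finCons).all_lt (primrec_eval t)).of_iff fun v => ?_
    simp [Tm.eval]

theorem IsSigma1.sig {S : Set (Set ℕ)} {n m : ℕ} {φ : Fm n m} (h : IsSigma1 φ) {w : Fin m → S}
    {B : Set ℕ} (hB : ∀ i, Dec B fun n => n ∈ (w i).1) :
    Sig B fun v : Fin n → ℕ => φ.Sat S v w := by
  obtain ⟨θ, hθ, rfl⟩ := h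
  exact (((hθ.dec hB).1.comp primrec_finCons).ex).of_iff fun v => by simp

theorem IsPi1.sig_not {S : Set (Set ℕ)} {n m : ℕ} {φ : Fm n m} (h : IsPi1 φ) {w : Fin m → S}
    {B : Set ℕ} (hB : ∀ i, Dec B fun n => n ∈ (w i).1) :
    Sig B fun v : Fin n → ℕ => ¬ φ.Sat S v w := by
  obtain ⟨θ, hθ, rfl⟩ := h
  exact (((hθ.dec hB).2.comp primrec_finCons).ex).of_iff fun v => by simp

/-- Numbers are standard, so induction is true outright. In Δ⁰₁ comprehension the two formulas make
the set and its complement Σ⁰₁ in a common bound of the parameters, hence the set is computable from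
it. -/
theorem IsIdeal.sat_RCA0 {S : Set (Set ℕ)} (hS : IsIdeal S) :
    ∀ χ ∈ RCA0, χ.Sat S (Fin.elim0 : Fin 0 → ℕ) (Fin.elim0 : Fin 0 → S) := by
  rintro χ ((hχ | ⟨n, m, φ, -, rfl⟩) | ⟨n, m, φ, ψ, hφ, hψ, rfl⟩)
  · simp only [basicAxioms, Set.mem_insert_iff, Set.mem_singleton_iff] at hχ
    rcases hχ with rfl | rfl | rfl | rfl | rfl | rfl | rfl | rfl <;>
      rw [Fm.sat_close] <;> intro v w <;> simp [Tm.eval] <;> first | rfl | ring | omega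
  · rw [Fm.sat_close]
    intro v w
    simp only [induction, Fm.sat_imp, Fm.sat_and, Fm.sat_instN, Fm.sat_allN, Fm.sat_shiftN, Tm.eval]
    rintro ⟨h0, hs⟩ x
    induction x with
    | zero => exact h0
    | succ x ih => exact hs x ih
  · rw [Fm.sat_close]
    intro v w
    simp only [comprehension, Fm.sat_imp, Fm.sat_iff, Fm.sat_allN, Fm.sat_exS, Fm.sat_mem,
      Fm.sat_liftS, Tm.eval]
    intro h
    obtain ⟨B, hB, hw⟩ := hS.exists_bound w
    have hc : Primrec fun x : ℕ => (Fin.cons x v : Fin (n + 1) → ℕ) :=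
      primrec_finCons.comp ((Primrec.const v).pair Primrec.id)
    have hd : Dec B fun x : ℕ => x ∈ {x | φ.Sat S (Fin.cons x v) w} :=
      ⟨(hφ.sig hw).comp hc, ((hψ.sig_not hw).comp hc).of_iff fun x => not_congr (h x)⟩
    exact ⟨⟨_, hS.down B hB _ hd⟩, fun x => Iff.rfl⟩

/-! ## Binary codes of strings -/

/-- The number whose binary expansion continues that of `n` by `ρ`. -/
def bfold (n : ℕ) (ρ : Str) : ℕ := ρ.foldl (fun n b => 2 * n + b.toNat) n

/-- The number with binary expansion `1σ`. -/
def bcode (σ : Str) : ℕ := bfold 1 σ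

theorem bfold_eq (ρ : Str) (n : ℕ) : bfold n ρ = n * 2 ^ ρ.length + bfold 0 ρ := by
  induction ρ generalizing n with
  | nil => simp [bfold]
  | cons b ρ ih =>
    have h1 : bfold n (b :: ρ) = bfold (2 * n + b.toNat) ρ := rfl
    have h2 : bfold 0 (b :: ρ) = bfold (2 * 0 + b.toNat) ρ := rfl
    rw [h1, h2, ih, ih (2 * 0 + _), List.length_cons]
    ring

theorem bfold_zero_lt (ρ : Str) : bfold 0 ρ < 2 ^ ρ.length := by
  induction ρ with
  | nil => simp [bfold]
  | cons b ρ ih =>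
    have h2 : bfold 0 (b :: ρ) = bfold (2 * 0 + b.toNat) ρ := rfl
    rw [h2, bfold_eq, List.length_cons, pow_succ]
    have : b.toNat ≤ 1 := Bool.toNat_le b
    nlinarith

theorem exists_bfold {k r : ℕ} (h : r < 2 ^ k) : ∃ ρ : Str, ρ.length = k ∧ bfold 0 ρ = r := by
  induction k generalizing r with
  | zero => exact ⟨[], rfl, by simp [bfold]; omega⟩
  | succ k ih =>
    rw [pow_succ] at h
    have step : ∀ (b : Bool) (q : ℕ), q < 2 ^ k → r = b.toNat * 2 ^ k + q →
        ∃ ρ : Str, ρ.length = k + 1 ∧ bfold 0 ρ = r := by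
      intro b q hq hr
      obtain ⟨ρ, h1, h2⟩ := ih hq
      refine ⟨b :: ρ, by simp [h1], ?_⟩
      have h3 : bfold 0 (b :: ρ) = bfold (2 * 0 + b.toNat) ρ := rfl
      rw [h3, bfold_eq, h1, h2, hr]
      ring
    by_cases hk : r < 2 ^ k
    · exact step false r hk (by simp)
    · exact step true (r - 2 ^ k) (by omega) (by simp; omega)

theorem bfold_inj {σ τ : Str} (hl : σ.length = τ.length) (h : bfold 0 σ = bfold 0 τ) : σ = τ := by
  induction σ generalizing τ with
  | nil => exact (List.length_eq_zero_iff.1 hl.symm).symm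
  | cons b σ ih =>
    cases τ with
    | nil => simp at hl
    | cons c τ =>
      have hl' : σ.length = τ.length := by simpa using hl
      have h2 : ∀ (b : Bool) (ρ : Str), bfold 0 (b :: ρ) = b.toNat * 2 ^ ρ.length + bfold 0 ρ :=
        fun b ρ => by
          have : bfold 0 (b :: ρ) = bfold (2 * 0 + b.toNat) ρ := rfl
          rw [this, bfold_eq]; simp
      rw [h2, h2, hl'] at h
      have h3 := bfold_zero_lt σ
      have h4 := bfold_zero_lt τ
      rw [hl'] at h3
      have hb : b = c := by
        cases b <;> cases c <;> simp at h ⊢ <;> omega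
      subst hb
      rw [ih hl' (by omega)]

theorem bcode_eq (σ : Str) : bcode σ = 2 ^ σ.length + bfold 0 σ := by
  rw [bcode, bfold_eq, one_mul]

theorem bcode_append (σ ρ : Str) : bcode (σ ++ ρ) = bcode σ * 2 ^ ρ.length + bfold 0 ρ := by
  rw [← bfold_eq]
  simp [bcode, bfold, List.foldl_append]

theorem bcode_ne_zero (σ : Str) : bcode σ ≠ 0 := by
  rw [bcode_eq]
  have : 0 < 2 ^ σ.length := by positivity
  omega

theorem bcode_injective {σ τ : Str} (h : bcode σ = bcode τ) : σ = τ := by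
  rw [bcode_eq, bcode_eq] at h
  have h1 := bfold_zero_lt σ
  have h2 := bfold_zero_lt τ
  have key : ∀ {a b x y : ℕ}, x < 2 ^ a → 2 ^ a + x = 2 ^ b + y → b ≤ a := by
    intro a b x y hx he
    by_contra hlt
    have : 2 ^ (a + 1) ≤ 2 ^ b := Nat.pow_le_pow_right (by norm_num) (by omega)
    rw [pow_succ] at this
    omega
  have hl : σ.length = τ.length := le_antisymm (key h2 h.symm) (key h1 h)
  refine bfold_inj hl ?_
  rw [hl] at h
  omega

theorem exists_bcode {n : ℕ} (h : n ≠ 0) : ∃ σ, bcode σ = n := by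
  have h1 := Nat.pow_log_le_self 2 h
  have h2 := Nat.lt_pow_succ_log_self (b := 2) (by norm_num) n
  rw [Nat.succ_eq_add_one, pow_succ] at h2
  obtain ⟨ρ, h3, h4⟩ := exists_bfold (k := Nat.log 2 n) (r := n - 2 ^ Nat.log 2 n) (by omega)
  refine ⟨ρ, ?_⟩
  rw [bcode_eq, h3, h4]
  omega

theorem primrec_bcode {α : Type*} [Primcodable α] {f : α → Str} (hf : Primrec f) :
    Primrec fun a => bcode (f a) := by
  have h : Primrec fun b : Bool => b.toNat := (Primrec.cond Primrec.id (Primrec.const 1)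
    (Primrec.const 0)).of_eq fun b => by cases b <;> rfl
  have : Primrec bcode := Primrec.list_foldl (f := fun σ : Str => σ) (g := fun _ => 1)
    (h := fun _ p => 2 * p.1 + p.2.toNat) primrec_id (Primrec.const 1)
    (Primrec.of_eq (f := fun q : Str × (ℕ × Bool) => 2 * q.2.1 + q.2.2.toNat)
      (primrec_add (by fun_prop) (h.comp (by fun_prop))) fun _ => rfl)
  exact this.comp hf

attribute [fun_prop] primrec_bcode

/-- The relation on codes of strings defined by `spre`. -/
def NPre (s t : ℕ) : Prop := (s ≠ 0 ∧ s ≠ t) ∧ ∃ k r, r < 2 ^ k ∧ t = s * 2 ^ k + r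

theorem nPre_bcode {σ τ : Str} : NPre (bcode σ) (bcode τ) ↔ SPre σ τ := by
  constructor
  · rintro ⟨⟨-, hne⟩, k, r, hr, h⟩
    obtain ⟨ρ, rfl, rfl⟩ := exists_bfold hr
    rw [← bcode_append] at h
    obtain rfl := bcode_injective h
    exact ⟨List.prefix_append _ _, fun he => hne (by rw [← he])⟩
  · rintro ⟨⟨ρ, rfl⟩, hne⟩
    exact ⟨⟨bcode_ne_zero _, fun h => hne (bcode_injective h)⟩, ρ.length, bfold 0 ρ,
      bfold_zero_lt ρ, bcode_append σ ρ⟩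

/-- The code of a pair of numbers. -/
def npair (s t : ℕ) : ℕ := (s + t) * (s + t) + s

/-- The code lies between consecutive squares, `(s + t)²` and `(s + t + 1)²`, so it determines `s +
t`. -/
theorem npair_inj {s t s' t' : ℕ} (h : npair s t = npair s' t') : s = s' ∧ t = t' := by
  have key : ∀ {a b a' b' : ℕ}, npair a b = npair a' b' → ¬ a + b < a' + b' := by
    intro a b a' b' h hlt
    simp only [npair] at h
    have : (a + b + 1) * (a + b + 1) ≤ (a' + b') * (a' + b') := Nat.mul_le_mul hlt hlt
    nlinarith
  have h1 : s + t = s' + t' := le_antisymm (not_lt.1 (key h.symm)) (not_lt.1 (key h))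
  simp only [npair] at h
  rw [h1] at h
  omega

/-- The code of a triple of numbers. -/
def ntriple (s t u : ℕ) : ℕ := npair (npair s t) u

theorem ntriple_inj {s t u s' t' u' : ℕ} (h : ntriple s t u = ntriple s' t' u') :
    s = s' ∧ t = t' ∧ u = u' := by
  obtain ⟨h1, h2⟩ := npair_inj h
  obtain ⟨h3, h4⟩ := npair_inj h1
  exact ⟨h3, h4, h2⟩

theorem primrec_ntriple {α : Type*} [Primcodable α] {f g h : α → ℕ} (hf : Primrec f)
    (hg : Primrec g) (hh : Primrec h) : Primrec fun a => ntriple (f a) (g a) (h a) := by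
  simp only [ntriple, npair]
  fun_prop

/-! ## The meaning of the formulas -/

namespace Fm
variable {S : Set (Set ℕ)} {n m : ℕ} {v : Fin n → ℕ} {w : Fin m → S}

@[simp] theorem eval_triple (s t u : Tm n) :
    (Tm.triple s t u).eval v = ntriple (s.eval v) (t.eval v) (u.eval v) := rfl

@[simp] theorem sat_pow2 {t : Tm n} : (pow2 t : Fm n m).Sat S v w ↔ ∃ k, t.eval v = 2 ^ k := by
  simp only [pow2, sat_and, sat_neg, sat_eq, sat_allN, sat_imp, sat_or, sat_exN, Tm.eval,
    Tm.eval_lift, Fin.cons_succ, Fin.cons_zero]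
  constructor
  · rintro ⟨h0, h⟩
    -- The divisor condition leaves 2 as the only possible prime divisor.
    refine ⟨_, Nat.eq_prime_pow_of_unique_prime_dvd h0 fun {d} hd hdvd => ?_⟩
    obtain ⟨e, he⟩ := hdvd
    rcases h d e he with rfl | ⟨y, hy⟩
    · exact absurd hd Nat.not_prime_one
    · exact (hd.eq_two_or_odd').resolve_right fun ho => by
        rw [← Nat.not_even_iff_odd] at ho
        exact ho ⟨y, hy⟩
  · rintro ⟨k, hk⟩
    rw [hk]
    refine ⟨by positivity, fun d e h => ?_⟩
    obtain ⟨j, -, rfl⟩ := (Nat.dvd_prime_pow Nat.prime_two).1 (Dvd.intro e h.symm)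
    cases j with
    | zero => exact .inl rfl
    | succ j => exact .inr ⟨2 ^ j, by rw [pow_succ]; ring⟩

@[simp] theorem sat_spre {s t : Tm n} :
    (spre s t : Fm n m).Sat S v w ↔ NPre (s.eval v) (t.eval v) := by
  simp only [spre, sat_and, sat_neg, sat_eq, sat_exN, sat_pow2, sat_lt, Tm.eval,
    Tm.eval_lift, Fin.cons_succ, Fin.cons_zero, NPre]
  refine and_congr Iff.rfl ⟨?_, ?_⟩
  · rintro ⟨p, r, ⟨k, rfl⟩, h1, h2⟩
    exact ⟨k, r, h1, h2⟩
  · rintro ⟨k, r, h1, h2⟩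
    exact ⟨2 ^ k, r, ⟨k, rfl⟩, h1, h2⟩

theorem sat_isColoring {F : Fin m} : (isColoring F : Fm n m).Sat S v w ↔
    (∀ x ∈ (w F).1, ∃ s t c, NPre s t ∧ c < 2 ∧ x = ntriple s t c) ∧
      ∀ s t, NPre s t → ∃ c, ntriple s t c ∈ (w F).1 ∧ ∀ d, ntriple s t d ∈ (w F).1 → d = c := by
  simp only [isColoring, sat_and, sat_eq, sat_exN, sat_allN, sat_imp, sat_mem, sat_spre, sat_lt,
    eval_triple, Tm.eval, Tm.two, Fin.cons_succ, Fin.cons_zero, Nat.reduceAdd]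

theorem sat_isStable {F : Fin m} : (isStable F : Fm n m).Sat S v w ↔
    ∀ s, s ≠ 0 → ∃ c q, c < 2 ∧ (∃ k, q = 2 ^ k) ∧ ∀ t, NPre s t → ¬ t < q + q →
      ntriple s t c ∈ (w F).1 := by
  simp only [isStable, sat_and, sat_neg, sat_eq, sat_exN, sat_allN, sat_imp, sat_mem, sat_spre,
    sat_lt, sat_pow2, eval_triple, Tm.eval, Tm.two, Fin.cons_succ, Fin.cons_zero, Nat.reduceAdd,
    ne_eq]

theorem sat_isSucc {H : Fin m} {s t : Tm n} : (isSucc H s t).Sat S v w ↔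
    t.eval v ∈ (w H).1 ∧ NPre (s.eval v) (t.eval v) ∧
      ¬ ∃ x ∈ (w H).1, NPre (s.eval v) x ∧ NPre x (t.eval v) := by
  simp only [isSucc, sat_and, sat_neg, sat_exN, sat_mem, sat_spre, Tm.eval, Tm.eval_lift,
    Fin.cons_zero]

theorem sat_isRoot {H : Fin m} {t : Tm n} : (isRoot H t).Sat S v w ↔
    t.eval v ∈ (w H).1 ∧ ¬ ∃ x ∈ (w H).1, NPre x (t.eval v) := by
  simp only [isRoot, sat_and, sat_neg, sat_exN, sat_mem, sat_spre, Tm.eval, Tm.eval_lift,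
    Fin.cons_zero]

theorem sat_isFullTree {H : Fin m} : (isFullTree H : Fm n m).Sat S v w ↔
    (∀ x ∈ (w H).1, ¬ x = 0) ∧
    (∃ r, (r ∈ (w H).1 ∧ ¬ ∃ x ∈ (w H).1, NPre x r) ∧
      ∀ r', (r' ∈ (w H).1 ∧ ¬ ∃ x ∈ (w H).1, NPre x r') → r' = r) ∧
    ∀ s ∈ (w H).1, ∃ a b, ¬ a = b ∧ ∀ c, (c ∈ (w H).1 ∧ NPre s c ∧
      ¬ ∃ x ∈ (w H).1, NPre s x ∧ NPre x c) ↔ c = a ∨ c = b := by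
  simp only [isFullTree, sat_and, sat_neg, sat_exN, sat_allN, sat_mem, sat_imp, sat_eq, sat_or,
    sat_iff, sat_isRoot, sat_isSucc, Tm.eval, Fin.cons_succ, Fin.cons_zero]

theorem sat_isHomogeneous {F H : Fin m} : (isHomogeneous F H : Fm n m).Sat S v w ↔
    ∃ c < 2, ∀ s ∈ (w H).1, ∀ t ∈ (w H).1, NPre s t → ntriple s t c ∈ (w F).1 := by
  simp only [isHomogeneous, sat_and, sat_exN, sat_allN, sat_mem, sat_imp, sat_lt, sat_spre,
    eval_triple, Tm.eval, Tm.two, Fin.cons_succ, Fin.cons_zero, Nat.reduceAdd]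
  exact exists_congr fun c => and_congr Iff.rfl
    ⟨fun h s hs t ht => h s t hs ht, fun h s t hs ht => h s hs t ht⟩

end Fm

/-- The set of the binary codes of the elements of `H`. -/
def bcodes (H : Set Str) : Set ℕ := {n | ∃ σ ∈ H, n = bcode σ}

theorem bcode_mem_bcodes {H : Set Str} {σ : Str} : bcode σ ∈ bcodes H ↔ σ ∈ H := by
  constructor
  · rintro ⟨τ, hτ, h⟩
    rwa [bcode_injective h]
  · exact fun h => ⟨σ, h, rfl⟩

theorem dec_bcodes {Y : Set ℕ} {H : Set Str} (h : Dec Y fun σ => σ ∈ H) :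
    Dec Y fun n => n ∈ bcodes H := by
  have h1 : Sig Y fun p : ℕ × Str => p.2 ∈ H ∧ p.1 = bcode p.2 :=
    (h.1.comp (f := fun p : ℕ × Str => p.2) (by fun_prop)).and
      (.of_primrec (primrecPred_eq (by fun_prop) (by fun_prop)))
  have h2 : Sig Y fun p : ℕ × Str => p.2 ∉ H ∧ p.1 = bcode p.2 :=
    (h.2.comp (f := fun p : ℕ × Str => p.2) (by fun_prop)).and
      (.of_primrec (primrecPred_eq (by fun_prop) (by fun_prop)))
  -- Zero is the only number that codes no string.
  refine ⟨h1.ex, (h2.ex.or (.of_primrec (S := fun n : ℕ => n = 0)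
    (primrecPred_eq (by fun_prop) (by fun_prop)))).of_iff fun n => ?_⟩
  constructor
  · intro hn
    by_cases h0 : n = 0
    · exact .inr h0
    · obtain ⟨σ, rfl⟩ := exists_bcode h0
      exact .inl ⟨σ, fun h => hn (bcode_mem_bcodes.2 h), rfl⟩
  · rintro (⟨σ, h, hn⟩ | h0) ⟨τ, h', hn'⟩
    · dsimp only at hn h
      rw [hn'] at hn
      exact h (bcode_injective hn ▸ h')
    · exact bcode_ne_zero τ (hn'.symm.trans h0)

theorem nPre_mem_bcodes {H : Set Str} {t : ℕ} {σ : Str} :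
    (∃ x ∈ bcodes H, NPre t x ∧ NPre x (bcode σ)) ↔ ∃ ξ ∈ H, NPre t (bcode ξ) ∧ SPre ξ σ := by
  constructor
  · rintro ⟨_, ⟨ξ, hξ, rfl⟩, h1, h2⟩
    exact ⟨ξ, hξ, h1, nPre_bcode.1 h2⟩
  · rintro ⟨ξ, hξ, h1, h2⟩
    exact ⟨_, ⟨ξ, hξ, rfl⟩, h1, nPre_bcode.2 h2⟩

/-- A Turing ideal closed under solving instances of the stable tree theorem satisfies the
corresponding sentence. -/
theorem IsIdeal.sat_STT22Sentence {S : Set (Set ℕ)} (hS : IsIdeal S)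
    (hsol : ∀ f : STT22.Inst, STT22.instCode f ∈ S → ∃ H : Set Str, STT22.IsSol f H ∧ codes H ∈ S) :
    STT22Sentence.Sat S (Fin.elim0 : Fin 0 → ℕ) (Fin.elim0 : Fin 0 → S) := by
  simp only [STT22Sentence, Fm.sat_allS, Fm.sat_imp, Fm.sat_and, Fm.sat_exS, Fm.sat_isColoring,
    Fm.sat_isStable, Fm.sat_isFullTree, Fm.sat_isHomogeneous, Fin.cons_zero, Fin.cons_one]
  rintro ⟨F, hF⟩ ⟨⟨hc1, hc2⟩, hst⟩
  dsimp only at hc1 hc2 hst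
  have hex : ∀ p : StrPair, ∃ c : Fin 2, ntriple (bcode p.1.1) (bcode p.1.2) c ∈ F ∧
      ∀ d, ntriple (bcode p.1.1) (bcode p.1.2) d ∈ F → d = c := by
    rintro ⟨⟨σ, τ⟩, h⟩
    obtain ⟨c, h1, h2⟩ := hc2 _ _ (nPre_bcode.2 h)
    obtain ⟨s, t, d, -, hd, he⟩ := hc1 _ h1
    obtain ⟨-, -, rfl⟩ := ntriple_inj he
    exact ⟨⟨c, hd⟩, h1, h2⟩
  choose f hf hf' using hex
  have hval : ∀ (p : StrPair) (c : Fin 2), ntriple (bcode p.1.1) (bcode p.1.2) c ∈ F → f p = c :=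
    fun p c h => (Fin.ext (hf' p c h)).symm
  have hstable : Stable f := by
    intro σ
    obtain ⟨c, q, hc, ⟨k, rfl⟩, h⟩ := hst (bcode σ) (bcode_ne_zero σ)
    refine ⟨⟨c, hc⟩, k, fun τ hτ hlen => hval ⟨(σ, τ), hτ⟩ ⟨c, hc⟩ (h _ (nPre_bcode.2 hτ) ?_)⟩
    -- With `q = 2 ^ k`, length above `k` means a code of at least `2 ^ (k + 1) = q + q`.
    have h1 : 2 ^ (k + 1) ≤ 2 ^ τ.length := Nat.pow_le_pow_right (by norm_num) hlen
    rw [pow_succ] at h1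
    have h2 := bcode_eq τ
    dsimp only
    omega
  -- The two codings of a colouring, arithmetical and by `Encodable`, have to be compared before the
  -- closure of the ideal applies.
  have hdec : Dec F fun k => k ∈ STT22.instCode ⟨f, hstable⟩ := by
    have h1 : Dec F fun q : ℕ × ((Str × Str) × Fin 2) =>
        q.1 = Encodable.encode q.2 ∧ (q.2.1.1 <+: q.2.1.2 ∧ q.2.1.1 ≠ q.2.1.2) ∧
          ntriple (bcode q.2.1.1) (bcode q.2.1.2) q.2.2 ∈ F :=
      (Dec.of_primrec ((primrecPred_eq (by fun_prop) (by fun_prop)))).and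
        ((Dec.of_primrec ((primrecPred_prefix (by fun_prop) (by fun_prop)).and
          (primrecPred_eq (by fun_prop) (by fun_prop)).not)).and
        (Dec.mem.comp (primrec_ntriple (by fun_prop) (by fun_prop)
          (Primrec.fin_val.comp (by fun_prop)))))
    refine (h1.ex_mem (f := fun k : ℕ => (Encodable.decode k : Option ((Str × Str) × Fin 2)).toList)
      (Primrec.optionToList.comp (by fun_prop))).of_iff fun k => ?_
    constructor
    · rintro ⟨p, rfl⟩
      exact ⟨(p.1, f p), by simp, rfl, p.2, hf p⟩
    · rintro ⟨⟨p, c⟩, -, hk, h, hm⟩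
      exact ⟨⟨p, h⟩, hk.trans (by rw [← hval ⟨p, h⟩ c hm])⟩
  obtain ⟨H, ⟨⟨⟨ρ, ⟨hρ, hρ'⟩, hu⟩, hT⟩, c, hH⟩, hHS⟩ := hsol ⟨f, hstable⟩ (hS.down F hF _ hdec)
  have hroot : ∀ σ, (¬ ∃ x ∈ bcodes H, NPre x (bcode σ)) ↔ ¬ ∃ ξ ∈ H, SPre ξ σ := by
    intro σ
    refine not_congr ⟨?_, ?_⟩
    · rintro ⟨_, ⟨ξ, hξ, rfl⟩, h⟩
      exact ⟨ξ, hξ, nPre_bcode.1 h⟩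
    · rintro ⟨ξ, hξ, h⟩
      exact ⟨_, ⟨ξ, hξ, rfl⟩, nPre_bcode.2 h⟩
  refine ⟨⟨bcodes H, hS.down _ hHS _ (dec_bcodes (dec_codes.1 .mem))⟩, ⟨?_, ?_, ?_⟩, c, c.2, ?_⟩
  · rintro _ ⟨σ, -, rfl⟩
    exact bcode_ne_zero σ
  · refine ⟨bcode ρ, ⟨⟨ρ, hρ, rfl⟩, (hroot ρ).2 hρ'⟩, ?_⟩
    rintro _ ⟨⟨σ, hσ, rfl⟩, h⟩
    rw [hu σ ⟨hσ, (hroot σ).1 h⟩]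
  · rintro _ ⟨σ, hσ, rfl⟩
    obtain ⟨α, β, hne, hαβ⟩ := hT σ hσ
    have hsucc : ∀ γ, (bcode γ ∈ bcodes H ∧ NPre (bcode σ) (bcode γ) ∧
        ¬ ∃ x ∈ bcodes H, NPre (bcode σ) x ∧ NPre x (bcode γ)) ↔ IsSucc H σ γ := by
      intro γ
      rw [bcode_mem_bcodes, nPre_bcode, nPre_mem_bcodes]
      simp only [nPre_bcode]
      rfl
    refine ⟨bcode α, bcode β, fun h => hne (bcode_injective h), fun x => ⟨?_, ?_⟩⟩
    · rintro h
      obtain ⟨γ, -, rfl⟩ := h.1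
      rcases (hαβ γ).1 ((hsucc γ).1 h) with rfl | rfl
      · exact .inl rfl
      · exact .inr rfl
    · rintro (rfl | rfl)
      · exact (hsucc α).2 ((hαβ α).2 (.inl rfl))
      · exact (hsucc β).2 ((hαβ β).2 (.inr rfl))
  · rintro _ ⟨σ, hσ, rfl⟩ _ ⟨τ, hτ, rfl⟩ h
    have h1 := hf ⟨(σ, τ), nPre_bcode.1 h⟩
    have h2 : f ⟨(σ, τ), nPre_bcode.1 h⟩ = c := hH ⟨(σ, τ), nPre_bcode.1 h⟩ hσ hτ
    rwa [h2] at h1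

/-! ## A Turing ideal closed under the stable tree theorem that omits a given set -/

theorem countable_dec (Y : Set ℕ) : {A : Set ℕ | Dec Y fun n => n ∈ A}.Countable := by
  have h := (countable_primrecPred (α := List Bool × ℕ)).image
    fun R => {n : ℕ | ∃ k, R (ini (chi Y) k, n)}
  refine h.mono ?_
  rintro A ⟨⟨R, hR, hA⟩, -⟩
  exact ⟨R, hR, by ext n; exact (hA n).symm⟩

theorem instCode_injective {f g : STT22.Inst} (h : STT22.instCode f = STT22.instCode g) :
    f = g := by
  obtain ⟨f, hf⟩ := f
  obtain ⟨g, hg⟩ := g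
  refine Subtype.ext (funext fun p => ?_)
  have : Encodable.encode (p.1, f p) ∈ STT22.instCode ⟨g, hg⟩ := by
    rw [← h]
    exact ⟨p, rfl⟩
  obtain ⟨q, hq⟩ := this
  have hq := Encodable.encode_injective hq
  simp only [Prod.mk.injEq] at hq
  obtain ⟨h1, h2⟩ := hq
  obtain rfl : p = q := Subtype.ext h1
  exact h2

/-- Cone avoidance is iterated along an increasing sequence of oracles, with bookkeeping that treats
every instance computable from some oracle; the ideal consists of the sets computable from one of
them. -/
theorem exists_ideal {C : Set ℕ} (hC : ¬ Dec ∅ fun n => n ∈ C) :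
    ∃ S : Set (Set ℕ), IsIdeal S ∧ C ∉ S ∧ ∀ f : STT22.Inst, STT22.instCode f ∈ S →
      ∃ H : Set Str, STT22.IsSol f H ∧ codes H ∈ S := by
  choose e he using fun Y : Set ℕ => (countable_dec Y).exists_eq_range ⟨Y, Dec.mem⟩
  have hstep : ∀ (Y : {Y : Set ℕ // ¬ Dec Y fun n => n ∈ C}) (A : Set ℕ),
      ∃ Y' : {Y : Set ℕ // ¬ Dec Y fun n => n ∈ C}, (Dec Y'.1 fun n => n ∈ Y.1) ∧
        ∀ f : STT22.Inst, STT22.instCode f = A → (Dec Y.1 fun n => n ∈ A) →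
          ∃ H, STT22.IsSol f H ∧ Dec Y'.1 fun n => n ∈ codes H := by
    rintro ⟨Y, hY⟩ A
    by_cases h : ∃ f : STT22.Inst, STT22.instCode f = A ∧ Dec Y fun n => n ∈ A
    · obtain ⟨f, rfl, hf⟩ := h
      obtain ⟨H, h1, h2⟩ := exists_solution hY f hf
      refine ⟨⟨join (codes H) Y, h2⟩, dec_join_right _ _, fun g hg _ => ?_⟩
      obtain rfl := instCode_injective hg
      exact ⟨H, h1, dec_join_left _ _⟩
    · exact ⟨⟨Y, hY⟩, .mem, fun f hf hA => absurd ⟨f, hf, hA⟩ h⟩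
  choose step h1 h2 using hstep
  -- The first component records the earlier oracles. At stage `s = ⟨j, i⟩` the `i`-th set
  -- computable from the `j`-th oracle is treated, and `j ≤ s` ensures that this oracle is known.
  let seq : ℕ → (ℕ → Set ℕ) × {Y : Set ℕ // ¬ Dec Y fun n => n ∈ C} := fun n =>
    n.rec (fun _ => ∅, ⟨∅, hC⟩) fun s p =>
      let h := Function.update p.1 s p.2.1
      (h, step p.2 (e (h s.unpair.1) s.unpair.2))
  let Y : ℕ → Set ℕ := fun s => (seq s).2.1
  have hhist : ∀ s j, j ≤ s → (seq (s + 1)).1 j = Y j := by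
    intro s j hj
    induction s with
    | zero =>
      obtain rfl : j = 0 := by omega
      rfl
    | succ s ih =>
      by_cases hjs : j = s + 1
      · subst hjs
        exact Function.update_self ..
      · exact (Function.update_of_ne hjs ..).trans (ih (by omega))
  have hmono : ∀ s t, s ≤ t → Dec (Y t) fun n => n ∈ Y s := by
    intro s t hst
    induction t, hst using Nat.le_induction with
    | base => exact .mem
    | succ t _ ih => exact ih.trans (h1 _ _)
  refine ⟨{A | ∃ s, Dec (Y s) fun n => n ∈ A}, ⟨⟨0, ?_⟩, ?_, ?_⟩, ?_, ?_⟩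
  · exact .mem
  · rintro A ⟨s, hA⟩ B hB
    exact ⟨s, hB.trans hA⟩
  · rintro A ⟨s, hA⟩ B ⟨t, hB⟩
    exact ⟨max s t, dec_join (hA.trans (hmono _ _ (le_max_left _ _)))
      (hB.trans (hmono _ _ (le_max_right _ _)))⟩
  · rintro ⟨s, hs⟩
    exact (seq s).2.2 hs
  · rintro f ⟨j, hf⟩
    obtain ⟨i, hi⟩ : STT22.instCode f ∈ Set.range (e (Y j)) := he (Y j) ▸ hf
    have hj : j ≤ Nat.pair j i := Nat.left_le_pair _ _
    have hA : e ((seq (Nat.pair j i + 1)).1 (Nat.pair j i).unpair.1) (Nat.pair j i).unpair.2 =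
        STT22.instCode f := by
      rw [hhist _ _ (by simpa using hj), Nat.unpair_pair, hi]
    obtain ⟨H, h3, h4⟩ := h2 (seq (Nat.pair j i)).2 _ f hA.symm
      (by
        have h5 := hf.trans (hmono _ _ hj)
        exact hA ▸ h5)
    exact ⟨H, h3, Nat.pair j i + 1, h4⟩

/-! ## The halting set -/

/-- The codes of the pairs `⟨x, s⟩` such that the `x`-th machine halts within `s` steps. -/
def haltingTimes : Set ℕ :=
  {k | ∃ x s, k = npair x s ∧ (Nat.Partrec.Code.evaln s (Denumerable.ofNat _ x) 0).isSome = true}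

/-- The halting set. -/
def haltingSet : Set ℕ := {x | (Nat.Partrec.Code.eval (Denumerable.ofNat _ x) 0).Dom}

theorem mem_haltingSet {x : ℕ} : x ∈ haltingSet ↔ ∃ s, npair x s ∈ haltingTimes := by
  constructor
  · intro h
    obtain ⟨y, hy⟩ := Part.dom_iff_mem.1 h
    obtain ⟨s, hs⟩ := Nat.Partrec.Code.evaln_complete.1 hy
    exact ⟨s, x, s, rfl, Option.isSome_iff_exists.2 ⟨y, hs⟩⟩
  · rintro ⟨s, x', s', h, hs⟩
    obtain ⟨rfl, rfl⟩ := npair_inj h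
    obtain ⟨y, hy⟩ := Option.isSome_iff_exists.1 hs
    exact Part.dom_iff_mem.2 ⟨y, Nat.Partrec.Code.evaln_complete.2 ⟨s, hy⟩⟩

theorem dec_haltingTimes : Dec ∅ fun k => k ∈ haltingTimes := by
  have h1 : PrimrecPred fun q : (ℕ × ℕ) × ℕ => q.1.1 = npair q.1.2 q.2 ∧
      (Nat.Partrec.Code.evaln q.2 (Denumerable.ofNat _ q.1.2) 0).isSome = true := by
    refine PrimrecPred.and (primrecPred_eq (by fun_prop) (by simp only [npair]; fun_prop))
      (primrecPred_eq ?_ (by fun_prop))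
    refine Primrec.option_isSome.comp (Nat.Partrec.Code.primrec_evaln.comp
      (f := fun a : (ℕ × Nat.Partrec.Code) × ℕ => Nat.Partrec.Code.evaln a.1.1 a.1.2 a.2)
      (g := fun q : (ℕ × ℕ) × ℕ => ((q.2, Denumerable.ofNat _ q.1.2), 0)) ?_)
    exact ((Primrec.snd).pair ((Primrec.ofNat _).comp (by fun_prop))).pair (Primrec.const 0)
  have h2 := primrecPred_exists_lt (primrecPred_exists_lt h1 (f := fun q : ℕ × ℕ => q.1 + 1)
    (by fun_prop)) (f := fun k : ℕ => k + 1) (by fun_prop)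
  refine (Dec.of_primrec h2).of_iff fun k => ?_
  constructor
  · rintro ⟨x, s, h, hs⟩
    have : x ≤ k ∧ s ≤ k := by
      rw [h, npair]
      have := Nat.le_mul_self (x + s)
      omega
    exact ⟨x, by omega, s, by dsimp only; omega, h, hs⟩
  · rintro ⟨x, -, s, -, h, hs⟩
    exact ⟨x, s, h, hs⟩

theorem not_dec_haltingSet : ¬ Dec ∅ fun n => n ∈ haltingSet := by
  intro h
  have h := setTuringLE_iff.2 h
  -- A constant oracle gives nothing, so reducibility to the empty set is plain computability.
  have he : charFun ∅ = fun _ => Part.some 0 := by funext n; simp [charFun]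
  rw [SetTuringLE, he] at h
  have h := h.partrec_of_const
  classical
  have hg : Computable fun n => if n ∈ haltingSet then 1 else 0 := h
  refine ComputablePred.halting_problem 0 (ComputablePred.computable_iff.2
    ⟨fun c => decide ((if Encodable.encode c ∈ haltingSet then 1 else 0) = 1), ?_, ?_⟩)
  · exact (PrimrecPred.decide (primrecPred_eq primrec_id (primrec_const 1))).to_comp.comp
      (hg.comp Computable.encode)
  · funext c
    simp [haltingSet]

/-- `∃ y, ⟨x, y⟩ ∈ X`. -/
def projection : Fm (0 + 1) 1 := (Fm.mem (Tm.pair Tm.x1 Tm.x0) 0).exN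

theorem isArith_projection : IsArith projection :=
  .imp (.allN (.imp (.mem _ _) .falsum)) .falsum

/-- One instance of arithmetical comprehension suffices: projecting the computable set
`haltingTimes` would put the halting set into the ideal. -/
theorem not_proves_ACA0 :
    ¬ ∀ φ ∈ ACA0, Proves RCA0 (STT22Sentence.imp φ) := by
  intro h
  obtain ⟨S, hS, hC, hsol⟩ := exists_ideal not_dec_haltingSet
  have hcomp := (h _ (.inr ⟨0, 1, projection, isArith_projection, rfl⟩)).sound hS.sat_RCA0
    Fin.elim0 Fin.elim0 (by simp) (hS.sat_STT22Sentence hsol)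
  rw [Fm.sat_close] at hcomp
  have := hcomp Fin.elim0
    (fun _ => ⟨haltingTimes, hS.down _ hS.empty_mem _ dec_haltingTimes⟩)
  simp only [comprehension, Fm.sat_exS, Fm.sat_allN, Fm.sat_iff, Fm.sat_mem, Fm.sat_liftS,
    projection, Fm.sat_exN, Tm.pair, Tm.eval, Fin.cons_zero, Fin.cons_succ] at this
  obtain ⟨X, hX⟩ := this
  refine hC ?_
  have : haltingSet = X.1 := by
    ext x
    rw [hX, mem_haltingSet]
    rfl
  exact this ▸ X.2

end TreeThm

theorem mainTheorem6 :
    TreeThm.STT22.AdmitsConeAvoidance ∧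
      ¬ ∀ φ ∈ TreeThm.ACA0, TreeThm.Proves TreeThm.RCA0 (TreeThm.STT22Sentence.imp φ) :=
  ⟨TreeThm.admitsConeAvoidance, TreeThm.not_proves_ACA0⟩
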